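/- Let $M$ be a smooth $n$-manifold with $n\ge 3$, let $\mathcal E\to M$ be a smooth real vector bundle of rank $n$ with a (positive definite, smooth) fibre metric $\langle\,,\rangle$ and a metric connection $D$, and let $\phi:TM\to\mathcal E$ be a smooth bundle homomorphism. Definitions. $(M,\mathcal E,\langle\,,\rangle,D,\phi)$ is a coherent tangent bundle if $D_X\phi(Y)-D_Y\phi(X)-\phi([X,Y])=0$ for all smooth vector fields $X,Y$ on $M$. The regular set $\mathcal R_\phi$ is the set of $p\in M$ at which $\phi_p:T_pM\to\mathcal E_p$ is injective; on it $g=\phi^*\langle\,,\rangle$ is a Riemannian metric, with Schouten tensor $$A_{ij}=\frac1{n-2}\Bigl(R_{ij}-\frac{S_g}{2(n-1)}g_{ij}\Bigr)$$ ($R_{ij}$ the Ricci tensor and $S_g$ the scalar curvature of $g$) and associated endomorphism field $\hat A=\sum_{i,j,a} g^{ia}A_{aj}\,\frac{\partial}{\partial u^i}\otimes du^j$. A coherent tangent bundle is a GCF-manifold if $\mathcal R_\phi$ is dense in $M$ and $g$ is conformally flat on $\mathcal R_\phi$, i.e. each point of $\mathcal R_\phi$ has a neighbourhood $U\subset\mathcal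 R_\phi$ and a smooth function $\sigma$ on $U$ such that $e^{2\sigma}g$ has vanishing sectional curvature on $U$. A GCF-manifold is admissible if the set $\mathcal R_\phi^*$ of points of $\mathcal R_\phi$ at which $A$ is non-degenerate is dense in $M$, and the homomorphism $v\mapsto\phi(\hat A v)$, defined on $TM|_{\mathcal R_\phi}$, extends to a smooth bundle homomorphism $\check\phi:TM\to\mathcal E$ (which is then unique, and is called the dual of $\phi$). Theorem. Let $(M,\mathcal E,\langle\,,\rangle,D,\phi)$ be an admissible GCF-manifold of dimension $n\ge3$, with dual homomorphism $\check\phi$. Then $(M,\mathcal E,\langle\,,\rangle,D,\check\phi)$ is also an admissible GCF-manifold, and its dual homomorphism $\check{\check\phi}$ is $\phi$. -/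

import Mathlib

open Bundle Manifold
open scoped ContDiff

noncomputable section

namespace GCF

/-! ## Riemannian geometry in coordinates

`G : ℝⁿ → Mat_n(ℝ)` is the matrix `(g_ij)` of a metric as a function of the coordinates. -/

section Coordinates

variable {n : ℕ}

/-- The partial derivative `∂f/∂uⁱ` at `u`. -/
def pderiv (i : Fin n) (f : EuclideanSpace ℝ (Fin n) → ℝ) (u : EuclideanSpace ℝ (Fin n)) : ℝ :=
  fderiv ℝ f u (EuclideanSpace.single i 1)

/-- The Christoffel symbol `Γᵏ_ij` of the Levi-Civita connection. -/
def christoffel (G : EuclideanSpace ℝ (Fin n) → Matrix (Fin n) (Fin n) ℝ) (k i j : Fin n)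
    (u : EuclideanSpace ℝ (Fin n)) : ℝ :=
  (1 / 2) * ∑ l, (G u)⁻¹ k l * (pderiv i (fun x => G x j l) u + pderiv j (fun x => G x i l) u
    - pderiv l (fun x => G x i j) u)

/-- The coefficient `Rˡ_ijk` in `R(∂_i, ∂_j) ∂_k = ∑ₗ Rˡ_ijk ∂_l`, where
`R(X, Y) Z = ∇_X ∇_Y Z - ∇_Y ∇_X Z - ∇_[X, Y] Z`. -/
def riemannUp (G : EuclideanSpace ℝ (Fin n) → Matrix (Fin n) (Fin n) ℝ) (l i j k : Fin n)
    (u : EuclideanSpace ℝ (Fin n)) : ℝ :=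
  pderiv i (christoffel G l j k) u - pderiv j (christoffel G l i k) u
    + ∑ m, (christoffel G m j k u * christoffel G l i m u
      - christoffel G m i k u * christoffel G l j m u)

/-- `R_ijkl = g(R(∂_i, ∂_j) ∂_k, ∂_l)`. -/
def riemannLow (G : EuclideanSpace ℝ (Fin n) → Matrix (Fin n) (Fin n) ℝ) (i j k l : Fin n)
    (u : EuclideanSpace ℝ (Fin n)) : ℝ :=
  ∑ m, riemannUp G m i j k u * G u m l

/-- The Ricci tensor `R_jk`, the trace of `X ↦ R(X, ∂_j) ∂_k`. -/
def ricci (G : EuclideanSpace ℝ (Fin n) → Matrix (Fin n) (Fin n) ℝ) (j k : Fin n)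
    (u : EuclideanSpace ℝ (Fin n)) : ℝ :=
  ∑ i, riemannUp G i i j k u

/-- The scalar curvature. -/
def scalarCurvature (G : EuclideanSpace ℝ (Fin n) → Matrix (Fin n) (Fin n) ℝ)
    (u : EuclideanSpace ℝ (Fin n)) : ℝ :=
  ∑ j, ∑ k, (G u)⁻¹ j k * ricci G j k u

/-- The matrix `(A_ij)` of the Schouten tensor,
`A_ij = (R_ij - S / (2 (n - 1)) g_ij) / (n - 2)`. -/
def schoutenMatrix (G : EuclideanSpace ℝ (Fin n) → Matrix (Fin n) (Fin n) ℝ)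
    (u : EuclideanSpace ℝ (Fin n)) : Matrix (Fin n) (Fin n) ℝ :=
  Matrix.of fun i j =>
    (1 / ((n : ℝ) - 2)) * (ricci G i j u - scalarCurvature G u / (2 * ((n : ℝ) - 1)) * G u i j)

/-- The sectional curvature
`R(a, b, b, a) / (g(a, a) g(b, b) - g(a, b)²)` of the plane spanned by the vectors with
components `a`, `b`. -/
def sectionalCoord (G : EuclideanSpace ℝ (Fin n) → Matrix (Fin n) (Fin n) ℝ)
    (u : EuclideanSpace ℝ (Fin n)) (a b : Fin n → ℝ) : ℝ :=
  (∑ i, ∑ j, ∑ k, ∑ l, riemannLow G i j k l u * a i * b j * b k * a l) /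
    ((G u).toBilin' a a * (G u).toBilin' b b - (G u).toBilin' a b ^ 2)

end Coordinates

/-! ## Metrics on a manifold

A symmetric covariant `2`-tensor field is a bilinear form on each tangent space. -/

section Tensors

variable {n : ℕ} {M : Type*} [TopologicalSpace M] [ChartedSpace (EuclideanSpace ℝ (Fin n)) M]

/-- The components `T_pM → ℝⁿ` of a tangent vector at `p` in the coordinates `(u¹, …, uⁿ)` of the
chart at `p`. -/
def components (p : M) : TangentSpace (𝓡 n) p →ₗ[ℝ] (Fin n → ℝ) :=
  (EuclideanSpace.equiv (Fin n) ℝ).toLinearMap ∘ₗ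
    (mfderiv (𝓡 n) 𝓘(ℝ, EuclideanSpace ℝ (Fin n)) (extChartAt (𝓡 n) p) p).toLinearMap

/-- The coordinate vector field `∂_i = ∂/∂uⁱ` of the chart at `p`, at the point with
coordinates `u`. -/
def coordVector (p : M) (u : EuclideanSpace ℝ (Fin n)) (i : Fin n) :
    TangentSpace (𝓡 n) ((extChartAt (𝓡 n) p).symm u) :=
  mfderiv 𝓘(ℝ, EuclideanSpace ℝ (Fin n)) (𝓡 n) (extChartAt (𝓡 n) p).symm u
    (EuclideanSpace.single i (1 : ℝ) : EuclideanSpace ℝ (Fin n))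

/-- The tangent vector `∑ᵢ aⁱ ∂_i` at `p`, where `∂_i` are the coordinate vectors of the chart
at `p`; this is the inverse of `components p`. -/
def ofComponents (p : M) : (Fin n → ℝ) →ₗ[ℝ] TangentSpace (𝓡 n) p :=
  ((mfderiv (𝓡 n) 𝓘(ℝ, EuclideanSpace ℝ (Fin n)) (extChartAt (𝓡 n) p) p).inverse).toLinearMap ∘ₗ
    (EuclideanSpace.equiv (Fin n) ℝ).symm.toLinearMap

/-- The coefficients `g_ij = g(∂_i, ∂_j)` in the chart at `p`, as functions of the coordinates. -/
def coeffs (g : ∀ q : M, LinearMap.BilinForm ℝ (TangentSpace (𝓡 n) q)) (p : M)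
    (u : EuclideanSpace ℝ (Fin n)) : Matrix (Fin n) (Fin n) ℝ :=
  Matrix.of fun i j => g ((extChartAt (𝓡 n) p).symm u) (coordVector p u i) (coordVector p u j)

/-- The Schouten tensor `A` of `g` at `p`. -/
def schouten (g : ∀ q : M, LinearMap.BilinForm ℝ (TangentSpace (𝓡 n) q)) (p : M) :
    LinearMap.BilinForm ℝ (TangentSpace (𝓡 n) p) :=
  (schoutenMatrix (coeffs g p) (extChartAt (𝓡 n) p p)).toBilin'.comp (components p) (components p)

/-- The Schouten tensor as an endomorphism of `T_pM`,
`Â = ∑ gⁱᵃ A_aj ∂_i ⊗ duʲ`. -/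
def schoutenHat (g : ∀ q : M, LinearMap.BilinForm ℝ (TangentSpace (𝓡 n) q)) (p : M) :
    TangentSpace (𝓡 n) p →ₗ[ℝ] TangentSpace (𝓡 n) p :=
  ofComponents p ∘ₗ
    Matrix.toLin' ((coeffs g p (extChartAt (𝓡 n) p p))⁻¹ *
      schoutenMatrix (coeffs g p) (extChartAt (𝓡 n) p p)) ∘ₗ components p

/-- The sectional curvature of `g` at `p` along the plane spanned by `v` and `w`. -/
def sectionalCurvature (g : ∀ q : M, LinearMap.BilinForm ℝ (TangentSpace (𝓡 n) q)) (p : M)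
    (v w : TangentSpace (𝓡 n) p) : ℝ :=
  sectionalCoord (coeffs g p) (extChartAt (𝓡 n) p p) (components p v) (components p w)

/-- `g` is conformally flat on the open set `R`: each point of `R` has a neighbourhood `U` in `R`
and a smooth function `σ` on `U` such that `e^{2σ} g` has vanishing sectional curvature on `U`. -/
def IsConformallyFlatOn (g : ∀ q : M, LinearMap.BilinForm ℝ (TangentSpace (𝓡 n) q))
    (R : Set M) : Prop :=
  ∀ p ∈ R, ∃ U : Set M, IsOpen U ∧ p ∈ U ∧ U ⊆ R ∧ ∃ σ : M → ℝ,
    ContMDiffOn (𝓡 n) 𝓘(ℝ, ℝ) ∞ σ U ∧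
    ∀ q ∈ U, ∀ v w : TangentSpace (𝓡 n) q, LinearIndependent ℝ ![v, w] →
      sectionalCurvature (fun x => Real.exp (2 * σ x) • g x) q v w = 0

end Tensors

/-! ## Coherent tangent bundles -/

section CoherentTangentBundle

variable {n : ℕ} {M : Type*} [TopologicalSpace M] [ChartedSpace (EuclideanSpace ℝ (Fin n)) M]
  [IsManifold (𝓡 n) ∞ M]
  {F : Type*} [NormedAddCommGroup F] [NormedSpace ℝ F] [FiniteDimensional ℝ F]
  {E : M → Type*} [TopologicalSpace (TotalSpace F E)]
  [∀ p, NormedAddCommGroup (E p)] [∀ p, InnerProductSpace ℝ (E p)]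
  [FiberBundle F E] [VectorBundle ℝ F E] [ContMDiffVectorBundle ∞ F E (𝓡 n)]
  [IsContMDiffRiemannianBundle (𝓡 n) ∞ F E]

variable (F) in
/-- The fibrewise linear map `φ : TM → E` is a smooth bundle homomorphism, that is, a smooth
section of `Hom(TM, E)`. -/
def IsSmoothHom (φ : ∀ p : M, TangentSpace (𝓡 n) p →L[ℝ] E p) : Prop :=
  ContMDiff (𝓡 n) ((𝓡 n).prod 𝓘(ℝ, EuclideanSpace ℝ (Fin n) →L[ℝ] F)) ∞
    (fun p => (⟨p, φ p⟩ : TotalSpace (EuclideanSpace ℝ (Fin n) →L[ℝ] F)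
      (fun p : M => TangentSpace (𝓡 n) p →L[ℝ] E p)))

/-- `X` is a smooth vector field on `M`. -/
def IsSmoothVectorField (X : ∀ p : M, TangentSpace (𝓡 n) p) : Prop :=
  ContMDiff (𝓡 n) (𝓡 n).tangent ∞ (fun p => (⟨p, X p⟩ : TangentBundle (𝓡 n) M))

/-- `(M, E, ⟨ , ⟩, D, φ)` is a coherent tangent bundle: `D` is a smooth metric connection and `φ`
is a smooth bundle homomorphism with `D_X φ(Y) - D_Y φ(X) - φ([X, Y]) = 0` for all smooth vector
fields `X`, `Y`. (`D s p v` is the derivative `D_v s` of the section `s` along `v ∈ T_pM`.) -/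
structure IsCoherentTangentBundle (D : CovariantDerivative (𝓡 n) F E)
    (φ : ∀ p : M, TangentSpace (𝓡 n) p →L[ℝ] E p) : Prop where
  smooth_connection : CovariantDerivative.ContMDiffCovariantDerivative D ∞
  metric_connection : D.IsMetricCompatible
  smooth_hom : IsSmoothHom F φ
  coherent : ∀ X Y : ∀ p : M, TangentSpace (𝓡 n) p,
    IsSmoothVectorField X → IsSmoothVectorField Y → ∀ p : M,
      D (fun q => φ q (Y q)) p (X p) - D (fun q => φ q (X q)) p (Y p)
        - φ p (VectorField.mlieBracket (𝓡 n) X Y p) = 0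

/-- The set of regular points of `φ`. -/
def regularSet (φ : ∀ p : M, TangentSpace (𝓡 n) p →L[ℝ] E p) : Set M :=
  {p | Function.Injective (φ p)}

/-- The pull-back metric `φ^*⟨ , ⟩`. -/
def pullbackMetric (φ : ∀ p : M, TangentSpace (𝓡 n) p →L[ℝ] E p) (p : M) :
    LinearMap.BilinForm ℝ (TangentSpace (𝓡 n) p) :=
  (innerₗ (E p)).compl₁₂ (φ p).toLinearMap (φ p).toLinearMap

/-- The set of non-parabolic regular points: those where the Schouten tensor of the pull-back
metric is non-degenerate. -/
def nonparabolicSet (φ : ∀ p : M, TangentSpace (𝓡 n) p →L[ℝ] E p) : Set M :=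
  {p | p ∈ regularSet φ ∧ (schouten (pullbackMetric φ) p).Nondegenerate}

/-- A generalized conformally flat manifold (a notion used for `n ≥ 3`): the regular points are
dense, and the pull-back metric is conformally flat on the set of regular points. -/
structure IsGCF (D : CovariantDerivative (𝓡 n) F E)
    (φ : ∀ p : M, TangentSpace (𝓡 n) p →L[ℝ] E p) : Prop where
  isCoherentTangentBundle : IsCoherentTangentBundle D φ
  dense_regularSet : Dense (regularSet φ)
  conformallyFlat : IsConformallyFlatOn (pullbackMetric φ) (regularSet φ)

variable (F) in
/-- `ψ` is a smooth extension to all of `TM` of the homomorphism `v ↦ φ(Â v)`, which is defined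
over the regular set of `φ`. -/
def IsDual (φ ψ : ∀ p : M, TangentSpace (𝓡 n) p →L[ℝ] E p) : Prop :=
  IsSmoothHom F ψ ∧
    ∀ p ∈ regularSet φ, ∀ v : TangentSpace (𝓡 n) p,
      ψ p v = φ p (schoutenHat (pullbackMetric φ) p v)

/-- An admissible GCF-manifold (`n ≥ 3`): the non-parabolic points are dense, and `φ ∘ Â` extends
smoothly to all of `TM`. -/
structure IsAdmissibleGCF (D : CovariantDerivative (𝓡 n) F E)
    (φ : ∀ p : M, TangentSpace (𝓡 n) p →L[ℝ] E p) : Prop extends IsGCF D φ where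
  dense_nonparabolicSet : Dense (nonparabolicSet φ)
  exists_dual : ∃ ψ : ∀ p : M, TangentSpace (𝓡 n) p →L[ℝ] E p, IsDual F φ ψ

end CoherentTangentBundle

end GCF

end

noncomputable section

namespace GCF

open Filter Topology

set_option maxSynthPendingDepth 3
set_option linter.unusedSectionVars false

/-! ## Connections on a trivial bundle over a normed space -/

section LocalCalculus

variable {X Y F : Type*} [NormedAddCommGroup X] [NormedSpace ℝ X]
  [NormedAddCommGroup Y] [NormedSpace ℝ Y] [NormedAddCommGroup F] [NormedSpace ℝ F]

/-! The theorem rests on a system of local equations that treats a homomorphism and its dual alike.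
In a chart and a trivialization the structure consists of a fibre metric `H`, a connection form `θ`
parallelizing `H`, and an `F`-valued one-form `Φ` with `dΦ + θ ∧ Φ = 0`. The equations, collected in
`DualAt`, say that the local form `Ψ` of the dual is also closed for the connection, that `⟨Φ, Ψ⟩`
is symmetric, and that the curvature of `θ` is minus the Kulkarni–Nomizu type product of `Φ` and
`Ψ`. Since that product is symmetric in its two factors and `Φ` is itself closed, `DualAt.swap`
exchanges the roles of `Φ` and `Ψ`.

From conformal flatness to the equations: the metric `e^{2σ} g` is induced by `e^σ Φ`, which is
closed for a modified metric connection on the same bundle with the same `H`. Its curvature differs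
from that of `θ` by the product of `Φ` with `B = Dξ - ⟨ξ, Φ⟩ ξ + |ξ|²/2 Φ`, where `ξ` represents
`dσ` (`curvForm_confForm`). If the new curvature vanishes, the curvature of `θ` is minus this
product. Contracting it gives `⟨Φ, B⟩` as the Schouten tensor (`schoutenMatrix_gram`), so `B` is the
local form of `φ ∘ Â`. Closedness of `B` is the Codazzi equation (`coherentAt_confSchouten`). This
settles regular points; all three equations are closed conditions, so density and smoothness of the
extension carry them to the remaining points (`IsGCF.dualAt`).

From the equations back to conformal flatness: they make a connection on `ℝ × F × ℝ` flat
(`curvForm_tractorForm`). A parallel section starting at the null vector `(1, 0, 0)` stays null for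
an invariant quadratic form, and minus the logarithm of its first entry is the exponent of a flat
conformal change (`CoherentNear.exists_flat`). The swapped equations thus give conformal flatness of
the metric of `ψ` on its regular set.

The same equations give the rest. Where `⟨φ, ψ⟩` is non-degenerate `ψ` is injective, so the
non-parabolic points of `φ` are non-parabolic for `ψ`, and density passes over. At every regular
point of `ψ` the swapped curvature equation identifies `ψ` composed with its own Schouten
endomorphism as `φ`; uniqueness of continuous extension from a dense set finishes the biduality.

The passage between coordinate tensors and the connection is `riemannUp_gram`: metricity and
closedness make `Φ` intertwine the Levi-Civita connection with `θ`. The pull-back lemmas handle the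
fact that tensors at a point are defined in that point's own chart. -/

theorem fderiv_apply_const {c : X → Y →L[ℝ] F} {x : X} (hc : DifferentiableAt ℝ c x) (u : X)
    (v : Y) : fderiv ℝ (fun y => c y v) x u = fderiv ℝ c x u v := by
  rw [fderiv_clm_apply hc (differentiableAt_const v)]
  simp

/-- The covariant derivative `D_v s = ds(v) + θ(v) s` along a constant vector `v`. -/
def covD (θ : X → X →L[ℝ] F →L[ℝ] F) (s : X → F) (v x : X) : F :=
  fderiv ℝ s x v + θ x v (s x)

/-- The curvature `dθ + θ ∧ θ` of a connection form. -/
def curvForm (θ : X → X →L[ℝ] F →L[ℝ] F) (x u v : X) : F →L[ℝ] F :=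
  fderiv ℝ θ x u v - fderiv ℝ θ x v u + (θ x u ∘L θ x v - θ x v ∘L θ x u)

/-- The fibre metric `H` is parallel at `x`. -/
def MetricAt (H : X → F →L[ℝ] F →L[ℝ] ℝ) (θ : X → X →L[ℝ] F →L[ℝ] F) (x : X) : Prop :=
  ∀ (v : X) (a b : F), fderiv ℝ H x v a b = H x (θ x v a) b + H x a (θ x v b)

/-- The `F`-valued one-form `Φ` is closed at `x` with respect to the connection. -/
def CoherentAt (θ : X → X →L[ℝ] F →L[ℝ] F) (Φ : X → X →L[ℝ] F) (x : X) : Prop :=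
  ∀ u v : X, fderiv ℝ Φ x u v + θ x u (Φ x v) = fderiv ℝ Φ x v u + θ x v (Φ x u)

/-- The Kulkarni–Nomizu type product of two `F`-valued one-forms. -/
def kulkarni (h : F →L[ℝ] F →L[ℝ] ℝ) (P Q : X →L[ℝ] F) (u v : X) (a : F) : F :=
  h (Q u) a • P v - h (P v) a • Q u - h (Q v) a • P u + h (P u) a • Q v

theorem kulkarni_comm (h : F →L[ℝ] F →L[ℝ] ℝ) (P Q : X →L[ℝ] F) (u v : X) (a : F) :
    kulkarni h P Q u v a = kulkarni h Q P u v a := by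
  simp only [kulkarni]; module

variable {H : X → F →L[ℝ] F →L[ℝ] ℝ} {θ : X → X →L[ℝ] F →L[ℝ] F} {Φ Ψ : X → X →L[ℝ] F} {x : X}

theorem covD_apply (hΦ : DifferentiableAt ℝ Φ x) (u v : X) :
    covD θ (fun y => Φ y v) u x = fderiv ℝ Φ x u v + θ x u (Φ x v) := by
  rw [covD, fderiv_apply_const hΦ]

theorem coherentAt_iff_covD (hΦ : DifferentiableAt ℝ Φ x) : CoherentAt θ Φ x ↔
    ∀ u v, covD θ (fun y => Φ y v) u x = covD θ (fun y => Φ y u) v x := by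
  simp only [CoherentAt, covD_apply hΦ]

theorem fderiv_covD {s : X → F} (hs : ContDiffAt ℝ 2 s x) (hθ : DifferentiableAt ℝ θ x) (u v : X) :
    fderiv ℝ (covD θ s v) x u
      = fderiv ℝ (fderiv ℝ s) x u v + (fderiv ℝ θ x u v (s x) + θ x v (fderiv ℝ s x u)) := by
  have hs1 : DifferentiableAt ℝ s x := hs.differentiableAt (by norm_num)
  have hs2 : DifferentiableAt ℝ (fderiv ℝ s) x :=
    (hs.fderiv_right (m := 1) (by norm_num)).differentiableAt (by norm_num)
  have hθv : DifferentiableAt ℝ (fun y => θ y v) x := hθ.clm_apply (differentiableAt_const v)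
  have h : covD θ s v = fun y => fderiv ℝ s y v + θ y v (s y) := rfl
  rw [h, fderiv_fun_add (hs2.clm_apply (differentiableAt_const v)) (hθv.clm_apply hs1)]
  rw [add_apply, fderiv_apply_const hs2, fderiv_clm_apply hθv hs1]
  simp [fderiv_apply_const hθ]
  abel

theorem covD_comm {s : X → F} (hs : ContDiffAt ℝ 2 s x) (hθ : DifferentiableAt ℝ θ x) (u v : X) :
    covD θ (covD θ s v) u x - covD θ (covD θ s u) v x = curvForm θ x u v (s x) := by
  have hsym : fderiv ℝ (fderiv ℝ s) x u v = fderiv ℝ (fderiv ℝ s) x v u :=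
    (hs.isSymmSndFDerivAt (by simp)).eq u v
  have h1 := fderiv_covD hs hθ u v
  have h2 := fderiv_covD hs hθ v u
  rw [hsym] at h1
  have e : ∀ (t : X → F) (v : X), covD θ t v x = fderiv ℝ t x v + θ x v (t x) := fun _ _ => rfl
  rw [e (covD θ s v) u, e (covD θ s u) v, h1, h2]
  simp only [covD, curvForm, add_apply, sub_apply,
    ContinuousLinearMap.comp_apply, map_add]
  abel

theorem covD_congr {s t : X → F} (h : s =ᶠ[𝓝 x] t) (v : X) : covD θ s v x = covD θ t v x := by
  rw [covD, covD, h.fderiv_eq, h.eq_of_nhds]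

/-- Applying the exterior covariant derivative to `dΦ + θ ∧ Φ = 0` gives the first Bianchi identity.
Concretely, writing each curvature as a commutator, the six second covariant derivatives cancel in
pairs. -/
theorem curvForm_bianchi (hΦ : ContDiffAt ℝ 2 Φ x) (hθ : DifferentiableAt ℝ θ x)
    (hc : ∀ᶠ y in 𝓝 x, CoherentAt θ Φ y) (u v w : X) :
    curvForm θ x u v (Φ x w) + curvForm θ x v w (Φ x u) + curvForm θ x w u (Φ x v) = 0 := by
  have hd : ∀ᶠ y in 𝓝 x, DifferentiableAt ℝ Φ y :=
    (hΦ.eventually (by simp)).mono fun y hy => hy.differentiableAt (by norm_num)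
  have key : ∀ a b c : X, covD θ (covD θ (fun y => Φ y b) a) c x
      = covD θ (covD θ (fun y => Φ y a) b) c x := fun a b c => by
    apply covD_congr
    filter_upwards [hc, hd] with y hy hdy
    exact (coherentAt_iff_covD hdy).1 hy a b
  have hs : ∀ w, ContDiffAt ℝ 2 (fun y => Φ y w) x := fun w => hΦ.clm_apply contDiffAt_const
  rw [← covD_comm (hs w) hθ, ← covD_comm (hs u) hθ, ← covD_comm (hs v) hθ,
    key u v w, key v w u, key w u v]
  abel

theorem hasFDerivAt_metric {s t : X → F} (hH : DifferentiableAt ℝ H x)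
    (hs : DifferentiableAt ℝ s x) (ht : DifferentiableAt ℝ t x) (u : X) :
    fderiv ℝ (fun y => H y (s y) (t y)) x u
      = fderiv ℝ H x u (s x) (t x) + H x (fderiv ℝ s x u) (t x) + H x (s x) (fderiv ℝ t x u) := by
  rw [fderiv_clm_apply (hH.clm_apply hs) ht]
  simp only [add_apply, ContinuousLinearMap.comp_apply,
    ContinuousLinearMap.flip_apply]
  rw [fderiv_clm_apply hH hs]
  simp only [add_apply, ContinuousLinearMap.comp_apply,
    ContinuousLinearMap.flip_apply]
  ring

theorem MetricAt.fderiv_apply {s t : X → F} (hm : MetricAt H θ x) (hH : DifferentiableAt ℝ H x)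
    (hs : DifferentiableAt ℝ s x) (ht : DifferentiableAt ℝ t x) (u : X) :
    fderiv ℝ (fun y => H y (s y) (t y)) x u
      = H x (covD θ s u x) (t x) + H x (s x) (covD θ t u x) := by
  rw [hasFDerivAt_metric hH hs ht, hm]
  simp only [covD, map_add, add_apply]
  ring

/-- Differentiating the function `H(a, b)` twice by the metric product rule and using symmetry of
second derivatives leaves only the commutator terms; the mixed first-order terms are symmetric in
`u`, `v`. -/
theorem curvForm_skew (hH : ContDiffAt ℝ 2 H x) (hθ : ContDiffAt ℝ 1 θ x)
    (hm : ∀ᶠ y in 𝓝 x, MetricAt H θ y) (u v : X) (a b : F) :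
    H x (curvForm θ x u v a) b + H x a (curvForm θ x u v b) = 0 := by
  have hH1 : DifferentiableAt ℝ H x := hH.differentiableAt (by norm_num)
  have hθ1 : DifferentiableAt ℝ θ x := hθ.differentiableAt (by norm_num)
  have hd : ∀ᶠ y in 𝓝 x, DifferentiableAt ℝ H y :=
    (hH.eventually (by simp)).mono fun y hy => hy.differentiableAt (by norm_num)
  have hg : ContDiffAt ℝ 2 (fun y => H y a b) x :=
    (hH.clm_apply contDiffAt_const).clm_apply contDiffAt_const
  have hcov : ∀ (c : F) (v : X), DifferentiableAt ℝ (covD θ (fun _ => c) v) x := fun c v => by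
    have : covD θ (fun _ => c) v = fun y => θ y v c := by ext y; simp [covD]
    rw [this]
    exact (hθ1.clm_apply (differentiableAt_const v)).clm_apply (differentiableAt_const c)
  have key : ∀ u v : X, fderiv ℝ (fderiv ℝ fun y => H y a b) x u v
      = (H x (covD θ (covD θ (fun _ => a) v) u x) b
          + H x (covD θ (fun _ => a) v x) (covD θ (fun _ => b) u x))
        + (H x (covD θ (fun _ => a) u x) (covD θ (fun _ => b) v x)
          + H x a (covD θ (covD θ (fun _ => b) v) u x)) := fun u v => by
    rw [← fderiv_apply_const ((hg.fderiv_right (m := 1) (by norm_num)).differentiableAt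
      (by norm_num))]
    have : (fun y => fderiv ℝ (fun y => H y a b) y v) =ᶠ[𝓝 x]
        fun y => H y (covD θ (fun _ => a) v y) b + H y a (covD θ (fun _ => b) v y) := by
      filter_upwards [hm, hd] with y hy hdy
      exact hy.fderiv_apply hdy (differentiableAt_const a) (differentiableAt_const b) v
    rw [this.fderiv_eq, fderiv_fun_add
      ((hH1.clm_apply (hcov a v)).clm_apply (differentiableAt_const b))
      ((hH1.clm_apply (differentiableAt_const a)).clm_apply (hcov b v)),
      add_apply,
      hm.self_of_nhds.fderiv_apply hH1 (hcov a v) (differentiableAt_const b),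
      hm.self_of_nhds.fderiv_apply hH1 (differentiableAt_const a) (hcov b v)]
  have hsym := (hg.isSymmSndFDerivAt (by simp)).eq u v
  rw [key, key] at hsym
  have ha := covD_comm (s := fun _ => a) contDiffAt_const hθ1 u v
  have hb := covD_comm (s := fun _ => b) contDiffAt_const hθ1 u v
  rw [← ha, ← hb, map_sub, map_sub, sub_apply]
  linarith

/-! ### Pull-back -/

variable {f : Y → X} {y : Y}

/-- The pull-back of a one-form. -/
def pullForm {Z : Type*} [NormedAddCommGroup Z] [NormedSpace ℝ Z] (f : Y → X) (Φ : X → X →L[ℝ] Z)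
    (y : Y) : Y →L[ℝ] Z :=
  Φ (f y) ∘L fderiv ℝ f y

/-- The term with the second derivative of `f` is symmetric in `u`, `v`, so it disappears from every
antisymmetrized expression below. -/
theorem fderiv_pullForm {Z : Type*} [NormedAddCommGroup Z] [NormedSpace ℝ Z]
    {Φ : X → X →L[ℝ] Z} (hf : ContDiffAt ℝ 2 f y) (hΦ : DifferentiableAt ℝ Φ (f y)) (u v : Y) :
    fderiv ℝ (pullForm f Φ) y u v = fderiv ℝ Φ (f y) (fderiv ℝ f y u) (fderiv ℝ f y v)
      + Φ (f y) (fderiv ℝ (fderiv ℝ f) y u v) := by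
  have hf1 : DifferentiableAt ℝ f y := hf.differentiableAt (by norm_num)
  have hf2 : DifferentiableAt ℝ (fderiv ℝ f) y :=
    (hf.fderiv_right (m := 1) (by norm_num)).differentiableAt (by norm_num)
  have h1 : DifferentiableAt ℝ (fun y => Φ (f y)) y := hΦ.comp y hf1
  have h : pullForm f Φ = fun y => (Φ (f y)) ∘L fderiv ℝ f y := rfl
  rw [h, ((h1.hasFDerivAt).clm_comp hf2.hasFDerivAt).fderiv]
  have : fderiv ℝ (fun y => Φ (f y)) y = fderiv ℝ Φ (f y) ∘L fderiv ℝ f y :=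
    fderiv_comp y hΦ hf1
  simp [this]
  abel

theorem CoherentAt.pullForm (hf : ContDiffAt ℝ 2 f y) (hΦ : DifferentiableAt ℝ Φ (f y))
    (hc : CoherentAt θ Φ (f y)) : CoherentAt (pullForm f θ) (pullForm f Φ) y := fun u v => by
  have hsym := (hf.isSymmSndFDerivAt (by simp)).eq u v
  have := hc (fderiv ℝ f y u) (fderiv ℝ f y v)
  rw [fderiv_pullForm hf hΦ, fderiv_pullForm hf hΦ, hsym]
  simp only [GCF.pullForm, ContinuousLinearMap.comp_apply]
  rw [add_right_comm, this]
  abel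

theorem MetricAt.pullForm (hf : DifferentiableAt ℝ f y) (hH : DifferentiableAt ℝ H (f y))
    (hm : MetricAt H θ (f y)) : MetricAt (fun y => H (f y)) (pullForm f θ) y := fun v a b => by
  have : fderiv ℝ (fun y => H (f y)) y = fderiv ℝ H (f y) ∘L fderiv ℝ f y :=
    fderiv_comp (G := F →L[ℝ] F →L[ℝ] ℝ) y hH hf
  rw [this]
  exact hm _ a b

theorem curvForm_pullForm (hf : ContDiffAt ℝ 2 f y) (hθ : DifferentiableAt ℝ θ (f y)) (u v : Y) :
    curvForm (pullForm f θ) y u v = curvForm θ (f y) (fderiv ℝ f y u) (fderiv ℝ f y v) := by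
  have hsym := (hf.isSymmSndFDerivAt (by simp)).eq u v
  rw [curvForm, fderiv_pullForm hf hθ, fderiv_pullForm hf hθ, hsym]
  simp only [curvForm, GCF.pullForm, ContinuousLinearMap.comp_apply]
  abel

/-! ### Conformal change -/

/-- The connection form of the conformally changed coherent structure, `ξ` being the gradient of
the conformal exponent. -/
def confForm (H : X → F →L[ℝ] F →L[ℝ] ℝ) (θ : X → X →L[ℝ] F →L[ℝ] F) (Φ : X → X →L[ℝ] F)
    (ξ : X → F) (x : X) : X →L[ℝ] F →L[ℝ] F :=
  θ x + (ContinuousLinearMap.smulRightL ℝ F F (H x (ξ x)) ∘L Φ x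
    - (ContinuousLinearMap.smulRightL ℝ F F).flip (ξ x) ∘L H x ∘L Φ x)

/-- The one-form `Dξ - ⟨ξ, Φ⟩ ξ + |ξ|²/2 Φ`. -/
def confSchouten (H : X → F →L[ℝ] F →L[ℝ] ℝ) (θ : X → X →L[ℝ] F →L[ℝ] F) (Φ : X → X →L[ℝ] F)
    (ξ : X → F) (x : X) : X →L[ℝ] F :=
  fderiv ℝ ξ x + (θ x).flip (ξ x) - (H x (ξ x) ∘L Φ x).smulRight (ξ x)
    + (1 / 2 * H x (ξ x) (ξ x)) • Φ x

variable {ξ : X → F} {σ : X → ℝ}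

theorem confForm_apply (v : X) (a : F) : confForm H θ Φ ξ x v a
    = θ x v a + (H x (ξ x) a • Φ x v - H x (Φ x v) a • ξ x) := by
  simp [confForm]

theorem confSchouten_apply (v : X) : confSchouten H θ Φ ξ x v
    = covD θ ξ v x - H x (ξ x) (Φ x v) • ξ x + (1 / 2 * H x (ξ x) (ξ x)) • Φ x v := by
  simp [confSchouten, covD]

/-- The endomorphism added to `θ` is skew for `H`, whatever `ξ` is. -/
theorem MetricAt.confForm (hm : MetricAt H θ x) (hsymm : ∀ a b, H x a b = H x b a) :
    MetricAt H (confForm H θ Φ ξ) x := fun v a b => by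
  rw [hm, confForm_apply, confForm_apply]
  simp only [map_add, map_sub, map_smul, add_apply,
    sub_apply, smul_apply, smul_eq_mul]
  rw [hsymm a (Φ x v), hsymm a (ξ x)]
  ring

/-- Differentiating the factor `e^σ` produces `dσ ∧ Φ`; since `ξ` represents `dσ`, the correction to
the connection form produces its negative. -/
theorem CoherentAt.confForm (hc : CoherentAt θ Φ x) (hΦ : DifferentiableAt ℝ Φ x)
    (hσ : DifferentiableAt ℝ σ x) (hξ : ∀ v, H x (ξ x) (Φ x v) = fderiv ℝ σ x v)
    (hsymm : ∀ a b, H x a b = H x b a) :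
    CoherentAt (confForm H θ Φ ξ) (fun y => Real.exp (σ y) • Φ y) x := fun u v => by
  have hd : ∀ u, fderiv ℝ (fun y => Real.exp (σ y) • Φ y) x u
      = Real.exp (σ x) • fderiv ℝ Φ x u + (Real.exp (σ x) * fderiv ℝ σ x u) • Φ x := fun u => by
    have h := hσ.hasFDerivAt.exp.fun_smul hΦ.hasFDerivAt
    rw [h.fderiv]
    simp
  have := hc u v
  have h2 : fderiv ℝ Φ x u v = fderiv ℝ Φ x v u + θ x v (Φ x u) - θ x u (Φ x v) := by
    rw [← this]; abel
  rw [hd, hd, confForm_apply, confForm_apply]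
  simp only [add_apply, smul_apply, map_smul, hξ,
    hsymm (Φ x v) (Φ x u), h2, smul_eq_mul]
  module

/-- The conformal transformation law of the curvature. It is an identity for an arbitrary
differentiable `ξ`; being a gradient matters only for the symmetry of `confSchouten` and for
closedness of the rescaled form. -/
theorem curvForm_confForm (hH : DifferentiableAt ℝ H x) (hθ : DifferentiableAt ℝ θ x)
    (hΦ : DifferentiableAt ℝ Φ x) (hξ : DifferentiableAt ℝ ξ x) (hm : MetricAt H θ x)
    (hc : CoherentAt θ Φ x) (hsymm : ∀ a b, H x a b = H x b a) (u v : X) (a : F) :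
    curvForm (confForm H θ Φ ξ) x u v a
      = curvForm θ x u v a + kulkarni (H x) (Φ x) (confSchouten H θ Φ ξ x) u v a := by
  have hdiff : DifferentiableAt ℝ (confForm H θ Φ ξ) x := by
    have h1 : DifferentiableAt ℝ (fun y => H y (ξ y)) x := hH.clm_apply hξ
    have h2 : DifferentiableAt ℝ
        (fun y => ContinuousLinearMap.smulRightL ℝ F F (H y (ξ y)) ∘L Φ y) x :=
      ((ContinuousLinearMap.smulRightL ℝ F F).differentiableAt.comp x h1).clm_comp hΦ
    have h3 : DifferentiableAt ℝ
        (fun y => (ContinuousLinearMap.smulRightL ℝ F F).flip (ξ y) ∘L H y ∘L Φ y) x :=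
      ((ContinuousLinearMap.smulRightL ℝ F F).flip.differentiableAt.comp x hξ).clm_comp
        (hH.clm_comp hΦ)
    exact hθ.fun_add (h2.fun_sub h3)
  have hθv : ∀ v a, DifferentiableAt ℝ (fun y => θ y v a) x := fun v a => by fun_prop
  have hΦv : ∀ v, DifferentiableAt ℝ (fun y => Φ y v) x := fun v => by fun_prop
  have hd : ∀ u v, fderiv ℝ (confForm H θ Φ ξ) x u v a
      = fderiv ℝ θ x u v a
        + ((H x (covD θ ξ u x) a + H x (ξ x) (θ x u a)) • Φ x v + H x (ξ x) a • fderiv ℝ Φ x u v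
        - ((H x (fderiv ℝ Φ x u v + θ x u (Φ x v)) a + H x (Φ x v) (θ x u a)) • ξ x
          + H x (Φ x v) a • fderiv ℝ ξ x u)) := fun u v => by
    rw [← fderiv_apply_const hdiff, ← fderiv_apply_const (hdiff.clm_apply
      (differentiableAt_const v))]
    have e : (fun y => confForm H θ Φ ξ y v a) = fun y =>
        θ y v a + (H y (ξ y) a • Φ y v - H y (Φ y v) a • ξ y) := by
      ext1 y; exact confForm_apply v a
    have h1 : DifferentiableAt ℝ (fun y => H y (ξ y) a) x :=
      (hH.clm_apply hξ).clm_apply (differentiableAt_const a)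
    have h2 : DifferentiableAt ℝ (fun y => H y (Φ y v) a) x :=
      (hH.clm_apply (hΦv v)).clm_apply (differentiableAt_const a)
    rw [e, fderiv_fun_add (hθv v a) ((h1.fun_smul (hΦv v)).fun_sub (h2.fun_smul hξ)),
      fderiv_fun_sub (h1.fun_smul (hΦv v)) (h2.fun_smul hξ), fderiv_fun_smul h1 (hΦv v),
      fderiv_fun_smul h2 hξ]
    simp only [add_apply, sub_apply,
      smul_apply, ContinuousLinearMap.smulRight_apply]
    rw [hm.fderiv_apply hH hξ (differentiableAt_const a),
      hm.fderiv_apply hH (hΦv v) (differentiableAt_const a), covD_apply hΦ]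
    rw [fderiv_apply_const (hθ.clm_apply (differentiableAt_const v)), fderiv_apply_const hθ,
      fderiv_apply_const hΦ]
    simp only [covD, fderiv_fun_const, Pi.zero_apply, zero_apply, zero_add]
    module
  have h2 : fderiv ℝ Φ x u v = fderiv ℝ Φ x v u + θ x v (Φ x u) - θ x u (Φ x v) := by
    rw [← hc u v]; abel
  simp only [curvForm, kulkarni, add_apply, sub_apply,
    ContinuousLinearMap.comp_apply, hd, confForm_apply, confSchouten_apply, map_add, map_sub,
    map_smul, smul_apply, h2, smul_eq_mul, hsymm (Φ x _) (ξ x), covD,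
    hsymm (Φ x v) (Φ x u)]
  module

end LocalCalculus

/-! ### The Codazzi equation for the conformal Schouten form -/

section Codazzi

variable {X F : Type*} [NormedAddCommGroup X] [NormedSpace ℝ X]
  [NormedAddCommGroup F] [NormedSpace ℝ F]
  {H : X → F →L[ℝ] F →L[ℝ] ℝ} {θ : X → X →L[ℝ] F →L[ℝ] F} {Φ : X → X →L[ℝ] F} {x : X}
  {ξ : X → F} {σ : X → ℝ}

theorem covD_add {s t : X → F} (hs : DifferentiableAt ℝ s x) (ht : DifferentiableAt ℝ t x) (v : X) :
    covD θ (fun y => s y + t y) v x = covD θ s v x + covD θ t v x := by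
  rw [covD, fderiv_fun_add hs ht]
  simp only [covD, add_apply, map_add]
  abel

theorem covD_sub {s t : X → F} (hs : DifferentiableAt ℝ s x) (ht : DifferentiableAt ℝ t x) (v : X) :
    covD θ (fun y => s y - t y) v x = covD θ s v x - covD θ t v x := by
  rw [covD, fderiv_fun_sub hs ht]
  simp only [covD, sub_apply, map_sub]
  abel

theorem covD_smul {g : X → ℝ} {s : X → F} (hg : DifferentiableAt ℝ g x)
    (hs : DifferentiableAt ℝ s x) (v : X) :
    covD θ (fun y => g y • s y) v x = fderiv ℝ g x v • s x + g x • covD θ s v x := by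
  rw [covD, fderiv_fun_smul hg hs]
  simp only [covD, add_apply, smul_apply, map_smul, ContinuousLinearMap.smulRight_apply, smul_add]
  abel

theorem covD_sum {ι : Type*} (S : Finset ι) {s : ι → X → F}
    (hs : ∀ i ∈ S, DifferentiableAt ℝ (s i) x) (v : X) :
    covD θ (fun y => ∑ i ∈ S, s i y) v x = ∑ i ∈ S, covD θ (s i) v x := by
  rw [covD, fderiv_fun_sum hs]
  simp [covD, Finset.sum_add_distrib]

/-- This is the symmetry of the Hessian of `σ`: closedness of `Φ` makes the term containing `DΦ`
symmetric, so what is left of the second derivative is symmetric too. -/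
theorem covD_gradient_symm (hH : DifferentiableAt ℝ H x) (hΦ : DifferentiableAt ℝ Φ x)
    (hξ : DifferentiableAt ℝ ξ x) (hσ : ContDiffAt ℝ 2 σ x) (hm : MetricAt H θ x)
    (hc : CoherentAt θ Φ x) (hgrad : ∀ᶠ y in 𝓝 x, ∀ v, H y (ξ y) (Φ y v) = fderiv ℝ σ y v)
    (u v : X) : H x (covD θ ξ u x) (Φ x v) = H x (covD θ ξ v x) (Φ x u) := by
  have hsym := (hσ.isSymmSndFDerivAt (by simp)).eq u v
  have hd : DifferentiableAt ℝ (fderiv ℝ σ) x :=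
    (hσ.fderiv_right (m := 1) (by norm_num)).differentiableAt (by norm_num)
  have key : ∀ u v, fderiv ℝ (fderiv ℝ σ) x u v
      = H x (covD θ ξ u x) (Φ x v) + H x (ξ x) (covD θ (fun y => Φ y v) u x) := fun u v => by
    rw [← fderiv_apply_const hd]
    have : (fun y => fderiv ℝ σ y v) =ᶠ[𝓝 x] fun y => H y (ξ y) (Φ y v) := by
      filter_upwards [hgrad] with y hy
      exact (hy v).symm
    rw [this.fderiv_eq, hm.fderiv_apply hH hξ (hΦ.clm_apply (differentiableAt_const v))]
  rw [key, key, (coherentAt_iff_covD hΦ).1 hc u v] at hsym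
  linarith

theorem confSchouten_symm (hsymm : ∀ a b, H x a b = H x b a)
    (hξ : ∀ u v, H x (covD θ ξ u x) (Φ x v) = H x (covD θ ξ v x) (Φ x u)) (u v : X) :
    H x (Φ x u) (confSchouten H θ Φ ξ x v) = H x (Φ x v) (confSchouten H θ Φ ξ x u) := by
  simp only [confSchouten_apply, map_add, map_sub, map_smul, smul_eq_mul]
  rw [hsymm (Φ x u) (covD θ ξ v x), hsymm (Φ x v) (covD θ ξ u x), hξ u v, hsymm (Φ x u) (ξ x),
    hsymm (Φ x v) (ξ x), hsymm (Φ x u) (Φ x v)]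
  ring

/-- Antisymmetrizing the derivative of `B` produces the curvature applied to `ξ`, and the assumed
form of the curvature turns it into exactly the negative of the derivatives of the two quadratic
terms. The argument uses no second Bianchi identity, so it is uniform in the dimension. -/
theorem coherentAt_confSchouten (hH : DifferentiableAt ℝ H x) (hθ : ContDiffAt ℝ 1 θ x)
    (hΦ : ContDiffAt ℝ 1 Φ x) (hξ : ContDiffAt ℝ 2 ξ x)
    (hB : DifferentiableAt ℝ (confSchouten H θ Φ ξ) x) (hm : MetricAt H θ x)
    (hc : CoherentAt θ Φ x) (hsymm : ∀ a b, H x a b = H x b a)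
    (hξs : ∀ u v, H x (covD θ ξ u x) (Φ x v) = H x (covD θ ξ v x) (Φ x u))
    (hcurv : ∀ u v a, curvForm θ x u v a
      = -kulkarni (H x) (Φ x) (confSchouten H θ Φ ξ x) u v a) :
    CoherentAt θ (confSchouten H θ Φ ξ) x := by
  have hθ1 : DifferentiableAt ℝ θ x := hθ.differentiableAt (by norm_num)
  have hΦ1 : DifferentiableAt ℝ Φ x := hΦ.differentiableAt (by norm_num)
  have hξ1 : DifferentiableAt ℝ ξ x := hξ.differentiableAt (by norm_num)
  have hξ2 : DifferentiableAt ℝ (fderiv ℝ ξ) x :=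
    (hξ.fderiv_right (m := 1) (by norm_num)).differentiableAt (by norm_num)
  have hΦv : ∀ v, DifferentiableAt ℝ (fun y => Φ y v) x := fun v =>
    hΦ1.clm_apply (differentiableAt_const v)
  have hHξ : DifferentiableAt ℝ (fun y => H y (ξ y)) x := hH.clm_apply hξ1
  have hDξ : ∀ v, DifferentiableAt ℝ (covD θ ξ v) x := fun v =>
    (hξ2.clm_apply (differentiableAt_const v)).fun_add
      ((hθ1.clm_apply (differentiableAt_const v)).clm_apply hξ1)
  have h1 : ∀ v, DifferentiableAt ℝ (fun y => H y (ξ y) (Φ y v)) x := fun v =>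
    hHξ.clm_apply (hΦv v)
  have h2 : DifferentiableAt ℝ (fun y => 1 / 2 * H y (ξ y) (ξ y)) x :=
    (hHξ.clm_apply hξ1).const_mul _
  rw [coherentAt_iff_covD hB]
  have key : ∀ u v, covD θ (fun y => confSchouten H θ Φ ξ y v) u x
      = covD θ (covD θ ξ v) u x
        - ((H x (covD θ ξ u x) (Φ x v) + H x (ξ x) (covD θ (fun y => Φ y v) u x)) • ξ x
          + H x (ξ x) (Φ x v) • covD θ ξ u x)
        + (H x (covD θ ξ u x) (ξ x) • Φ x v
          + (1 / 2 * H x (ξ x) (ξ x)) • covD θ (fun y => Φ y v) u x) := fun u v => by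
    have e : (fun y => confSchouten H θ Φ ξ y v) = fun y =>
        (covD θ ξ v y - H y (ξ y) (Φ y v) • ξ y) + (1 / 2 * H y (ξ y) (ξ y)) • Φ y v := by
      ext1 y; rw [confSchouten_apply]
    rw [e, covD_add ((hDξ v).fun_sub ((h1 v).fun_smul hξ1)) (h2.fun_smul (hΦv v)),
      covD_sub (hDξ v) ((h1 v).fun_smul hξ1), covD_smul (h1 v) hξ1, covD_smul h2 (hΦv v),
      hm.fderiv_apply hH hξ1 (hΦv v), fderiv_const_mul (hHξ.clm_apply hξ1)]
    simp only [smul_apply]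
    rw [hm.fderiv_apply hH hξ1 hξ1, hsymm (ξ x) (covD θ ξ u x)]
    congr 3
    simp only [smul_eq_mul]
    ring
  intro u v
  rw [← sub_eq_zero]
  have hcomm := covD_comm hξ hθ1 u v
  rw [hcurv] at hcomm
  rw [key, key, hξs v u, (coherentAt_iff_covD hΦ1).1 hc v u,
    sub_eq_iff_eq_add.1 hcomm]
  simp only [kulkarni, confSchouten_apply, map_add, map_sub, map_smul, add_apply, sub_apply,
    smul_apply, smul_eq_mul, hsymm (Φ x _) (ξ x)]
  module

end Codazzi

/-! ### Algebraic curvature tensors and sectional curvature -/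

section SectionalAlgebra

/-- An algebraic curvature tensor all of whose sectional curvatures vanish is zero. -/
theorem curvatureTensor_eq_zero {X : Type*} [AddCommGroup X]
    (T : X → X → X → X → ℝ) (ha : ∀ a a' b c d, T (a + a') b c d = T a b c d + T a' b c d)
    (hb : ∀ a b b' c d, T a (b + b') c d = T a b c d + T a b' c d)
    (hc : ∀ a b c c' d, T a b (c + c') d = T a b c d + T a b c' d)
    (hd : ∀ a b c d d', T a b c (d + d') = T a b c d + T a b c d')
    (h1 : ∀ a b c d, T a b c d = -T b a c d)
    (h2 : ∀ a b c d, T a b c d = -T a b d c)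
    (h3 : ∀ a b c d, T a b c d + T b c a d + T c a b d = 0) (h : ∀ a b, T a b b a = 0)
    (a b c d : X) : T a b c d = 0 := by
  have pair : ∀ a b c d, T a b c d = T c d a b := fun a b c d => by
    linarith [h3 a b c d, h3 b c d a, h3 c d a b, h3 d a b c, h1 a b c d, h2 a b c d,
      h1 c d a b, h2 c d a b, h1 b c a d, h2 b c a d, h1 c a b d, h2 c a b d, h1 b c d a,
      h2 b c d a, h1 c d b a, h2 c d b a, h1 d b c a, h2 d b c a, h1 d a c b, h2 d a c b,
      h1 a c d b, h2 a c d b, h1 d a b c, h2 d a b c, h1 a b d c, h2 a b d c, h1 b d a c,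
      h2 b d a c, h1 a d b c, h2 a d b c, h2 d b a c, h1 b d c a]
  -- Polarizing in the outer pair, and below in the inner pair, makes `T` skew in its two middle
  -- arguments as well; the three terms of the cyclic identity then coincide.
  have polar : ∀ a b c, T a b b c = 0 := fun a b c => by
    have e := h (a + c) b
    simp only [ha, hd, h] at e
    have := pair c b b a
    have e1 := h1 b a c b
    have e2 := h2 a b c b
    linarith
  have skew : ∀ a b c d, T a b c d = -T a c b d := fun a b c d => by
    have e := polar a (b + c) d
    simp only [hb, hc, polar] at e
    linarith
  linarith [h3 a b c d, skew a b c d, h1 a c b d, h1 b c a d, skew b a c d, h1 a b c d]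

theorem cauchySchwarz_strict {F : Type*} [AddCommGroup F] [Module ℝ F]
    (h : F →ₗ[ℝ] F →ₗ[ℝ] ℝ) (hsymm : ∀ a b, h a b = h b a) (hpos : ∀ a, a ≠ 0 → 0 < h a a)
    {a b : F} (hab : LinearIndependent ℝ ![a, b]) : 0 < h a a * h b b - h a b ^ 2 := by
  have hb : b ≠ 0 := hab.ne_zero 1
  -- Up to the factor `h b b` this is the component of `a` orthogonal to `b`.
  have hv : h b b • a - h a b • b ≠ 0 := fun h0 => by
    have := LinearIndependent.pair_iff.1 hab (h b b) (-h a b) (by rw [← h0]; module)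
    exact (hpos b hb).ne' this.1
  have e := hpos _ hv
  have : h (h b b • a - h a b • b) (h b b • a - h a b • b)
      = h b b * (h a a * h b b - h a b ^ 2) := by
    simp only [map_sub, map_smul, LinearMap.sub_apply, LinearMap.smul_apply, smul_eq_mul,
      hsymm b a]
    ring
  rw [this] at e
  exact pos_of_mul_pos_right e (hpos b hb).le

end SectionalAlgebra

/-! ### Levi-Civita curvature of the induced metric in terms of the connection form -/

section Gram

variable {n : ℕ} {F : Type*} [NormedAddCommGroup F] [NormedSpace ℝ F]

/-- The Gram matrix of the images of the coordinate vectors. -/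
def gram (H : EuclideanSpace ℝ (Fin n) → F →L[ℝ] F →L[ℝ] ℝ)
    (Φ : EuclideanSpace ℝ (Fin n) → EuclideanSpace ℝ (Fin n) →L[ℝ] F)
    (x : EuclideanSpace ℝ (Fin n)) : Matrix (Fin n) (Fin n) ℝ :=
  Matrix.of fun i j =>
    H x (Φ x (EuclideanSpace.single i 1)) (Φ x (EuclideanSpace.single j 1))

theorem euclidean_eq_sum (v : EuclideanSpace ℝ (Fin n)) :
    v = ∑ i, v i • EuclideanSpace.single i (1 : ℝ) := by
  ext j
  simp [Finset.sum_apply, Pi.single_apply]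

theorem clm_eq_sum {Z : Type*} [NormedAddCommGroup Z] [NormedSpace ℝ Z]
    (T : EuclideanSpace ℝ (Fin n) →L[ℝ] Z) (v : EuclideanSpace ℝ (Fin n)) :
    T v = ∑ i, v i • T (EuclideanSpace.single i 1) := by
  conv_lhs => rw [euclidean_eq_sum v]
  simp

variable {H : EuclideanSpace ℝ (Fin n) → F →L[ℝ] F →L[ℝ] ℝ}
  {θ : EuclideanSpace ℝ (Fin n) → EuclideanSpace ℝ (Fin n) →L[ℝ] F →L[ℝ] F}
  {Φ : EuclideanSpace ℝ (Fin n) → EuclideanSpace ℝ (Fin n) →L[ℝ] F} {x : EuclideanSpace ℝ (Fin n)}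

theorem gram_mulVec (c : Fin n → ℝ) (l : Fin n) : (gram H Φ x).mulVec c l
    = H x (Φ x (EuclideanSpace.single l 1)) (Φ x (WithLp.toLp 2 c)) := by
  rw [clm_eq_sum (Φ x) (WithLp.toLp 2 c), map_sum]
  simp [gram, Matrix.mulVec, dotProduct, mul_comm]

theorem gram_isUnit_det (hpos : ∀ a, a ≠ 0 → 0 < H x a a) (hinj : Function.Injective (Φ x)) :
    IsUnit (gram H Φ x).det := by
  rw [isUnit_iff_ne_zero]
  intro h0
  obtain ⟨c, hc, hGc⟩ := Matrix.exists_mulVec_eq_zero_iff.2 h0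
  have hc' : (WithLp.toLp 2 c : EuclideanSpace ℝ (Fin n)) ≠ 0 := by simpa using hc
  have hne : Φ x (WithLp.toLp 2 c) ≠ 0 := fun h => hc' (hinj (by rw [h, map_zero]))
  have := hpos _ hne
  have e := clm_eq_sum ((H x).flip (Φ x (WithLp.toLp 2 c)) ∘L Φ x) (WithLp.toLp 2 c)
  simp only [ContinuousLinearMap.comp_apply, ContinuousLinearMap.flip_apply] at e
  have h2 : ∀ l, H x (Φ x (EuclideanSpace.single l 1)) (Φ x (WithLp.toLp 2 c)) = 0 := fun l => by
    rw [← gram_mulVec, hGc]; rfl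
  simp [e, h2] at this

theorem pderiv_gram (hH : DifferentiableAt ℝ H x) (hΦ : DifferentiableAt ℝ Φ x)
    (hm : MetricAt H θ x) (i j k : Fin n) :
    pderiv k (fun y => gram H Φ y i j) x
      = H x (covD θ (fun y => Φ y (EuclideanSpace.single i 1)) (EuclideanSpace.single k 1) x)
          (Φ x (EuclideanSpace.single j 1))
        + H x (Φ x (EuclideanSpace.single i 1))
          (covD θ (fun y => Φ y (EuclideanSpace.single j 1)) (EuclideanSpace.single k 1) x) :=
  hm.fderiv_apply hH (hΦ.clm_apply (differentiableAt_const _))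
    (hΦ.clm_apply (differentiableAt_const _)) _

/-- The Koszul formula: metricity expands each derivative of the Gram matrix into two terms and
closedness makes all but two equal ones cancel. Hence `Φ` carries the Levi-Civita connection of the
induced metric to the given connection. -/
theorem christoffel_gram (hH : DifferentiableAt ℝ H x) (hΦ : DifferentiableAt ℝ Φ x)
    (hm : MetricAt H θ x) (hc : CoherentAt θ Φ x) (hsymm : ∀ a b, H x a b = H x b a)
    (hpos : ∀ a, a ≠ 0 → 0 < H x a a) (hinj : Function.Injective (Φ x))
    {c : EuclideanSpace ℝ (Fin n)} {i j : Fin n}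
    (hΦc : Φ x c = covD θ (fun y => Φ y (EuclideanSpace.single j 1)) (EuclideanSpace.single i 1) x)
    (k : Fin n) : christoffel (gram H Φ) k i j x = c k := by
  have hcoh := (coherentAt_iff_covD hΦ).1 hc
  have hl : ∀ l, pderiv i (fun y => gram H Φ y j l) x + pderiv j (fun y => gram H Φ y i l) x
      - pderiv l (fun y => gram H Φ y i j) x = 2 * (gram H Φ x).mulVec c l := fun l => by
    rw [pderiv_gram hH hΦ hm, pderiv_gram hH hΦ hm, pderiv_gram hH hΦ hm, gram_mulVec,
      show (WithLp.toLp 2 (c : Fin n → ℝ) : EuclideanSpace ℝ (Fin n)) = c from rfl, hΦc,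
      hcoh (EuclideanSpace.single j 1) (EuclideanSpace.single i 1),
      hcoh (EuclideanSpace.single l 1) (EuclideanSpace.single i 1),
      hcoh (EuclideanSpace.single l 1) (EuclideanSpace.single j 1),
      hsymm (Φ x (EuclideanSpace.single j 1)), hsymm (Φ x (EuclideanSpace.single l 1)),
      hsymm (Φ x (EuclideanSpace.single i 1))]
    ring
  have hinv : (gram H Φ x)⁻¹.mulVec ((gram H Φ x).mulVec c) = c := by
    rw [Matrix.mulVec_mulVec, Matrix.nonsing_inv_mul _ (gram_isUnit_det hpos hinj),
      Matrix.one_mulVec]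
  have := congrFun hinv k
  rw [← this, christoffel]
  simp only [hl]
  rw [Matrix.mulVec, dotProduct, Finset.mul_sum]
  exact Finset.sum_congr rfl fun l _ => by ring

theorem toBilin'_gram (a b : Fin n → ℝ) : (gram H Φ x).toBilin' a b
    = H x (Φ x (WithLp.toLp 2 a)) (Φ x (WithLp.toLp 2 b)) := by
  have e := clm_eq_sum ((H x).flip (Φ x (WithLp.toLp 2 b)) ∘L Φ x) (WithLp.toLp 2 a)
  simp only [ContinuousLinearMap.comp_apply, ContinuousLinearMap.flip_apply] at e
  rw [Matrix.toBilin'_apply', e]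
  simp [dotProduct, gram_mulVec]

theorem riemannLow_gram
    {R : EuclideanSpace ℝ (Fin n) →L[ℝ] EuclideanSpace ℝ (Fin n) →L[ℝ] F →L[ℝ] F}
    (hR : ∀ i j k, ∑ l, riemannUp (gram H Φ) l i j k x • Φ x (EuclideanSpace.single l 1)
      = R (EuclideanSpace.single i 1) (EuclideanSpace.single j 1)
          (Φ x (EuclideanSpace.single k 1))) (i j k l : Fin n) :
    riemannLow (gram H Φ) i j k l x
      = H x (R (EuclideanSpace.single i 1) (EuclideanSpace.single j 1)
          (Φ x (EuclideanSpace.single k 1))) (Φ x (EuclideanSpace.single l 1)) := by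
  rw [← hR]
  simp [riemannLow, gram]

section Inverse

variable {V W : Type*} [NormedAddCommGroup V] [NormedSpace ℝ V] [FiniteDimensional ℝ V]
  [NormedAddCommGroup W] [NormedSpace ℝ W] [FiniteDimensional ℝ W]

theorem exists_equiv_of_injective (h : Module.finrank ℝ V = Module.finrank ℝ W) {T : V →L[ℝ] W}
    (hT : Function.Injective T) : ∃ e : V ≃L[ℝ] W, (e : V →L[ℝ] W) = T :=
  ⟨(LinearEquiv.ofInjectiveOfFinrankEq (T : V →ₗ[ℝ] W) hT h).toContinuousLinearEquiv,
    by ext v; rfl⟩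

theorem eventually_injective {Z : Type*} [TopologicalSpace Z]
    (h : Module.finrank ℝ V = Module.finrank ℝ W) {T : Z → V →L[ℝ] W} {z : Z}
    (hT : ContinuousAt T z) (hinj : Function.Injective (T z)) :
    ∀ᶠ y in 𝓝 z, Function.Injective (T y) := by
  obtain ⟨e, he⟩ := exists_equiv_of_injective h hinj
  have : ∀ᶠ S in 𝓝 (T z), S ∈ Set.range ((↑) : (V ≃L[ℝ] W) → V →L[ℝ] W) := by
    rw [← he]
    exact ContinuousLinearEquiv.nhds e
  filter_upwards [hT.eventually this] with y hy
  obtain ⟨e', he'⟩ := hy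
  rw [← he']
  exact e'.injective

theorem inverse_apply_of_injective (h : Module.finrank ℝ V = Module.finrank ℝ W) {T : V →L[ℝ] W}
    (hT : Function.Injective T) (a : W) : T (T.inverse a) = a := by
  obtain ⟨e, rfl⟩ := exists_equiv_of_injective h hT
  simp

theorem contDiffAt_inverse {Z : Type*} [NormedAddCommGroup Z] [NormedSpace ℝ Z]
    (h : Module.finrank ℝ V = Module.finrank ℝ W) {m : ℕ∞ω} {T : Z → V →L[ℝ] W} {z : Z}
    (hT : ContDiffAt ℝ m T z) (hinj : Function.Injective (T z)) :
    ContDiffAt ℝ m (fun y => (T y).inverse) z := by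
  obtain ⟨e, he⟩ := exists_equiv_of_injective h hinj
  have := contDiffAt_map_inverse (𝕜 := ℝ) (n := m) e
  rw [he] at this
  exact this.comp z hT

end Inverse

variable [FiniteDimensional ℝ F]

/-- Near a regular point the vectors `Φ ∂_l` form a frame whose connection coefficients are the
Christoffel symbols, so the commutator of covariant derivatives expanded in this frame is the
coordinate formula for the Riemann tensor. -/
theorem riemannUp_gram (hF : Module.finrank ℝ (EuclideanSpace ℝ (Fin n)) = Module.finrank ℝ F)
    (hH : ∀ᶠ y in 𝓝 x, DifferentiableAt ℝ H y)
    (hθ : ContDiffAt ℝ 1 θ x) (hΦ : ContDiffAt ℝ 2 Φ x)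
    (hm : ∀ᶠ y in 𝓝 x, MetricAt H θ y) (hc : ∀ᶠ y in 𝓝 x, CoherentAt θ Φ y)
    (hsymm : ∀ᶠ y in 𝓝 x, ∀ a b, H y a b = H y b a)
    (hpos : ∀ᶠ y in 𝓝 x, ∀ a, a ≠ 0 → 0 < H y a a) (hinj : Function.Injective (Φ x))
    (i j k : Fin n) :
    ∑ l, riemannUp (gram H Φ) l i j k x • Φ x (EuclideanSpace.single l 1)
      = curvForm θ x (EuclideanSpace.single i 1) (EuclideanSpace.single j 1)
        (Φ x (EuclideanSpace.single k 1)) := by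
  have hθ1 : DifferentiableAt ℝ θ x := hθ.differentiableAt (by norm_num)
  have hΦ1 : DifferentiableAt ℝ Φ x := hΦ.differentiableAt (by norm_num)
  have hΦd : ∀ᶠ y in 𝓝 x, DifferentiableAt ℝ Φ y :=
    (hΦ.eventually (by simp)).mono fun y hy => hy.differentiableAt (by norm_num)
  have hΦv : ∀ v, ContDiffAt ℝ 2 (fun y => Φ y v) x := fun v => hΦ.clm_apply contDiffAt_const
  have hinv : DifferentiableAt ℝ (fun y => (Φ y).inverse) x :=
    (contDiffAt_inverse hF hΦ hinj).differentiableAt (by norm_num)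
  -- `c i j` is the vector `∇_i ∂_j`, obtained by inverting `Φ`; differentiability of the
  -- Christoffel symbols comes from that of the inverse.
  set c : Fin n → Fin n → EuclideanSpace ℝ (Fin n) → EuclideanSpace ℝ (Fin n) :=
    fun i j y => (Φ y).inverse
    (covD θ (fun z => Φ z (EuclideanSpace.single j 1)) (EuclideanSpace.single i 1) y) with hcdef
  have hcd : ∀ i j, DifferentiableAt ℝ (c i j) x := fun i j => by
    refine hinv.clm_apply ?_
    exact (((((hΦv _).fderiv_right (m := 1) (by norm_num)).differentiableAt
      (by norm_num)).clm_apply (differentiableAt_const _)).fun_add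
      ((hθ1.clm_apply (differentiableAt_const _)).clm_apply
        ((hΦv _).differentiableAt (by norm_num))))
  have hinjn := eventually_injective hF hΦ.continuousAt hinj
  have hΦc : ∀ᶠ y in 𝓝 x, ∀ i j, Φ y (c i j y)
      = covD θ (fun z => Φ z (EuclideanSpace.single j 1)) (EuclideanSpace.single i 1) y := by
    filter_upwards [hinjn] with y hy i j
    exact inverse_apply_of_injective hF hy _
  have hchr : ∀ᶠ y in 𝓝 x, ∀ k i j, christoffel (gram H Φ) k i j y = c i j y k := by
    filter_upwards [hH, hΦd, hm, hc, hsymm, hpos, hinjn, hΦc] with y h1 h2 h3 h4 h5 h6 h7 h8 k i j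
    exact christoffel_gram h1 h2 h3 h4 h5 h6 h7 (h8 i j) k
  have hcomp :
    ∀ (c : EuclideanSpace ℝ (Fin n) → EuclideanSpace ℝ (Fin n)), DifferentiableAt ℝ c x → ∀ l,
      DifferentiableAt ℝ (fun y => c y l) x := fun c hc l =>
    (EuclideanSpace.proj (𝕜 := ℝ) l).differentiableAt.comp x hc
  have hpd : ∀ l i j k, pderiv l (christoffel (gram H Φ) k i j) x
      = fderiv ℝ (fun y => c i j y k) x (EuclideanSpace.single l 1) := fun l i j k => by
    have : christoffel (gram H Φ) k i j =ᶠ[𝓝 x] fun y => c i j y k := by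
      filter_upwards [hchr] with y hy
      exact hy k i j
    rw [pderiv, this.fderiv_eq]
  have hsum : ∀ y i j, Φ y (c i j y) = ∑ l, c i j y l • Φ y (EuclideanSpace.single l 1) :=
    fun y i j => clm_eq_sum _ _
  have hDD : ∀ i j k, covD θ (covD θ (fun z => Φ z (EuclideanSpace.single k 1))
        (EuclideanSpace.single j 1)) (EuclideanSpace.single i 1) x
      = ∑ l, (fderiv ℝ (fun y => c j k y l) x (EuclideanSpace.single i 1)
          + ∑ m, c j k x m * c i m x l) • Φ x (EuclideanSpace.single l 1) := fun i j k => by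
    have e : covD θ (fun z => Φ z (EuclideanSpace.single k 1)) (EuclideanSpace.single j 1) =ᶠ[𝓝 x]
        fun y => ∑ l, c j k y l • Φ y (EuclideanSpace.single l 1) := by
      filter_upwards [hΦc] with y hy
      rw [← hsum, hy]
    rw [covD_congr e, covD_sum _ fun l _ => (hcomp _ (hcd j k) l).fun_smul
      ((hΦv _).differentiableAt (by norm_num))]
    have : ∀ l, covD θ (fun y => c j k y l • Φ y (EuclideanSpace.single l 1))
        (EuclideanSpace.single i 1) x
        = fderiv ℝ (fun y => c j k y l) x (EuclideanSpace.single i 1)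
            • Φ x (EuclideanSpace.single l 1)
          + c j k x l • ∑ m, c i l x m • Φ x (EuclideanSpace.single m 1) := fun l => by
      rw [covD_smul (hcomp _ (hcd j k) l) ((hΦv _).differentiableAt (by norm_num)),
        ← hΦc.self_of_nhds, hsum]
    simp only [this, add_smul, Finset.sum_add_distrib, Finset.smul_sum, Finset.sum_smul, smul_smul]
    congr 1
    rw [Finset.sum_comm]
  have hcomm := covD_comm (hΦv (EuclideanSpace.single k 1)) hθ1 (EuclideanSpace.single i 1)
    (EuclideanSpace.single j 1)
  rw [← hcomm, hDD, hDD, ← Finset.sum_sub_distrib]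
  refine Finset.sum_congr rfl fun l _ => ?_
  rw [← sub_smul, riemannUp, hpd, hpd]
  simp only [hchr.self_of_nhds]
  rw [Finset.sum_sub_distrib]
  congr 1
  ring

theorem riemannUp_eq_of_kulkarni {B : EuclideanSpace ℝ (Fin n) →L[ℝ] F}
    (hinj : Function.Injective (Φ x))
    (hF : Module.finrank ℝ (EuclideanSpace ℝ (Fin n)) = Module.finrank ℝ F)
    (hsymm : ∀ a b, H x a b = H x b a) {i j k : Fin n}
    (hR : ∑ l, riemannUp (gram H Φ) l i j k x • Φ x (EuclideanSpace.single l 1)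
      = -kulkarni (H x) (Φ x) B (EuclideanSpace.single i 1) (EuclideanSpace.single j 1)
          (Φ x (EuclideanSpace.single k 1))) (l : Fin n) :
    riemannUp (gram H Φ) l i j k x
      = -(H x (Φ x (EuclideanSpace.single k 1)) (B (EuclideanSpace.single i 1))
            * (1 : Matrix (Fin n) (Fin n) ℝ) l j)
        + gram H Φ x j k * (Φ x).inverse (B (EuclideanSpace.single i 1)) l
        + H x (Φ x (EuclideanSpace.single k 1)) (B (EuclideanSpace.single j 1))
            * (1 : Matrix (Fin n) (Fin n) ℝ) l i
        - gram H Φ x i k * (Φ x).inverse (B (EuclideanSpace.single j 1)) l := by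
  have key : (WithLp.toLp 2 fun l => riemannUp (gram H Φ) l i j k x)
      = -(H x (Φ x (EuclideanSpace.single k 1)) (B (EuclideanSpace.single i 1))
            • EuclideanSpace.single j (1 : ℝ))
        + gram H Φ x j k • (Φ x).inverse (B (EuclideanSpace.single i 1))
        + H x (Φ x (EuclideanSpace.single k 1)) (B (EuclideanSpace.single j 1))
            • EuclideanSpace.single i (1 : ℝ)
        - gram H Φ x i k • (Φ x).inverse (B (EuclideanSpace.single j 1)) := by
    apply hinj
    rw [clm_eq_sum]
    simp only [map_add, map_sub, map_neg, map_smul, inverse_apply_of_injective hF hinj]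
    rw [hR, kulkarni, hsymm (B _), hsymm (B _)]
    simp only [gram, Matrix.of_apply]
    module
  have := congrArg (fun v : EuclideanSpace ℝ (Fin n) => v l) key
  simpa [Matrix.one_apply, Pi.single_apply] using this

/-- Tracing the product of `Φ` and `B` gives Ricci curvature `(n - 2) A + tr(b) g` and scalar
curvature `2 (n - 1) tr(b)`, where `A = ⟨Φ, B⟩` and `b = Φ⁻¹ B`. The Schouten combination removes
the trace part, and `n ≥ 3` permits the division by `n - 2`. -/
theorem schoutenMatrix_gram (hn : 3 ≤ n) {B : EuclideanSpace ℝ (Fin n) →L[ℝ] F}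
    (hinj : Function.Injective (Φ x))
    (hF : Module.finrank ℝ (EuclideanSpace ℝ (Fin n)) = Module.finrank ℝ F)
    (hsymm : ∀ a b, H x a b = H x b a) (hpos : ∀ a, a ≠ 0 → 0 < H x a a)
    (hB : ∀ u v, H x (Φ x u) (B v) = H x (Φ x v) (B u))
    (hR : ∀ i j k, ∑ l, riemannUp (gram H Φ) l i j k x • Φ x (EuclideanSpace.single l 1)
      = -kulkarni (H x) (Φ x) B (EuclideanSpace.single i 1) (EuclideanSpace.single j 1)
          (Φ x (EuclideanSpace.single k 1))) :
    schoutenMatrix (gram H Φ) x = Matrix.of fun i j =>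
      H x (Φ x (EuclideanSpace.single i 1)) (B (EuclideanSpace.single j 1)) := by
  have hn' : (3 : ℝ) ≤ n := by exact_mod_cast hn
  set A : Matrix (Fin n) (Fin n) ℝ := Matrix.of fun i j =>
      H x (Φ x (EuclideanSpace.single i 1)) (B (EuclideanSpace.single j 1)) with hA
  set b : Matrix (Fin n) (Fin n) ℝ := Matrix.of fun l i =>
      (Φ x).inverse (B (EuclideanSpace.single i 1)) l with hb
  have hGb : gram H Φ x * b = A := by
    ext i j
    have := gram_mulVec (H := H) (Φ := Φ) (x := x)
      (fun l => (Φ x).inverse (B (EuclideanSpace.single j 1)) l) i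
    rw [show (WithLp.toLp 2 fun l => (Φ x).inverse (B (EuclideanSpace.single j 1)) l :
      EuclideanSpace ℝ (Fin n)) = (Φ x).inverse (B (EuclideanSpace.single j 1)) from rfl,
      inverse_apply_of_injective hF hinj] at this
    exact this
  have hGs : ∀ i j, gram H Φ x i j = gram H Φ x j i := fun i j => hsymm _ _
  have hAs : ∀ i j, A i j = A j i := fun i j => hB _ _
  have hric : ∀ j k, ricci (gram H Φ) j k x = (n - 2) * A j k + b.trace * gram H Φ x j k :=
    fun j k => by
      rw [ricci]
      have e : ∀ i, riemannUp (gram H Φ) i i j k x = -(A k i * (1 : Matrix _ _ ℝ) i j)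
          + gram H Φ x j k * b i i + A k j - gram H Φ x k i * b i j := fun i => by
        rw [riemannUp_eq_of_kulkarni hinj hF hsymm (hR i j k) i, hGs i k]
        simp [hA, hb]
      simp only [e]
      -- The four sums are `-A`, `tr(b) g`, `n A` and `-A`, the last because `G b = A`.
      rw [Finset.sum_sub_distrib, Finset.sum_add_distrib, Finset.sum_add_distrib,
        Finset.sum_neg_distrib, ← Matrix.mul_apply, ← Matrix.mul_apply, ← Finset.mul_sum, hGb,
        Matrix.mul_one, hAs j k]
      simp [Matrix.trace]
      ring
  have hdet := gram_isUnit_det hpos hinj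
  have hscal : scalarCurvature (gram H Φ) x = 2 * (n - 1) * b.trace := by
    have h1 : ∑ j, ∑ k, (gram H Φ x)⁻¹ j k * A j k = b.trace := by
      have : (gram H Φ x)⁻¹ * A = b := by
        rw [← hGb, Matrix.nonsing_inv_mul_cancel_left _ _ hdet]
      rw [← this]
      simp only [Matrix.trace, Matrix.diag, Matrix.mul_apply]
      exact Finset.sum_congr rfl fun j _ => Finset.sum_congr rfl fun k _ => by rw [hAs]
    have h2 : ∑ j, ∑ k, (gram H Φ x)⁻¹ j k * gram H Φ x j k = n := by
      have := congrArg Matrix.trace (Matrix.nonsing_inv_mul _ hdet)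
      rw [Matrix.trace_one, Fintype.card_fin] at this
      rw [← this]
      simp only [Matrix.trace, Matrix.diag, Matrix.mul_apply]
      exact Finset.sum_congr rfl fun j _ => Finset.sum_congr rfl fun k _ => by rw [hGs]
    have h3 : scalarCurvature (gram H Φ) x
        = (n - 2) * (∑ j, ∑ k, (gram H Φ x)⁻¹ j k * A j k)
          + b.trace * ∑ j, ∑ k, (gram H Φ x)⁻¹ j k * gram H Φ x j k := by
      simp only [scalarCurvature, hric, Finset.mul_sum, ← Finset.sum_add_distrib]
      exact Finset.sum_congr rfl fun j _ => Finset.sum_congr rfl fun k _ => by ring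
    rw [h3, h1, h2]
    ring
  ext i j
  rw [schoutenMatrix, Matrix.of_apply, hscal, hric]
  have h2 : (n : ℝ) - 2 ≠ 0 := by linarith
  have h1 : (n : ℝ) - 1 ≠ 0 := by linarith
  field_simp
  ring

theorem schoutenHat_gram {B : EuclideanSpace ℝ (Fin n) →L[ℝ] F}
    (hinj : Function.Injective (Φ x))
    (hF : Module.finrank ℝ (EuclideanSpace ℝ (Fin n)) = Module.finrank ℝ F)
    (hpos : ∀ a, a ≠ 0 → 0 < H x a a) (c : Fin n → ℝ) :
    Φ x (WithLp.toLp 2 (((gram H Φ x)⁻¹ * Matrix.of fun i j =>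
      H x (Φ x (EuclideanSpace.single i 1)) (B (EuclideanSpace.single j 1))).mulVec c))
      = B (WithLp.toLp 2 c) := by
  have hdet := gram_isUnit_det hpos hinj
  have h : (Matrix.of fun i j =>
      H x (Φ x (EuclideanSpace.single i 1)) (B (EuclideanSpace.single j 1))).mulVec c
      = (gram H Φ x).mulVec fun l => (Φ x).inverse (B (WithLp.toLp 2 c)) l := by
    ext i
    rw [gram_mulVec, show (WithLp.toLp 2 fun l => (Φ x).inverse (B (WithLp.toLp 2 c)) l :
      EuclideanSpace ℝ (Fin n)) = (Φ x).inverse (B (WithLp.toLp 2 c)) from rfl,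
      inverse_apply_of_injective hF hinj, clm_eq_sum B, map_sum]
    simp [Matrix.mulVec, dotProduct, mul_comm]
  rw [← Matrix.mulVec_mulVec, h, Matrix.mulVec_mulVec, Matrix.nonsing_inv_mul _ hdet,
    Matrix.one_mulVec]
  exact inverse_apply_of_injective hF hinj _

end Gram

/-! ### Coherent structures near a regular point of a coordinate space -/

section CoherentNear

variable {n : ℕ} {F : Type*} [NormedAddCommGroup F] [NormedSpace ℝ F]

/-- A coherent tangent bundle in a neighbourhood of a regular point of a coordinate space:
fibre metric `H`, connection form `θ`, bundle homomorphism `Φ`. -/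
structure CoherentNear (H : EuclideanSpace ℝ (Fin n) → F →L[ℝ] F →L[ℝ] ℝ)
    (θ : EuclideanSpace ℝ (Fin n) → EuclideanSpace ℝ (Fin n) →L[ℝ] F →L[ℝ] F)
    (Φ : EuclideanSpace ℝ (Fin n) → EuclideanSpace ℝ (Fin n) →L[ℝ] F)
    (x : EuclideanSpace ℝ (Fin n)) : Prop where
  smooth_metric : ContDiffAt ℝ 2 H x
  smooth_form : ContDiffAt ℝ 2 θ x
  smooth_hom : ContDiffAt ℝ 2 Φ x
  metric : ∀ᶠ y in 𝓝 x, MetricAt H θ y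
  coherent : ∀ᶠ y in 𝓝 x, CoherentAt θ Φ y
  symm : ∀ᶠ y in 𝓝 x, ∀ a b, H y a b = H y b a
  pos : ∀ᶠ y in 𝓝 x, ∀ a, a ≠ 0 → 0 < H y a a
  injective : Function.Injective (Φ x)

variable {H : EuclideanSpace ℝ (Fin n) → F →L[ℝ] F →L[ℝ] ℝ}
  {θ : EuclideanSpace ℝ (Fin n) → EuclideanSpace ℝ (Fin n) →L[ℝ] F →L[ℝ] F}
  {Φ : EuclideanSpace ℝ (Fin n) → EuclideanSpace ℝ (Fin n) →L[ℝ] F}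
  {x y : EuclideanSpace ℝ (Fin n)} {f : EuclideanSpace ℝ (Fin n) → EuclideanSpace ℝ (Fin n)}

theorem eventually_differentiableAt {X Z : Type*} [NormedAddCommGroup X] [NormedSpace ℝ X]
    [NormedAddCommGroup Z] [NormedSpace ℝ Z] {s : X → Z} {x : X} (hs : ContDiffAt ℝ 2 s x) :
    ∀ᶠ y in 𝓝 x, DifferentiableAt ℝ s y :=
  (hs.eventually (by simp)).mono fun _ hy => hy.differentiableAt (by norm_num)

/-- One derivative of `f` enters the pulled-back forms, so `C³` is what keeps them `C²`. -/
theorem CoherentNear.pullback (h : CoherentNear H θ Φ (f y)) (hf : ContDiffAt ℝ 3 f y)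
    (hinj : Function.Injective (fderiv ℝ f y)) :
    CoherentNear (fun z => H (f z)) (pullForm f θ) (pullForm f Φ) y := by
  have hf2 : ContDiffAt ℝ 2 f y := hf.of_le (by norm_num)
  have hfe := hf2.eventually (by simp)
  have hdf : ContDiffAt ℝ 2 (fderiv ℝ f) y := hf.fderiv_right (m := 2) (by norm_num)
  have hfc := hf.continuousAt
  refine ⟨h.smooth_metric.comp y hf2, (h.smooth_form.comp y hf2).clm_comp hdf,
    (h.smooth_hom.comp y hf2).clm_comp hdf, ?_, ?_, hfc.eventually h.symm, hfc.eventually h.pos,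
    h.injective.comp hinj⟩
  · filter_upwards [hfc.eventually h.metric,
      hfc.eventually (eventually_differentiableAt h.smooth_metric), hfe] with z h1 h2 h3
    exact h1.pullForm (h3.differentiableAt (by norm_num)) h2
  · filter_upwards [hfc.eventually h.coherent,
      hfc.eventually (eventually_differentiableAt h.smooth_hom), hfe] with z h1 h2 h3
    exact h1.pullForm h3 h2

theorem CoherentNear.conformal {σ : EuclideanSpace ℝ (Fin n) → ℝ}
    {ξ : EuclideanSpace ℝ (Fin n) → F} (h : CoherentNear H θ Φ x) (hσ : ContDiffAt ℝ 2 σ x)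
    (hξ : ContDiffAt ℝ 2 ξ x)
    (hgrad : ∀ᶠ y in 𝓝 x, ∀ v, H y (ξ y) (Φ y v) = fderiv ℝ σ y v) :
    CoherentNear H (confForm H θ Φ ξ) (fun y => Real.exp (σ y) • Φ y) x := by
  have h1 : ContDiffAt ℝ 2 (fun y => H y (ξ y)) x := h.smooth_metric.clm_apply hξ
  have h2 : ContDiffAt ℝ 2
      (fun y => ContinuousLinearMap.smulRightL ℝ F F (H y (ξ y)) ∘L Φ y) x :=
    ((ContinuousLinearMap.smulRightL ℝ F F).contDiff.contDiffAt.comp x h1).clm_comp h.smooth_hom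
  have h3 : ContDiffAt ℝ 2
      (fun y => (ContinuousLinearMap.smulRightL ℝ F F).flip (ξ y) ∘L H y ∘L Φ y) x :=
    (ContDiffAt.comp (g := fun a => (ContinuousLinearMap.smulRightL ℝ F F).flip a) x
      (ContinuousLinearMap.contDiff _).contDiffAt hξ).clm_comp
        (h.smooth_metric.clm_comp h.smooth_hom)
  refine ⟨h.smooth_metric, h.smooth_form.add (h2.sub h3),
    ContDiffAt.smul (Real.contDiff_exp.contDiffAt.comp x hσ) h.smooth_hom, ?_, ?_, h.symm, h.pos,
    fun a b hab => h.injective ?_⟩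
  · filter_upwards [h.metric, h.symm] with y hy hs
    exact hy.confForm hs
  · filter_upwards [h.coherent, h.symm, hgrad, eventually_differentiableAt h.smooth_hom,
      eventually_differentiableAt hσ] with y h1 h2 h3 h4 h5
    exact h1.confForm h4 h5 h3 h2
  · exact smul_right_injective F (Real.exp_pos (σ x)).ne' hab

theorem CoherentNear.riemannUp_gram [FiniteDimensional ℝ F]
    (hF : Module.finrank ℝ (EuclideanSpace ℝ (Fin n)) = Module.finrank ℝ F)
    (h : CoherentNear H θ Φ x) (i j k : Fin n) :
    ∑ l, riemannUp (gram H Φ) l i j k x • Φ x (EuclideanSpace.single l 1)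
      = curvForm θ x (EuclideanSpace.single i 1) (EuclideanSpace.single j 1)
        (Φ x (EuclideanSpace.single k 1)) :=
  GCF.riemannUp_gram hF (eventually_differentiableAt h.smooth_metric)
    (h.smooth_form.of_le (by norm_num)) h.smooth_hom h.metric h.coherent h.symm h.pos h.injective
    i j k

/-! ### Dependence on germs -/

section Germs

variable {G G' : EuclideanSpace ℝ (Fin n) → Matrix (Fin n) (Fin n) ℝ}

theorem pderiv_congr {f g : EuclideanSpace ℝ (Fin n) → ℝ} (h : f =ᶠ[𝓝 x] g) (i : Fin n) :
    pderiv i f x = pderiv i g x := by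
  rw [pderiv, pderiv, h.fderiv_eq]

theorem christoffel_congr (h : G =ᶠ[𝓝 x] G') (k i j : Fin n) :
    christoffel G k i j x = christoffel G' k i j x := by
  have e : ∀ i j, (fun y => G y i j) =ᶠ[𝓝 x] fun y => G' y i j := fun i j =>
    h.mono fun y hy => by simp only [hy]
  simp only [christoffel, h.eq_of_nhds, fun i j => pderiv_congr (e i j)]

theorem riemannUp_congr (h : G =ᶠ[𝓝 x] G') (l i j k : Fin n) :
    riemannUp G l i j k x = riemannUp G' l i j k x := by
  have e : ∀ k i j, christoffel G k i j =ᶠ[𝓝 x] christoffel G' k i j := fun k i j => by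
    filter_upwards [eventually_eventually_nhds.2 h] with y hy
    exact christoffel_congr hy k i j
  simp only [riemannUp, christoffel_congr h, fun k i j => pderiv_congr (e k i j)]

theorem ricci_congr (h : G =ᶠ[𝓝 x] G') (j k : Fin n) : ricci G j k x = ricci G' j k x := by
  simp only [ricci, riemannUp_congr h]

theorem schoutenMatrix_congr (h : G =ᶠ[𝓝 x] G') : schoutenMatrix G x = schoutenMatrix G' x := by
  simp only [schoutenMatrix, scalarCurvature, ricci_congr h, h.eq_of_nhds]

theorem sectionalCoord_congr (h : G =ᶠ[𝓝 x] G') (a b : Fin n → ℝ) :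
    sectionalCoord G x a b = sectionalCoord G' x a b := by
  simp only [sectionalCoord, riemannLow, riemannUp_congr h, h.eq_of_nhds]

end Germs

/-! ### Curvature of the Gram matrix -/

/-- The curvature as a continuous bilinear map. -/
def curvBilin (θ : EuclideanSpace ℝ (Fin n) → EuclideanSpace ℝ (Fin n) →L[ℝ] F →L[ℝ] F)
    (x : EuclideanSpace ℝ (Fin n)) :
    EuclideanSpace ℝ (Fin n) →L[ℝ] EuclideanSpace ℝ (Fin n) →L[ℝ] F →L[ℝ] F :=
  fderiv ℝ θ x - (fderiv ℝ θ x).flip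
    + ((ContinuousLinearMap.compL ℝ F F F).bilinearComp (θ x) (θ x)
      - ((ContinuousLinearMap.compL ℝ F F F).bilinearComp (θ x) (θ x)).flip)

theorem curvBilin_apply (u v : EuclideanSpace ℝ (Fin n)) :
    curvBilin θ x u v = curvForm θ x u v := rfl

theorem curvForm_add_left (u u' v : EuclideanSpace ℝ (Fin n)) :
    curvForm θ x (u + u') v = curvForm θ x u v + curvForm θ x u' v := by
  rw [← curvBilin_apply, map_add]; rfl

theorem curvForm_smul_left (c : ℝ) (u v : EuclideanSpace ℝ (Fin n)) :
    curvForm θ x (c • u) v = c • curvForm θ x u v := by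
  rw [← curvBilin_apply, map_smul]; rfl

theorem curvForm_add_right (u v v' : EuclideanSpace ℝ (Fin n)) :
    curvForm θ x u (v + v') = curvForm θ x u v + curvForm θ x u v' := by
  rw [← curvBilin_apply, map_add]; rfl

theorem curvForm_anti (u v : EuclideanSpace ℝ (Fin n)) :
    curvForm θ x u v = -curvForm θ x v u := by
  simp only [curvForm]; abel

theorem curvForm_self (u : EuclideanSpace ℝ (Fin n)) : curvForm θ x u u = 0 := by
  simp [curvForm]

theorem CoherentNear.schoutenMatrix_gram [FiniteDimensional ℝ F] (hn : 3 ≤ n)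
    (hF : Module.finrank ℝ (EuclideanSpace ℝ (Fin n)) = Module.finrank ℝ F)
    (h : CoherentNear H θ Φ x) {B : EuclideanSpace ℝ (Fin n) →L[ℝ] F}
    (hB : ∀ u v, H x (Φ x u) (B v) = H x (Φ x v) (B u))
    (hR : ∀ u v a, curvForm θ x u v a = -kulkarni (H x) (Φ x) B u v a) :
    schoutenMatrix (gram H Φ) x = Matrix.of fun i j =>
      H x (Φ x (EuclideanSpace.single i 1)) (B (EuclideanSpace.single j 1)) :=
  GCF.schoutenMatrix_gram hn h.injective hF h.symm.self_of_nhds h.pos.self_of_nhds hB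
    fun i j k => by rw [h.riemannUp_gram hF, hR]

theorem sum_riemannLow_gram
    {R : EuclideanSpace ℝ (Fin n) →L[ℝ] EuclideanSpace ℝ (Fin n) →L[ℝ] F →L[ℝ] F}
    (hR : ∀ i j k l, riemannLow (gram H Φ) i j k l x
      = H x (R (EuclideanSpace.single i 1) (EuclideanSpace.single j 1)
          (Φ x (EuclideanSpace.single k 1))) (Φ x (EuclideanSpace.single l 1)))
    (a b : Fin n → ℝ) :
    ∑ i, ∑ j, ∑ k, ∑ l, riemannLow (gram H Φ) i j k l x * a i * b j * b k * a l
      = H x (R (WithLp.toLp 2 a) (WithLp.toLp 2 b) (Φ x (WithLp.toLp 2 b)))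
          (Φ x (WithLp.toLp 2 a)) := by
  set a' : EuclideanSpace ℝ (Fin n) := WithLp.toLp 2 a
  set b' : EuclideanSpace ℝ (Fin n) := WithLp.toLp 2 b
  have h1 : ∀ w : F, H x w (Φ x a') = ∑ l, a l * H x w (Φ x (EuclideanSpace.single l 1)) :=
    fun w => by simpa using clm_eq_sum (H x w ∘L Φ x) a'
  have h2 : ∀ T : F →L[ℝ] F, H x (T (Φ x b')) (Φ x a')
      = ∑ k, b k * H x (T (Φ x (EuclideanSpace.single k 1))) (Φ x a') := fun T => by
    simpa using clm_eq_sum ((H x).flip (Φ x a') ∘L T ∘L Φ x) b'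
  have h3 : ∀ S : EuclideanSpace ℝ (Fin n) →L[ℝ] F →L[ℝ] F, H x (S b' (Φ x b')) (Φ x a')
      = ∑ j, b j * H x (S (EuclideanSpace.single j 1) (Φ x b')) (Φ x a') := fun S => by
    simpa using clm_eq_sum ((H x).flip (Φ x a') ∘L S.flip (Φ x b')) b'
  have h4 : H x (R a' b' (Φ x b')) (Φ x a')
      = ∑ i, a i * H x (R (EuclideanSpace.single i 1) b' (Φ x b')) (Φ x a') := by
    simpa using clm_eq_sum ((H x).flip (Φ x a') ∘L (R.flip b').flip (Φ x b')) a'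
  rw [h4]
  simp only [h3, h2, h1, hR, Finset.mul_sum]
  exact Finset.sum_congr rfl fun i _ => Finset.sum_congr rfl fun j _ =>
    Finset.sum_congr rfl fun k _ => Finset.sum_congr rfl fun l _ => by ring

theorem CoherentNear.sum_riemannLow [FiniteDimensional ℝ F]
    (hF : Module.finrank ℝ (EuclideanSpace ℝ (Fin n)) = Module.finrank ℝ F)
    (h : CoherentNear H θ Φ x) (a b : Fin n → ℝ) :
    ∑ i, ∑ j, ∑ k, ∑ l, riemannLow (gram H Φ) i j k l x * a i * b j * b k * a l
      = H x (curvForm θ x (WithLp.toLp 2 a) (WithLp.toLp 2 b) (Φ x (WithLp.toLp 2 b)))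
          (Φ x (WithLp.toLp 2 a)) := by
  rw [← curvBilin_apply]
  refine sum_riemannLow_gram (riemannLow_gram fun i j k => ?_) a b
  rw [h.riemannUp_gram hF, curvBilin_apply]

theorem CoherentNear.sectionalCoord_eq_zero [FiniteDimensional ℝ F]
    (hF : Module.finrank ℝ (EuclideanSpace ℝ (Fin n)) = Module.finrank ℝ F)
    (h : CoherentNear H θ Φ x) (hflat : ∀ u v, curvForm θ x u v = 0) (a b : Fin n → ℝ) :
    sectionalCoord (gram H Φ) x a b = 0 := by
  rw [sectionalCoord, h.sum_riemannLow hF, hflat]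
  simp

/-- The curvature contracted with `Φ` is skew in both pairs and satisfies the Bianchi identity, so
vanishing sectional curvature kills it. Since `Φ x` is onto, nothing of the curvature escapes the
contraction. -/
theorem CoherentNear.curvForm_eq_zero [FiniteDimensional ℝ F]
    (hF : Module.finrank ℝ (EuclideanSpace ℝ (Fin n)) = Module.finrank ℝ F)
    (h : CoherentNear H θ Φ x)
    (hsec : ∀ a b : Fin n → ℝ, LinearIndependent ℝ ![a, b] →
      sectionalCoord (gram H Φ) x a b = 0) (u v : EuclideanSpace ℝ (Fin n)) :
    curvForm θ x u v = 0 := by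
  have hθ1 : DifferentiableAt ℝ θ x := h.smooth_form.differentiableAt (by norm_num)
  have hskew := curvForm_skew h.smooth_metric (h.smooth_form.of_le (by norm_num)) h.metric
  have hbian := curvForm_bianchi h.smooth_hom hθ1 h.coherent
  have hsec' : ∀ a b : EuclideanSpace ℝ (Fin n),
      H x (curvForm θ x a b (Φ x b)) (Φ x a) = 0 := fun a b => by
    by_cases hab : LinearIndependent ℝ ![(a : Fin n → ℝ), b]
    · have h0 := hsec a b hab
      rw [sectionalCoord, h.sum_riemannLow hF, toBilin'_gram, toBilin'_gram, toBilin'_gram,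
        div_eq_zero_iff] at h0
      -- A vanishing quotient could also come from a zero denominator; strict Cauchy–Schwarz
      -- excludes this.
      refine h0.resolve_right (ne_of_gt ?_)
      have hlin : LinearIndependent ℝ ![Φ x a, Φ x b] := by
        rw [LinearIndependent.pair_iff] at hab ⊢
        intro s t hst
        refine hab s t ?_
        have : s • a + t • b = 0 := h.injective (by simpa using hst)
        exact congrArg (fun w : EuclideanSpace ℝ (Fin n) => (w : Fin n → ℝ)) this
      exact cauchySchwarz_strict ((ContinuousLinearMap.coeLM ℝ) ∘ₗ (H x : F →ₗ[ℝ] F →L[ℝ] ℝ))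
        (fun a b => h.symm.self_of_nhds a b) (fun a ha => h.pos.self_of_nhds a ha) hlin
    -- For dependent vectors the sectional hypothesis says nothing, but then either `b = 0` or `a`
    -- is a multiple of `b`, and antisymmetry suffices.
    · have hab' : ¬ LinearIndependent ℝ ![a, b] := fun hl => hab <| by
        rw [LinearIndependent.pair_iff] at hl ⊢
        intro s t hst
        refine hl s t ?_
        ext i
        exact congrFun hst i
      simp only [LinearIndependent.pair_iff, not_forall] at hab'
      obtain ⟨s, t, hst, hne⟩ := hab'
      by_cases hs : s = 0
      · have ht : t ≠ 0 := fun ht => hne ⟨hs, ht⟩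
        have : b = 0 := by simpa [hs, ht] using hst
        simp [this]
      · have : a = (-(t / s)) • b := by
          rw [neg_smul, eq_neg_iff_add_eq_zero, div_eq_inv_mul, mul_smul,
            ← smul_right_injective (EuclideanSpace ℝ (Fin n)) hs |>.eq_iff]
          simpa [smul_smul, hs] using hst
        rw [this, curvForm_smul_left, curvForm_self]
        simp
  have hT : ∀ a b c d, H x (curvForm θ x a b (Φ x c)) (Φ x d) = 0 := by
    refine curvatureTensor_eq_zero (fun a b c d => H x (curvForm θ x a b (Φ x c)) (Φ x d))
      (fun a a' b c d => ?_) (fun a b b' c d => ?_) (fun a b c c' d => ?_)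
      (fun a b c d d' => ?_) (fun a b c d => ?_) (fun a b c d => ?_) (fun a b c d => ?_) hsec'
    · simp only [curvForm_add_left, add_apply, map_add]
    · simp only [curvForm_add_right, add_apply, map_add]
    · simp only [add_apply, map_add]
    · simp only [map_add]
    · simp only [curvForm_anti a b, neg_apply, map_neg]
    · rw [← add_eq_zero_iff_eq_neg, h.symm.self_of_nhds (curvForm θ x a b (Φ x d))]
      exact hskew a b _ _
    · rw [← add_apply, ← map_add, ← add_apply, ← map_add, hbian, map_zero, zero_apply]
  ext w
  obtain ⟨c, rfl⟩ : ∃ c, Φ x c = w := ⟨_, inverse_apply_of_injective hF h.injective w⟩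
  by_contra hne
  have hne' : curvForm θ x u v (Φ x c) ≠ 0 := hne
  -- Pairing the curvature vector with itself contradicts positivity.
  obtain ⟨d, hd⟩ : ∃ d, Φ x d = curvForm θ x u v (Φ x c) :=
    ⟨_, inverse_apply_of_injective hF h.injective _⟩
  have := h.pos.self_of_nhds _ hne'
  conv at this =>
    rhs
    arg 2
    rw [← hd]
  rw [hT] at this
  exact lt_irrefl _ this

end CoherentNear

/-! ### Parallel sections of flat connections -/

section Frobenius

variable {X W : Type*} [NormedAddCommGroup X] [NormedSpace ℝ X]
  [NormedAddCommGroup W] [NormedSpace ℝ W]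

theorem exists_linear_ode_solution [CompleteSpace W] {a : ℝ → W →L[ℝ] W}
    (ha : ContinuousOn a (Set.Icc 0 1))
    (hbound : ∀ t ∈ Set.Icc (0 : ℝ) 1, ‖a t‖ ≤ 1 / 2) (w : W) :
    ∃ z : ℝ → W, z 0 = w ∧ ∀ t ∈ Set.Icc (0 : ℝ) 1,
      HasDerivWithinAt z (-(a t (z t))) (Set.Icc 0 1) t := by
  -- On the ball of radius `‖w‖ + 1` about `w` the speed is at most `(2‖w‖ + 1) / 2 ≤ ‖w‖ + 1`, so a
  -- solution cannot leave it within unit time.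
  have hP : IsPicardLindelof (fun t z => -(a t z)) (tmin := 0) (tmax := 1) ⟨0, by simp⟩ w
      (‖w‖₊ + 1) 0 (‖w‖₊ + 1) 1 := by
    refine ⟨fun t ht => ?_, fun z _ => ?_, fun t ht z hz => ?_, ?_⟩
    · refine LipschitzWith.lipschitzOnWith (LipschitzWith.of_dist_le_mul fun y z => ?_)
      rw [dist_eq_norm, dist_eq_norm, ← neg_sub', norm_neg, ← map_sub]
      refine ((a t).le_of_opNorm_le (hbound t ht) _).trans ?_
      have := norm_nonneg (y - z)
      simp only [NNReal.coe_one]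
      linarith
    · exact (ha.clm_apply continuousOn_const).neg
    · rw [norm_neg]
      refine ((a t).le_of_opNorm_le (hbound t ht) _).trans ?_
      have h1 : ‖z - w‖ ≤ ‖w‖ + 1 := by simpa [dist_eq_norm] using hz
      have h2 : ‖z‖ ≤ ‖w‖ + ‖z - w‖ := norm_le_insert' z w
      have h3 := norm_nonneg w
      push_cast
      linarith
    · simp
  obtain ⟨z, hz0, hz⟩ := hP.exists_eq_forall_mem_Icc_hasDerivWithinAt₀
  exact ⟨z, hz0, hz⟩

theorem hasFDerivAt_of_quadratic_bound {s : X → W} {T : X →L[ℝ] W} {x : X} {C : ℝ}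
    (h : ∀ᶠ k in 𝓝 (0 : X), ‖s (x + k) - s x - T k‖ ≤ C * ‖k‖ ^ 2) : HasFDerivAt s T x := by
  rw [hasFDerivAt_iff_isLittleO_nhds_zero]
  refine Asymptotics.IsBigO.trans_isLittleO (g := fun k : X => ‖k‖ ^ 2) ?_
    (Asymptotics.isLittleO_norm_pow_id one_lt_two)
  refine Asymptotics.IsBigO.of_bound C ?_
  filter_upwards [h] with k hk
  simpa using hk

theorem norm_taylor_le {Z : Type*} [NormedAddCommGroup Z] [NormedSpace ℝ Z] {f : X → Z}
    {S : Set X} {K : NNReal} (hS : Convex ℝ S) (hf : ∀ y ∈ S, DifferentiableAt ℝ f y)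
    (hK : LipschitzOnWith K (fderiv ℝ f) S) {p k : X} (hp : p ∈ S) (hk : p + k ∈ S) :
    ‖f (p + k) - f p - fderiv ℝ f p k‖ ≤ K * ‖k‖ ^ 2 := by
  have hseg : segment ℝ p (p + k) ⊆ S := hS.segment_subset hp hk
  have := (convex_segment p (p + k)).norm_image_sub_le_of_norm_hasFDerivWithin_le'
    (f := f) (f' := fderiv ℝ f) (φ := fderiv ℝ f p) (C := K * ‖k‖)
    (fun y hy => (hf y (hseg hy)).hasFDerivAt.hasFDerivWithinAt) (fun y hy => ?_)
    (left_mem_segment ℝ p (p + k)) (right_mem_segment ℝ p (p + k))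
  · simpa [sq, mul_assoc] using this
  · refine (hK.norm_sub_le (hseg hy) hp).trans ?_
    gcongr
    have hb : segment ℝ p (p + k) ⊆ Metric.closedBall p ‖k‖ :=
      (convex_closedBall p ‖k‖).segment_subset (by simp) (by simp)
    exact mem_closedBall_iff_norm.1 (hb hy)

/-- A quantitative derivative of radial transport in the end point, without differentiating an ODE
in a parameter: the expected first-order correction of `z` solves the equation along the
neighbouring ray up to an error quadratic in `k`, and Grönwall's inequality compares it with the
true solution. -/
theorem norm_ray_sub_le {Θ : X → X →L[ℝ] W →L[ℝ] W} {x₀ y k : X} {z z' : ℝ → W} {M C N : ℝ}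
    (hz : ∀ t ∈ Set.Icc (0 : ℝ) 1,
      HasDerivWithinAt z (-(Θ (x₀ + t • y) y (z t))) (Set.Icc 0 1) t)
    (hz' : ∀ t ∈ Set.Icc (0 : ℝ) 1,
      HasDerivWithinAt z' (-(Θ (x₀ + t • (y + k)) (y + k) (z' t))) (Set.Icc 0 1) t)
    (h0 : z' 0 = z 0) (hd : ∀ t ∈ Set.Icc (0 : ℝ) 1, DifferentiableAt ℝ Θ (x₀ + t • y))
    (hflat : ∀ t ∈ Set.Icc (0 : ℝ) 1, curvForm Θ (x₀ + t • y) k y = 0)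
    (hM : ∀ t ∈ Set.Icc (0 : ℝ) 1, ‖Θ (x₀ + t • y)‖ ≤ M)
    (hM' : ∀ t ∈ Set.Icc (0 : ℝ) 1, ‖fderiv ℝ Θ (x₀ + t • y)‖ ≤ M)
    (hC : ∀ t ∈ Set.Icc (0 : ℝ) 1, ‖Θ (x₀ + t • y + t • k) - Θ (x₀ + t • y)
      - fderiv ℝ Θ (x₀ + t • y) (t • k)‖ ≤ C * ‖t • k‖ ^ 2) (hC0 : 0 ≤ C)
    (hb : ∀ t ∈ Set.Icc (0 : ℝ) 1, ‖Θ (x₀ + t • (y + k)) (y + k)‖ ≤ 1)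
    (hyk : ‖y + k‖ ≤ 1) (hy : ‖y‖ ≤ 1) (hk : ‖k‖ ≤ 1) (hN : ∀ t ∈ Set.Icc (0 : ℝ) 1, ‖z t‖ ≤ N) :
    ‖z' 1 - z 1 + Θ (x₀ + y) k (z 1)‖
      ≤ (((M + C) * (N + M * N) + M * M * N + M * M * N) * (Real.exp 1 - 1)) * ‖k‖ ^ 2 := by
  have hM0 : 0 ≤ M := (norm_nonneg _).trans (hM 0 (by simp))
  have hN0 : 0 ≤ N := (norm_nonneg _).trans (hN 0 (by simp))
  set p : ℝ → X := fun t => x₀ + t • y with hp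
  have hline : ∀ t, HasDerivAt p y t := fun t => by
    rw [hp]
    simpa using ((hasDerivAt_id t).smul_const y).const_add x₀
  have hTh : ∀ t ∈ Set.Icc (0 : ℝ) 1,
      HasDerivWithinAt (fun t => Θ (p t)) (fderiv ℝ Θ (p t) y) (Set.Icc 0 1) t := fun t ht =>
    ((hd t ht).hasFDerivAt.comp_hasDerivAt t (hline t)).hasDerivWithinAt
  -- The linear prediction for transport along `y + k`: the ray point at time `t` is displaced by `t
  -- • k`, so the parallel section should change by `-Θ(t • k) z`.
  set m : ℝ → W := fun t => z t - t • Θ (p t) k (z t) with hm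
  set m' : ℝ → W := fun t => -(Θ (p t) y (z t)) - (Θ (p t) k (z t)
      + t • (fderiv ℝ Θ (p t) y k (z t) - Θ (p t) k (Θ (p t) y (z t)))) with hm'
  have hmd : ∀ t ∈ Set.Icc (0 : ℝ) 1, HasDerivWithinAt m (m' t) (Set.Icc 0 1) t := fun t ht => by
    have e1 := ((hTh t ht).clm_apply (hasDerivWithinAt_const t _ k)).clm_apply (hz t ht)
    have e2 := (hz t ht).sub ((hasDerivWithinAt_id t (Set.Icc (0 : ℝ) 1)).smul e1)
    refine e2.congr_deriv ?_
    simp only [hm', hp, map_neg, map_zero, add_zero, id_eq, one_smul]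
    module
  have hbound : ∀ t ∈ Set.Icc (0 : ℝ) 1,
      dist (m' t) (-(Θ (x₀ + t • (y + k)) (y + k) (m t)))
        ≤ ((M + C) * (N + M * N) + M * M * N + M * M * N) * ‖k‖ ^ 2 := fun t ht => by
    obtain ⟨E, hE⟩ : ∃ E, E = Θ (p t + t • k) - Θ (p t) - fderiv ℝ Θ (p t) (t • k) := ⟨_, rfl⟩
    have hE2 : Θ (x₀ + t • (y + k)) = Θ (p t) + t • fderiv ℝ Θ (p t) k + E := by
      rw [hE, smul_add, ← add_assoc, map_smul]
      abel
    -- Flatness exchanges the derivative of `Θ` along `k` for the derivative along the ray. It makes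
    -- all terms linear in `k` cancel in `hrem`.
    have hfl : fderiv ℝ Θ (p t) k y (z t) = fderiv ℝ Θ (p t) y k (z t)
        - (Θ (p t) k (Θ (p t) y (z t)) - Θ (p t) y (Θ (p t) k (z t))) := by
      have := congrArg (fun T : W →L[ℝ] W => T (z t)) (hflat t ht)
      simp only [curvForm, add_apply, sub_apply, ContinuousLinearMap.comp_apply, zero_apply] at this
      rw [← sub_eq_zero, ← this]
      abel
    have hrem : m' t - -(Θ (x₀ + t • (y + k)) (y + k) (m t))
        = (t • fderiv ℝ Θ (p t) k k + E (y + k)) (m t)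
          - t • Θ (p t) k (Θ (p t) k (z t)) - (t * t) • fderiv ℝ Θ (p t) k y (Θ (p t) k (z t)) := by
      simp only [hE2, hm, hm', add_apply, smul_apply, map_add, map_sub, map_smul, hfl]
      module
    have ht0 := ht.1
    have ht1 := ht.2
    have hnk := norm_nonneg k
    have hΘk : ‖Θ (p t) k‖ ≤ M * ‖k‖ := (Θ (p t)).le_of_opNorm_le (hM t ht) k
    have hΘkz : ‖Θ (p t) k (z t)‖ ≤ M * ‖k‖ * N :=
      (ContinuousLinearMap.le_opNorm _ _).trans
        (mul_le_mul hΘk (hN t ht) (norm_nonneg _) (by positivity))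
    have hDk : ‖fderiv ℝ Θ (p t) k‖ ≤ M * ‖k‖ :=
      ContinuousLinearMap.le_of_opNorm_le _ (hM' t ht) k
    have hmt : ‖m t‖ ≤ N + M * N := by
      refine (norm_sub_le _ _).trans (add_le_add (hN t ht) ?_)
      rw [norm_smul, Real.norm_of_nonneg ht0]
      calc t * ‖Θ (p t) k (z t)‖ ≤ 1 * (M * 1 * N) := by gcongr; exact hΘkz.trans (by gcongr)
        _ = M * N := by ring
    have hEn : ‖E‖ ≤ C * ‖k‖ ^ 2 := by
      rw [hE]
      refine (hC t ht).trans ?_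
      gcongr
      rw [norm_smul, Real.norm_of_nonneg ht0]
      exact mul_le_of_le_one_left hnk ht1
    rw [dist_eq_norm, hrem]
    have b1 : ‖(t • fderiv ℝ Θ (p t) k k + E (y + k)) (m t)‖
        ≤ (M * ‖k‖ ^ 2 + C * ‖k‖ ^ 2) * (N + M * N) := by
      refine (ContinuousLinearMap.le_opNorm _ _).trans
        (mul_le_mul ((norm_add_le _ _).trans (add_le_add ?_ ?_)) hmt (norm_nonneg _)
          (by positivity))
      · rw [norm_smul, Real.norm_of_nonneg ht0]
        calc t * ‖fderiv ℝ Θ (p t) k k‖ ≤ 1 * (M * ‖k‖ * ‖k‖) := by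
              gcongr; exact ContinuousLinearMap.le_of_opNorm_le _ hDk k
          _ = M * ‖k‖ ^ 2 := by ring
      · calc ‖E (y + k)‖ ≤ C * ‖k‖ ^ 2 * 1 :=
              (E.le_of_opNorm_le hEn _).trans (by gcongr)
          _ = C * ‖k‖ ^ 2 := by ring
    have b2 : ‖t • Θ (p t) k (Θ (p t) k (z t))‖ ≤ M * M * N * ‖k‖ ^ 2 := by
      rw [norm_smul, Real.norm_of_nonneg ht0]
      calc t * ‖Θ (p t) k (Θ (p t) k (z t))‖ ≤ 1 * (M * ‖k‖ * (M * ‖k‖ * N)) := by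
            gcongr
            exact (ContinuousLinearMap.le_of_opNorm_le _ hΘk _).trans (by gcongr)
        _ = M * M * N * ‖k‖ ^ 2 := by ring
    have b3 : ‖(t * t) • fderiv ℝ Θ (p t) k y (Θ (p t) k (z t))‖ ≤ M * M * N * ‖k‖ ^ 2 := by
      rw [norm_smul, Real.norm_of_nonneg (by positivity)]
      have hDky : ‖fderiv ℝ Θ (p t) k y‖ ≤ M * ‖k‖ * 1 :=
        (ContinuousLinearMap.le_of_opNorm_le _ hDk y).trans (by gcongr)
      calc t * t * ‖fderiv ℝ Θ (p t) k y (Θ (p t) k (z t))‖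
          ≤ 1 * 1 * (M * ‖k‖ * 1 * (M * ‖k‖ * N)) := by
            gcongr
            exact (ContinuousLinearMap.le_of_opNorm_le _ hDky _).trans (by gcongr)
        _ = M * M * N * ‖k‖ ^ 2 := by ring
    calc _ ≤ _ := (norm_sub_le _ _).trans (add_le_add ((norm_sub_le _ _).trans
          (add_le_add b1 b2)) b3)
      _ = _ := by ring
  -- `z'` is an exact solution and `m` an approximate one with the same initial value; `K = 1` is
  -- the bound on the coefficient along the new ray.
  have hgron := dist_le_of_approx_trajectories_ODE_of_mem (a := 0) (b := 1) (K := 1) (δ := 0)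
    (v := fun t w => -(Θ (x₀ + t • (y + k)) (y + k) w)) (s := fun _ => Set.univ)
    (f := z') (g := m) (f' := fun t => -(Θ (x₀ + t • (y + k)) (y + k) (z' t))) (g' := m')
    (εf := 0) (εg := ((M + C) * (N + M * N) + M * M * N + M * M * N) * ‖k‖ ^ 2)
    (fun t ht => LipschitzWith.lipschitzOnWith (LipschitzWith.of_dist_le_mul fun a b => by
      rw [dist_eq_norm, dist_eq_norm, ← neg_sub', norm_neg, ← map_sub]
      exact ContinuousLinearMap.le_of_opNorm_le _ (hb t ⟨ht.1, ht.2.le⟩) _))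
    (fun t ht => (hz' t ht).continuousWithinAt)
    (fun t ht => (hz' t ⟨ht.1, ht.2.le⟩).mono_of_mem_nhdsWithin (Icc_mem_nhdsGE_of_mem ht))
    (fun t ht => by simp) (fun _ _ => Set.mem_univ _)
    (fun t ht => (hmd t ht).continuousWithinAt)
    (fun t ht => (hmd t ⟨ht.1, ht.2.le⟩).mono_of_mem_nhdsWithin (Icc_mem_nhdsGE_of_mem ht))
    (fun t ht => hbound t ⟨ht.1, ht.2.le⟩) (fun _ _ => Set.mem_univ _)
    (by simp [hm, h0]) 1 (by simp)
  rw [gronwallBound_of_K_ne_0 (by simp), dist_eq_norm] at hgron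
  have e : z' 1 - z 1 + Θ (x₀ + y) k (z 1) = z' 1 - m 1 := by
    simp only [hm, hp, one_smul]
    abel
  rw [e]
  refine hgron.trans (le_of_eq ?_)
  simp
  ring

/-- Parallel transport along rays for a flat linear connection depends differentiably on the end
point, with the expected derivative. -/
theorem exists_parallel [CompleteSpace W] {Θ : X → X →L[ℝ] W →L[ℝ] W} {x₀ : X}
    (hΘ : ContDiffAt ℝ 2 Θ x₀)
    (hflat : ∀ᶠ y in 𝓝 x₀, ∀ u v, curvForm Θ y u v = 0) (w : W) :
    ∃ s : X → W, s x₀ = w ∧ ∀ᶠ y in 𝓝 x₀, HasFDerivAt s (-((Θ y).flip (s y))) y := by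
  have hd := eventually_differentiableAt hΘ
  obtain ⟨K, S, hS, hK⟩ := (hΘ.fderiv_right (m := 1) (by norm_num)).exists_lipschitzOnWith
  obtain ⟨M, hM0, hM⟩ : ∃ M : ℝ, 0 < M ∧ ∀ᶠ y in 𝓝 x₀, ‖Θ y‖ ≤ M ∧ ‖fderiv ℝ Θ y‖ ≤ M := by
    have hc : ContinuousAt (fderiv ℝ Θ) x₀ :=
      (hΘ.fderiv_right (m := 1) (by norm_num)).continuousAt
    refine ⟨max ‖Θ x₀‖ ‖fderiv ℝ Θ x₀‖ + 1, by positivity, ?_⟩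
    filter_upwards [hΘ.continuousAt.norm.eventually
      (gt_mem_nhds (lt_of_le_of_lt (le_max_left _ ‖fderiv ℝ Θ x₀‖) (lt_add_one _))),
      hc.norm.eventually
      (gt_mem_nhds (lt_of_le_of_lt (le_max_right ‖Θ x₀‖ _) (lt_add_one _)))] with y h1 h2
    exact ⟨h1.le, h2.le⟩
  obtain ⟨r, hr, hball⟩ := Metric.eventually_nhds_iff_ball.1
    (hd.and (hflat.and (hM.and (eventually_mem_set.2 hS))))
  have hKb : LipschitzOnWith K (fderiv ℝ Θ) (Metric.ball x₀ r) :=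
    hK.mono fun y hy => (hball y hy).2.2.2
  -- The bound `M * ρ ≤ 1 / 2` makes the linear equation along each ray solvable up to time `1`.
  obtain ⟨ρ, hρ, hρr, hρM, hρ1⟩ : ∃ ρ : ℝ, 0 < ρ ∧ ρ ≤ r ∧ M * ρ ≤ 1 / 2 ∧ ρ ≤ 1 := by
    refine ⟨min (min r (1 / (2 * M))) 1, by positivity, (min_le_left _ _).trans (min_le_left _ _),
      ?_, min_le_right _ _⟩
    calc M * min (min r (1 / (2 * M))) 1 ≤ M * (1 / (2 * M)) := by
          gcongr; exact (min_le_left _ _).trans (min_le_right _ _)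
      _ = 1 / 2 := by field_simp
  have hmem : ∀ y : X, ‖y‖ < ρ → ∀ t ∈ Set.Icc (0 : ℝ) 1, x₀ + t • y ∈ Metric.ball x₀ r :=
    fun y hy t ht => by
      rw [mem_ball_iff_norm, add_sub_cancel_left, norm_smul, Real.norm_of_nonneg ht.1]
      nlinarith [norm_nonneg y, ht.2]
  have hray : ∀ y : X, ‖y‖ < ρ → ∀ t ∈ Set.Icc (0 : ℝ) 1, ‖Θ (x₀ + t • y) y‖ ≤ 1 / 2 :=
    fun y hy t ht => by
      refine ((Θ (x₀ + t • y)).le_of_opNorm_le (hball _ (hmem y hy t ht)).2.2.1.1 y).trans ?_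
      exact (mul_le_mul_of_nonneg_left hy.le hM0.le).trans hρM
  have hline : ∀ (y : X) (t : ℝ), HasDerivAt (fun t : ℝ => x₀ + t • y) y t := fun y t => by
    simpa using ((hasDerivAt_id t).smul_const y).const_add x₀
  have hcont : ∀ y : X, ‖y‖ < ρ → ContinuousOn (fun t : ℝ => Θ (x₀ + t • y)) (Set.Icc 0 1) :=
    fun y hy t ht => ((hball _ (hmem y hy t ht)).1.continuousAt.comp
      (f := fun t : ℝ => x₀ + t • y) (hline y t).continuousAt).continuousWithinAt
  -- Outside the small ball the constant curve serves as a default, so that one function `Z` is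
  -- defined for all `y`.
  have hex : ∀ y : X, ∃ z : ℝ → W, z 0 = w ∧ (‖y‖ < ρ → ∀ t ∈ Set.Icc (0 : ℝ) 1,
      HasDerivWithinAt z (-(Θ (x₀ + t • y) y (z t))) (Set.Icc 0 1) t) := fun y => by
    by_cases hy : ‖y‖ < ρ
    · obtain ⟨z, h0, h1⟩ := exists_linear_ode_solution (a := fun t => Θ (x₀ + t • y) y)
        ((hcont y hy).clm_apply continuousOn_const) (hray y hy) w
      exact ⟨z, h0, fun _ => h1⟩
    · exact ⟨fun _ => w, rfl, fun h => absurd h hy⟩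
  choose Z hZ0 hZ using hex
  have hZc : ∀ y, ‖y‖ < ρ → ContinuousOn (Z y) (Set.Icc 0 1) := fun y hy t ht =>
    (hZ y hy t ht).continuousWithinAt
  refine ⟨fun x => Z (x - x₀) 1, ?_, ?_⟩
  · have h0 : ‖(0 : X)‖ < ρ := by simpa using hρ
    simp only [sub_self]
    rw [← hZ0 0]
    refine constant_of_has_deriv_right_zero (hZc 0 h0) (fun t ht => ?_) 1 (by simp)
    have := hZ 0 h0 t ⟨ht.1, ht.2.le⟩
    simp only [map_zero, zero_apply, neg_zero] at this
    exact this.mono_of_mem_nhdsWithin (Icc_mem_nhdsGE_of_mem ht)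
  rw [Metric.eventually_nhds_iff_ball]
  refine ⟨ρ, hρ, fun x hx => ?_⟩
  obtain ⟨y, rfl⟩ : ∃ y, x = x₀ + y := ⟨x - x₀, by abel⟩
  have hy : ‖y‖ < ρ := by simpa [mem_ball_iff_norm] using hx
  obtain ⟨N, hN⟩ := isCompact_Icc.exists_bound_of_continuousOn (hZc y hy)
  refine hasFDerivAt_of_quadratic_bound
    (C := ((M + K) * (N + M * N) + M * M * N + M * M * N) * (Real.exp 1 - 1)) ?_
  have hev : ∀ᶠ k in 𝓝 (0 : X), ‖k‖ < 1 ∧ ‖y + k‖ < ρ := by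
    refine (ContinuousAt.eventually_lt continuous_norm.continuousAt continuousAt_const
      (by simp)).and (ContinuousAt.eventually_lt (by fun_prop) continuousAt_const (by simpa using hy))
  filter_upwards [hev] with k ⟨hk1, hk⟩
  have := norm_ray_sub_le (hZ y hy) (hZ (y + k) hk) ((hZ0 _).trans (hZ0 _).symm)
    (fun t ht => (hball _ (hmem y hy t ht)).1) (fun t ht => (hball _ (hmem y hy t ht)).2.1 k y)
    (fun t ht => (hball _ (hmem y hy t ht)).2.2.1.1)
    (fun t ht => (hball _ (hmem y hy t ht)).2.2.1.2)
    (fun t ht => norm_taylor_le (convex_ball x₀ r) (fun y hy => (hball y hy).1) hKb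
      (hmem y hy t ht) (by rw [add_assoc, ← smul_add]; exact hmem _ hk t ht)) K.2
    (fun t ht => (hray _ hk t ht).trans (by norm_num)) (hk.le.trans hρ1) (hy.le.trans hρ1) hk1.le hN
  simpa [add_assoc] using this

theorem contDiffAt_flip {Y Z : Type*} [NormedAddCommGroup Y] [NormedSpace ℝ Y]
    [NormedAddCommGroup Z] [NormedSpace ℝ Z] {m : ℕ∞ω} {T : X → Y →L[ℝ] W →L[ℝ] Z} {x : X}
    (hT : ContDiffAt ℝ m T x) : ContDiffAt ℝ m (fun y => (T y).flip) x := by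
  let L : (Y →L[ℝ] W →L[ℝ] Z) →L[ℝ] W →L[ℝ] Y →L[ℝ] Z :=
    (ContinuousLinearMap.flipₗᵢ ℝ Y W Z).toContinuousLinearEquiv
  exact L.contDiff.contDiffAt.comp x hT

/-- Bootstrap: the derivative of `s` is an expression in `Θ` and `s`, so each degree of
differentiability of `s` yields the next. -/
theorem contDiffAt_of_parallel {Θ : X → X →L[ℝ] W →L[ℝ] W} {x₀ : X} {s : X → W}
    (hΘ : ∀ᶠ y in 𝓝 x₀, ContDiffAt ℝ ∞ Θ y)
    (hs : ∀ᶠ y in 𝓝 x₀, HasFDerivAt s (-((Θ y).flip (s y))) y) :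
    ∀ᶠ y in 𝓝 x₀, ContDiffAt ℝ ∞ s y := by
  filter_upwards [eventually_eventually_nhds.2 hs, hΘ] with y hy hΘy
  rw [contDiffAt_infty]
  intro k
  induction k with
  | zero =>
    exact contDiffAt_zero.2 ⟨_, hy, fun z hz => (HasFDerivAt.continuousAt hz).continuousWithinAt⟩
  | succ k ih =>
    refine contDiffAt_succ_iff_hasFDerivAt.2 ⟨_, ⟨_, hy, fun z hz => hz⟩, ?_⟩
    have h1 : ContDiffAt ℝ k (fun z => (Θ z).flip) y :=
      contDiffAt_flip (hΘy.of_le (by exact_mod_cast le_top))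
    exact (h1.clm_apply ih).neg

end Frobenius

/-! ### Flat conformal changes from the structure equations -/

section ConformalFlatness

variable {n : ℕ} {F : Type*} [NormedAddCommGroup F] [NormedSpace ℝ F]
  {H : EuclideanSpace ℝ (Fin n) → F →L[ℝ] F →L[ℝ] ℝ}
  {θ : EuclideanSpace ℝ (Fin n) → EuclideanSpace ℝ (Fin n) →L[ℝ] F →L[ℝ] F}
  {Φ Ψ : EuclideanSpace ℝ (Fin n) → EuclideanSpace ℝ (Fin n) →L[ℝ] F}
  {x y : EuclideanSpace ℝ (Fin n)}

theorem CoherentNear.eventually [FiniteDimensional ℝ F]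
    (hF : Module.finrank ℝ (EuclideanSpace ℝ (Fin n)) = Module.finrank ℝ F)
    (h : CoherentNear H θ Φ x) : ∀ᶠ y in 𝓝 x, CoherentNear H θ Φ y := by
  filter_upwards [h.smooth_metric.eventually (by simp), h.smooth_form.eventually (by simp),
    h.smooth_hom.eventually (by simp), eventually_eventually_nhds.2 h.metric,
    eventually_eventually_nhds.2 h.coherent, eventually_eventually_nhds.2 h.symm,
    eventually_eventually_nhds.2 h.pos,
    eventually_injective hF h.smooth_hom.continuousAt h.injective] with y h1 h2 h3 h4 h5 h6 h7 h8
  exact ⟨h1, h2, h3, h4, h5, h6, h7, h8⟩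

theorem metric_injective {h : F →L[ℝ] F →L[ℝ] ℝ} (hpos : ∀ a, a ≠ 0 → 0 < h a a) :
    Function.Injective h := by
  rw [injective_iff_map_eq_zero]
  intro a ha
  by_contra hne
  have := hpos a hne
  rw [ha] at this
  exact lt_irrefl _ this

/-- Near a regular point both `Φ` and the map `F → F*` given by `H` are invertible, so the gradient
equation is solved pointwise, and inversion preserves differentiability. -/
theorem CoherentNear.exists_gradient [FiniteDimensional ℝ F]
    (hF : Module.finrank ℝ (EuclideanSpace ℝ (Fin n)) = Module.finrank ℝ F)
    (h : CoherentNear H θ Φ x) {σ : EuclideanSpace ℝ (Fin n) → ℝ} (hσ : ContDiffAt ℝ 3 σ x) :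
    ∃ ξ : EuclideanSpace ℝ (Fin n) → F, ContDiffAt ℝ 2 ξ x ∧
      ∀ᶠ y in 𝓝 x, ∀ v, H y (ξ y) (Φ y v) = fderiv ℝ σ y v := by
  have hdual : Module.finrank ℝ F = Module.finrank ℝ (F →L[ℝ] ℝ) := by
    rw [← (LinearMap.toContinuousLinearMap (𝕜 := ℝ) (E := F) (F' := ℝ)).finrank_eq]
    exact (Subspace.dual_finrank_eq).symm
  refine ⟨fun y => (H y).inverse (fderiv ℝ σ y ∘L (Φ y).inverse), ?_, ?_⟩
  · exact (contDiffAt_inverse hdual h.smooth_metric (metric_injective h.pos.self_of_nhds)).clm_apply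
      ((hσ.fderiv_right (m := 2) (by norm_num)).clm_comp
        (contDiffAt_inverse hF h.smooth_hom h.injective))
  · filter_upwards [h.pos, eventually_injective hF h.smooth_hom.continuousAt h.injective]
      with y h1 h2 v
    rw [inverse_apply_of_injective hdual (metric_injective h1), ContinuousLinearMap.comp_apply]
    congr 1
    exact h2 (inverse_apply_of_injective hF h2 _)

/-! ### The tractor connection -/

/-- The connection form on `ℝ × F × ℝ` whose parallel sections are the conformal factors making
the metric flat. -/
def tractorForm (H : EuclideanSpace ℝ (Fin n) → F →L[ℝ] F →L[ℝ] ℝ)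
    (θ : EuclideanSpace ℝ (Fin n) → EuclideanSpace ℝ (Fin n) →L[ℝ] F →L[ℝ] F)
    (Φ Ψ : EuclideanSpace ℝ (Fin n) → EuclideanSpace ℝ (Fin n) →L[ℝ] F)
    (x : EuclideanSpace ℝ (Fin n)) :
    EuclideanSpace ℝ (Fin n) →L[ℝ] (ℝ × F × ℝ) →L[ℝ] (ℝ × F × ℝ) :=
  let π₁ := ContinuousLinearMap.fst ℝ ℝ (F × ℝ)
  let π₂ := ContinuousLinearMap.fst ℝ F ℝ ∘L ContinuousLinearMap.snd ℝ ℝ (F × ℝ)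
  let π₃ := ContinuousLinearMap.snd ℝ F ℝ ∘L ContinuousLinearMap.snd ℝ ℝ (F × ℝ)
  let ι₁ := ContinuousLinearMap.inl ℝ ℝ (F × ℝ)
  let ι₂ := ContinuousLinearMap.inr ℝ ℝ (F × ℝ) ∘L ContinuousLinearMap.inl ℝ F ℝ
  let ι₃ := ContinuousLinearMap.inr ℝ ℝ (F × ℝ) ∘L ContinuousLinearMap.inr ℝ F ℝ
  (ContinuousLinearMap.compL ℝ (ℝ × F × ℝ) F (ℝ × F × ℝ) ι₂
    ∘L (ContinuousLinearMap.compL ℝ (ℝ × F × ℝ) F F).flip π₂) ∘L θ x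
    + (ContinuousLinearMap.compL ℝ (ℝ × F × ℝ) F (ℝ × F × ℝ) ι₂
      ∘L ContinuousLinearMap.smulRightL ℝ (ℝ × F × ℝ) F π₁) ∘L Ψ x
    + (ContinuousLinearMap.compL ℝ (ℝ × F × ℝ) F (ℝ × F × ℝ) ι₂
      ∘L ContinuousLinearMap.smulRightL ℝ (ℝ × F × ℝ) F π₃) ∘L Φ x
    - (ContinuousLinearMap.compL ℝ (ℝ × F × ℝ) ℝ (ℝ × F × ℝ) ι₁
      ∘L (ContinuousLinearMap.compL ℝ (ℝ × F × ℝ) F ℝ).flip π₂) ∘L (H x ∘L Φ x)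
    - (ContinuousLinearMap.compL ℝ (ℝ × F × ℝ) ℝ (ℝ × F × ℝ) ι₃
      ∘L (ContinuousLinearMap.compL ℝ (ℝ × F × ℝ) F ℝ).flip π₂) ∘L (H x ∘L Ψ x)

theorem tractorForm_apply (v : EuclideanSpace ℝ (Fin n)) (w : ℝ × F × ℝ) :
    tractorForm H θ Φ Ψ x v w = (-H x (Φ x v) w.2.1, θ x v w.2.1 + w.1 • Ψ x v + w.2.2 • Φ x v,
      -H x (Ψ x v) w.2.1) := by
  simp [tractorForm]

theorem contDiffAt_tractorForm {m : ℕ∞ω} (hH : ContDiffAt ℝ m H x) (hθ : ContDiffAt ℝ m θ x)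
    (hΦ : ContDiffAt ℝ m Φ x) (hΨ : ContDiffAt ℝ m Ψ x) :
    ContDiffAt ℝ m (tractorForm H θ Φ Ψ) x :=
  ((((contDiffAt_const.clm_comp hθ).add (contDiffAt_const.clm_comp hΨ)).add
    (contDiffAt_const.clm_comp hΦ)).sub (contDiffAt_const.clm_comp (hH.clm_comp hΦ))).sub
    (contDiffAt_const.clm_comp (hH.clm_comp hΨ))

/-- The outer components of the curvature vanish by closedness of `Φ` and of `Ψ` together with
symmetry of `⟨Φ, Ψ⟩`. In the middle component the `F`-part is the curvature of `θ` plus the product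
of `Φ` and `Ψ`, and the two scalar parts again reduce to closedness. -/
theorem curvForm_tractorForm (hH : DifferentiableAt ℝ H x) (hθ : DifferentiableAt ℝ θ x)
    (hΦ : DifferentiableAt ℝ Φ x) (hΨ : DifferentiableAt ℝ Ψ x)
    (hT : DifferentiableAt ℝ (tractorForm H θ Φ Ψ) x) (hm : MetricAt H θ x)
    (hcΦ : CoherentAt θ Φ x) (hcΨ : CoherentAt θ Ψ x) (hsymm : ∀ a b, H x a b = H x b a)
    (hB : ∀ u v, H x (Φ x u) (Ψ x v) = H x (Φ x v) (Ψ x u))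
    (hR : ∀ u v a, curvForm θ x u v a = -kulkarni (H x) (Φ x) (Ψ x) u v a)
    (u v : EuclideanSpace ℝ (Fin n)) : curvForm (tractorForm H θ Φ Ψ) x u v = 0 := by
  have hd : ∀ u v w, fderiv ℝ (tractorForm H θ Φ Ψ) x u v w
      = (-(H x (covD θ (fun y => Φ y v) u x) w.2.1 + H x (Φ x v) (θ x u w.2.1)),
        fderiv ℝ θ x u v w.2.1 + w.1 • fderiv ℝ Ψ x u v + w.2.2 • fderiv ℝ Φ x u v,
        -(H x (covD θ (fun y => Ψ y v) u x) w.2.1 + H x (Ψ x v) (θ x u w.2.1))) := fun u v w => by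
    have hΦv : DifferentiableAt ℝ (fun y => Φ y v) x := hΦ.clm_apply (differentiableAt_const v)
    have hΨv : DifferentiableAt ℝ (fun y => Ψ y v) x := hΨ.clm_apply (differentiableAt_const v)
    have hθv : DifferentiableAt ℝ (fun y => θ y v w.2.1) x :=
      (hθ.clm_apply (differentiableAt_const v)).clm_apply (differentiableAt_const w.2.1)
    have h1 : DifferentiableAt ℝ (fun y => H y (Φ y v) w.2.1) x :=
      (hH.clm_apply hΦv).clm_apply (differentiableAt_const w.2.1)
    have h3 : DifferentiableAt ℝ (fun y => H y (Ψ y v) w.2.1) x :=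
      (hH.clm_apply hΨv).clm_apply (differentiableAt_const w.2.1)
    have h2 : DifferentiableAt ℝ (fun y => θ y v w.2.1 + w.1 • Ψ y v + w.2.2 • Φ y v) x :=
      (hθv.fun_add (hΨv.const_smul w.1)).fun_add (hΦv.const_smul w.2.2)
    rw [← fderiv_apply_const hT, ← fderiv_apply_const (hT.clm_apply (differentiableAt_const v))]
    have e : (fun y => tractorForm H θ Φ Ψ y v w) = fun y =>
        (-H y (Φ y v) w.2.1, θ y v w.2.1 + w.1 • Ψ y v + w.2.2 • Φ y v, -H y (Ψ y v) w.2.1) := by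
      ext1 y; exact tractorForm_apply v w
    have e1 := hm.fderiv_apply hH hΦv (differentiableAt_const w.2.1) u
    have e3 := hm.fderiv_apply hH hΨv (differentiableAt_const w.2.1) u
    have e2 : fderiv ℝ (fun y => θ y v w.2.1 + w.1 • Ψ y v + w.2.2 • Φ y v) x u
        = fderiv ℝ θ x u v w.2.1 + w.1 • fderiv ℝ Ψ x u v + w.2.2 • fderiv ℝ Φ x u v := by
      rw [fderiv_fun_add (hθv.fun_add (hΨv.fun_const_smul w.1)) (hΦv.fun_const_smul w.2.2),
        fderiv_fun_add hθv (hΨv.fun_const_smul w.1), fderiv_fun_const_smul hΨv,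
        fderiv_fun_const_smul hΦv]
      simp only [add_apply, smul_apply]
      rw [fderiv_apply_const (hθ.clm_apply (differentiableAt_const v)), fderiv_apply_const hθ,
        fderiv_apply_const hΨ, fderiv_apply_const hΦ]
    have hc : covD θ (fun _ => w.2.1) u x = θ x u w.2.1 := by simp [covD]
    rw [hc] at e1 e3
    rw [e, (h1.hasFDerivAt.fun_neg.prodMk (h2.hasFDerivAt.prodMk h3.hasFDerivAt.fun_neg)).fderiv]
    simp only [ContinuousLinearMap.prod_apply, neg_apply, e1, e2, e3]
  refine ContinuousLinearMap.ext fun w => ?_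
  have hΦs := (coherentAt_iff_covD hΦ).1 hcΦ v u
  have hΨs := (coherentAt_iff_covD hΨ).1 hcΨ v u
  have hR' := hR u v w.2.1
  have h1 := hcΦ u v
  have h2 := hcΨ u v
  simp only [curvForm, add_apply, sub_apply, ContinuousLinearMap.comp_apply, hd,
    tractorForm_apply, zero_apply, kulkarni] at hR' ⊢
  refine Prod.ext ?_ (Prod.ext ?_ ?_)
  · simp only [Prod.fst_add, Prod.fst_sub, map_add, map_smul, smul_eq_mul, Prod.fst_zero, hΦs,
      hsymm (Φ x v) (Φ x u), hB u v]
    ring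
  · simp only [Prod.snd_add, Prod.snd_sub, Prod.fst_add, Prod.fst_sub, map_add, map_smul,
      Prod.fst_zero, Prod.snd_zero]
    rw [eq_sub_of_add_eq h1, eq_sub_of_add_eq h2, ← sub_eq_zero.2 hR']
    module
  · simp only [Prod.snd_add, Prod.snd_sub, map_add, map_smul, smul_eq_mul,
      Prod.snd_zero, hΨs, hsymm (Ψ x v) (Ψ x u), hsymm (Ψ x u) (Φ x v), hsymm (Ψ x v) (Φ x u),
      hB u v]
    ring

/-- Local existence of a flat conformal change: the theorem of Weyl and Schouten for coherent
structures. -/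
theorem CoherentNear.exists_flat [FiniteDimensional ℝ F] (h : CoherentNear H θ Φ x)
    (hH : ∀ᶠ y in 𝓝 x, ContDiffAt ℝ ∞ H y) (hθ : ∀ᶠ y in 𝓝 x, ContDiffAt ℝ ∞ θ y)
    (hΦ : ∀ᶠ y in 𝓝 x, ContDiffAt ℝ ∞ Φ y) (hΨ : ∀ᶠ y in 𝓝 x, ContDiffAt ℝ ∞ Ψ y)
    (hc : ∀ᶠ y in 𝓝 x, CoherentAt θ Ψ y)
    (hB : ∀ᶠ y in 𝓝 x, ∀ u v, H y (Φ y u) (Ψ y v) = H y (Φ y v) (Ψ y u))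
    (hR : ∀ᶠ y in 𝓝 x, ∀ u v a, curvForm θ y u v a = -kulkarni (H y) (Φ y) (Ψ y) u v a) :
    ∃ (σ : EuclideanSpace ℝ (Fin n) → ℝ) (ξ : EuclideanSpace ℝ (Fin n) → F),
      (∀ᶠ y in 𝓝 x, ContDiffAt ℝ ∞ σ y) ∧ (∀ᶠ y in 𝓝 x, ContDiffAt ℝ 2 ξ y) ∧
      (∀ᶠ y in 𝓝 x, ∀ v, H y (ξ y) (Φ y v) = fderiv ℝ σ y v) ∧
      ∀ᶠ y in 𝓝 x, ∀ u v, curvForm (confForm H θ Φ ξ) y u v = 0 := by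
  have hT : ∀ᶠ y in 𝓝 x, ContDiffAt ℝ ∞ (tractorForm H θ Φ Ψ) y := by
    filter_upwards [hH, hθ, hΦ, hΨ] with y h1 h2 h3 h4
    exact contDiffAt_tractorForm h1 h2 h3 h4
  have h0 : (∞ : ℕ∞ω) ≠ 0 := by simp
  have hflat : ∀ᶠ y in 𝓝 x, ∀ u v, curvForm (tractorForm H θ Φ Ψ) y u v = 0 := by
    filter_upwards [hH, hθ, hΦ, hΨ, hT, h.metric, h.coherent, hc, h.symm, hB, hR]
      with y h1 h2 h3 h4 h5 h6 h7 h8 h9 h10 h11 u v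
    exact curvForm_tractorForm (h1.differentiableAt h0) (h2.differentiableAt h0)
      (h3.differentiableAt h0) (h4.differentiableAt h0) (h5.differentiableAt h0) h6 h7 h8 h9 h10
      h11 u v
  -- The initial value has positive first entry, so that its logarithm is defined nearby, and is
  -- null for the form `2 τ ρ + |ζ|²`.
  obtain ⟨s, hs0, hs⟩ := exists_parallel (contDiffAt_infty.1 hT.self_of_nhds 2) hflat
    ((1, 0, 0) : ℝ × F × ℝ)
  have hsm := contDiffAt_of_parallel hT hs
  set τ : EuclideanSpace ℝ (Fin n) → ℝ := fun y => (s y).1 with hτ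
  set ζ : EuclideanSpace ℝ (Fin n) → F := fun y => (s y).2.1 with hζ
  set ρ : EuclideanSpace ℝ (Fin n) → ℝ := fun y => (s y).2.2 with hρ
  have hτm : ∀ᶠ y in 𝓝 x, ContDiffAt ℝ ∞ τ y := hsm.mono fun y hy => hy.fst
  have hζm : ∀ᶠ y in 𝓝 x, ContDiffAt ℝ ∞ ζ y := hsm.mono fun y hy => hy.snd.fst
  have hρm : ∀ᶠ y in 𝓝 x, ContDiffAt ℝ ∞ ρ y := hsm.mono fun y hy => hy.snd.snd
  have hder : ∀ᶠ y in 𝓝 x, ∀ v, fderiv ℝ τ y v = H y (Φ y v) (ζ y) ∧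
      covD θ ζ v y = -(τ y • Ψ y v + ρ y • Φ y v) ∧ fderiv ℝ ρ y v = H y (Ψ y v) (ζ y) := by
    filter_upwards [hs] with y hy v
    have e1 : HasFDerivAt τ _ y := hy.fst
    have e2 : HasFDerivAt ζ _ y := hy.snd.fst
    have e3 : HasFDerivAt ρ _ y := hy.snd.snd
    rw [e1.fderiv, covD, e2.fderiv, e3.fderiv]
    simp only [ContinuousLinearMap.comp_apply, neg_apply, ContinuousLinearMap.flip_apply,
      tractorForm_apply, ContinuousLinearMap.coe_fst', ContinuousLinearMap.coe_snd', Prod.fst_neg,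
      Prod.snd_neg, neg_neg]
    refine ⟨rfl, ?_, rfl⟩
    simp only [hτ, hζ, hρ]
    abel
  have hτ0 : ∀ᶠ y in 𝓝 x, 0 < τ y := by
    refine hτm.self_of_nhds.continuousAt.eventually (lt_mem_nhds ?_)
    simp [hτ, hs0]
  -- The quadratic form is preserved by the connection, so it is constant on a ball and keeps its
  -- value zero at the centre.
  have hnull : ∀ᶠ y in 𝓝 x, 2 * τ y * ρ y + H y (ζ y) (ζ y) = 0 := by
    have hall : ∀ᶠ y in 𝓝 x, HasFDerivAt (fun y => 2 * τ y * ρ y + H y (ζ y) (ζ y))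
        (0 : EuclideanSpace ℝ (Fin n) →L[ℝ] ℝ) y := by
      filter_upwards [hH, hτm, hζm, hρm, hder, h.metric, h.symm] with y h1 h2 h3 h4 h5 h6 h7
      have d1 := h1.differentiableAt h0
      have d2 := h2.differentiableAt h0
      have d3 := h3.differentiableAt h0
      have d4 := h4.differentiableAt h0
      have dH : DifferentiableAt ℝ (fun y => H y (ζ y) (ζ y)) y :=
        (d1.clm_apply d3).clm_apply d3
      have dp : DifferentiableAt ℝ (fun y => 2 * τ y * ρ y) y := (d2.const_mul 2).fun_mul d4
      suffices hz : fderiv ℝ (fun y => 2 * τ y * ρ y + H y (ζ y) (ζ y)) y = 0 from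
        hz ▸ (dp.fun_add dH).hasFDerivAt
      refine ContinuousLinearMap.ext fun v => ?_
      rw [fderiv_fun_add dp dH, add_apply, h6.fderiv_apply d1 d3 d3,
        fderiv_fun_mul (d2.const_mul 2) d4, fderiv_const_mul d2]
      simp only [add_apply, smul_apply, (h5 v).1, (h5 v).2.1, (h5 v).2.2, zero_apply, map_neg,
        map_add, map_smul, neg_apply, smul_eq_mul, h7 (ζ y)]
      ring
    obtain ⟨r, hr, hball⟩ := Metric.eventually_nhds_iff_ball.1 hall
    filter_upwards [Metric.ball_mem_nhds x hr] with y hy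
    have := (convex_ball x r).is_const_of_fderivWithin_eq_zero (𝕜 := ℝ)
      (f := fun y => 2 * τ y * ρ y + H y (ζ y) (ζ y))
      (fun z hz => (hball z hz).differentiableAt.differentiableWithinAt)
      (fun z hz => by
        rw [fderivWithin_of_isOpen Metric.isOpen_ball hz, (hball z hz).fderiv])
      hy (Metric.mem_ball_self hr)
    rw [this]
    simp [hτ, hζ, hρ, hs0]
  refine ⟨fun y => -Real.log (τ y), fun y => (-(τ y)⁻¹) • ζ y, ?_, ?_, ?_, ?_⟩
  · filter_upwards [hτm, hτ0] with y h1 h2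
    exact (h1.log h2.ne').neg
  · filter_upwards [hτm, hτ0, hζm] with y h1 h2 h3
    exact contDiffAt_infty.1 ((h1.inv h2.ne').neg.smul h3) 2
  · filter_upwards [hτm, hτ0, hder, h.symm] with y h1 h2 h3 h4 v
    rw [fderiv_fun_neg, fderiv.log (h1.differentiableAt h0) h2.ne']
    simp only [map_smul, smul_apply, smul_eq_mul, neg_apply, (h3 v).1, h4 (ζ y)]
    ring
  · filter_upwards [hH, hθ, hΦ, hτm, hζm, hder, hτ0, hnull, h.metric, h.coherent, h.symm, hR]
      with y h1 h2 h3 h4 h5 h6 h7 h8 h9 h10 h11 h12 u v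
    have d1 := h1.differentiableAt h0
    have d4 := h4.differentiableAt h0
    have d5 := h5.differentiableAt h0
    have di : DifferentiableAt ℝ (fun y => -(τ y)⁻¹) y := (d4.fun_inv h7.ne').fun_neg
    -- The equation for `Dζ` gives `Ψ` plus a multiple of `Φ`; nullity expresses `ρ` through `ζ` and
    -- `τ` and makes this multiple cancel the `|ξ|²/2` term.
    have hBΨ : confSchouten H θ Φ (fun y => (-(τ y)⁻¹) • ζ y) y = Ψ y := by
      ext1 v
      have e : fderiv ℝ (fun y => -(τ y)⁻¹) y v = (τ y ^ 2)⁻¹ * H y (Φ y v) (ζ y) := by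
        have hi : HasFDerivAt (fun y => (τ y)⁻¹) _ y :=
          (hasDerivAt_inv h7.ne').comp_hasFDerivAt y d4.hasFDerivAt
        rw [fderiv_fun_neg, hi.fderiv]
        simp [(h6 v).1]
      have hρy : ρ y = -(H y (ζ y) (ζ y)) / (2 * τ y) := by
        field_simp
        linarith
      rw [confSchouten_apply, covD_smul di d5, e, (h6 v).2.1]
      simp only [map_smul, smul_apply, smul_eq_mul, h11 (ζ y) (Φ y v), hρy]
      have h7' := h7.ne'
      have t1 : (τ y)⁻¹ * τ y = 1 := inv_mul_cancel₀ h7'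
      match_scalars <;> field_simp <;> ring
    ext1 a
    rw [curvForm_confForm d1 (h2.differentiableAt h0) (h3.differentiableAt h0)
      (di.fun_smul d5) h9 h10 h11, hBΨ, h12]
    simp

end ConformalFlatness

/-! ### The structure equations derived from a flat conformal change -/

section LocalDual

variable {n : ℕ} {F : Type*} [NormedAddCommGroup F] [NormedSpace ℝ F]
  {H : EuclideanSpace ℝ (Fin n) → F →L[ℝ] F →L[ℝ] ℝ}
  {θ : EuclideanSpace ℝ (Fin n) → EuclideanSpace ℝ (Fin n) →L[ℝ] F →L[ℝ] F}
  {Φ : EuclideanSpace ℝ (Fin n) → EuclideanSpace ℝ (Fin n) →L[ℝ] F}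
  {B : EuclideanSpace ℝ (Fin n) →L[ℝ] F} {ξ : EuclideanSpace ℝ (Fin n) → F}
  {σ : EuclideanSpace ℝ (Fin n) → ℝ} {x y : EuclideanSpace ℝ (Fin n)}
  {f : EuclideanSpace ℝ (Fin n) → EuclideanSpace ℝ (Fin n)}

theorem CoherentNear.confSchouten_symm (h : CoherentNear H θ Φ x) (hσ : ContDiffAt ℝ 2 σ x)
    (hξ : DifferentiableAt ℝ ξ x)
    (hgrad : ∀ᶠ y in 𝓝 x, ∀ v, H y (ξ y) (Φ y v) = fderiv ℝ σ y v)
    (u v : EuclideanSpace ℝ (Fin n)) :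
    H x (Φ x u) (confSchouten H θ Φ ξ x v) = H x (Φ x v) (confSchouten H θ Φ ξ x u) :=
  GCF.confSchouten_symm h.symm.self_of_nhds
    (covD_gradient_symm (h.smooth_metric.differentiableAt (by norm_num))
      (h.smooth_hom.differentiableAt (by norm_num)) hξ hσ h.metric.self_of_nhds
      h.coherent.self_of_nhds hgrad) u v

theorem CoherentNear.curvForm_eq_neg_kulkarni (h : CoherentNear H θ Φ x)
    (hξ : DifferentiableAt ℝ ξ x) (hflat : ∀ u v, curvForm (confForm H θ Φ ξ) x u v = 0)
    (u v : EuclideanSpace ℝ (Fin n)) (a : F) :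
    curvForm θ x u v a = -kulkarni (H x) (Φ x) (confSchouten H θ Φ ξ x) u v a := by
  have e := curvForm_confForm (h.smooth_metric.differentiableAt (by norm_num))
    (h.smooth_form.differentiableAt (by norm_num)) (h.smooth_hom.differentiableAt (by norm_num))
    hξ h.metric.self_of_nhds h.coherent.self_of_nhds h.symm.self_of_nhds u v a
  rw [hflat, zero_apply] at e
  exact eq_neg_of_add_eq_zero_left e.symm

theorem contDiffAt_confSchouten (hH : ContDiffAt ℝ 1 H x) (hθ : ContDiffAt ℝ 1 θ x)
    (hΦ : ContDiffAt ℝ 1 Φ x) (hξ : ContDiffAt ℝ 2 ξ x) :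
    ContDiffAt ℝ 1 (confSchouten H θ Φ ξ) x := by
  have hξ1 : ContDiffAt ℝ 1 ξ x := hξ.of_le (by norm_num)
  have hHξ : ContDiffAt ℝ 1 (fun y => H y (ξ y)) x := hH.clm_apply hξ1
  exact (((hξ.fderiv_right (m := 1) (by norm_num)).add ((contDiffAt_flip hθ).clm_apply hξ1)).sub
    ((hHξ.clm_comp hΦ).smulRight hξ1)).add
      ((contDiffAt_const.mul (hHξ.clm_apply hξ1)).smul hΦ)

theorem CoherentNear.coherentAt_confSchouten (h : CoherentNear H θ Φ x)
    (hσ : ContDiffAt ℝ 2 σ x) (hξ : ContDiffAt ℝ 2 ξ x)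
    (hgrad : ∀ᶠ y in 𝓝 x, ∀ v, H y (ξ y) (Φ y v) = fderiv ℝ σ y v)
    (hflat : ∀ u v, curvForm (confForm H θ Φ ξ) x u v = 0) :
    CoherentAt θ (confSchouten H θ Φ ξ) x := by
  have hH := h.smooth_metric.differentiableAt (by norm_num)
  have hΦ := h.smooth_hom.differentiableAt (by norm_num)
  have hξ1 := hξ.differentiableAt (by norm_num)
  exact GCF.coherentAt_confSchouten hH
    (h.smooth_form.of_le (by norm_num)) (h.smooth_hom.of_le (by norm_num)) hξ
    ((contDiffAt_confSchouten (h.smooth_metric.of_le (by norm_num))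
      (h.smooth_form.of_le (by norm_num)) (h.smooth_hom.of_le (by norm_num)) hξ).differentiableAt
      (by norm_num))
    h.metric.self_of_nhds h.coherent.self_of_nhds h.symm.self_of_nhds
    (covD_gradient_symm hH hΦ hξ1 hσ h.metric.self_of_nhds h.coherent.self_of_nhds hgrad)
    (h.curvForm_eq_neg_kulkarni hξ1 hflat)

/-! ### Change of coordinates -/

variable [FiniteDimensional ℝ F] {G : EuclideanSpace ℝ (Fin n) → Matrix (Fin n) (Fin n) ℝ}

/-- Tensoriality under a change of coordinates: the whole structure pulls back along `f` with `B`
replaced by `B ∘ df`, and the Gram computation applies to the pulled-back structure. This avoids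
transforming Christoffel symbols. -/
theorem CoherentNear.schoutenMatrix_pullback (hn : 3 ≤ n)
    (hF : Module.finrank ℝ (EuclideanSpace ℝ (Fin n)) = Module.finrank ℝ F)
    (h : CoherentNear H θ Φ (f y)) (hf : ContDiffAt ℝ 3 f y)
    (hinj : Function.Injective (fderiv ℝ f y))
    (hG : G =ᶠ[𝓝 y] gram (fun z => H (f z)) (pullForm f Φ))
    (hB : ∀ u v, H (f y) (Φ (f y) u) (B v) = H (f y) (Φ (f y) v) (B u))
    (hR : ∀ u v a, curvForm θ (f y) u v a = -kulkarni (H (f y)) (Φ (f y)) B u v a) :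
    schoutenMatrix G y = Matrix.of fun i j =>
      H (f y) (Φ (f y) (fderiv ℝ f y (EuclideanSpace.single i 1)))
        (B (fderiv ℝ f y (EuclideanSpace.single j 1))) := by
  rw [schoutenMatrix_congr hG, (h.pullback hf hinj).schoutenMatrix_gram hn hF
    (B := B ∘L fderiv ℝ f y) (fun u v => hB _ _) fun u v a => ?_]
  · rfl
  · rw [curvForm_pullForm (hf.of_le (by norm_num))
      (h.smooth_form.differentiableAt (by norm_num)), hR]
    rfl

theorem CoherentNear.schoutenHat_pullback (hn : 3 ≤ n)
    (hF : Module.finrank ℝ (EuclideanSpace ℝ (Fin n)) = Module.finrank ℝ F)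
    (h : CoherentNear H θ Φ (f y)) (hf : ContDiffAt ℝ 3 f y)
    (hinj : Function.Injective (fderiv ℝ f y))
    (hG : G =ᶠ[𝓝 y] gram (fun z => H (f z)) (pullForm f Φ))
    (hB : ∀ u v, H (f y) (Φ (f y) u) (B v) = H (f y) (Φ (f y) v) (B u))
    (hR : ∀ u v a, curvForm θ (f y) u v a = -kulkarni (H (f y)) (Φ (f y)) B u v a)
    (c : Fin n → ℝ) :
    Φ (f y) (fderiv ℝ f y (WithLp.toLp 2 (((G y)⁻¹ * schoutenMatrix G y).mulVec c)))
      = B (fderiv ℝ f y (WithLp.toLp 2 c)) := by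
  rw [h.schoutenMatrix_pullback hn hF hf hinj hG hB hR, hG.eq_of_nhds]
  exact schoutenHat_gram (H := fun z => H (f z)) (Φ := pullForm f Φ) (x := y)
    (B := B ∘L fderiv ℝ f y) (h.pullback hf hinj).injective hF h.pos.self_of_nhds c

theorem CoherentNear.sectionalCoord_pullback_eq_zero
    (hF : Module.finrank ℝ (EuclideanSpace ℝ (Fin n)) = Module.finrank ℝ F)
    (h : CoherentNear H θ Φ (f y)) (hf : ContDiffAt ℝ 3 f y)
    (hinj : Function.Injective (fderiv ℝ f y))
    (hG : G =ᶠ[𝓝 y] gram (fun z => H (f z)) (pullForm f Φ))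
    (hflat : ∀ u v, curvForm θ (f y) u v = 0) (a b : Fin n → ℝ) :
    sectionalCoord G y a b = 0 := by
  rw [sectionalCoord_congr hG]
  refine (h.pullback hf hinj).sectionalCoord_eq_zero hF (fun u v => ?_) a b
  rw [curvForm_pullForm (hf.of_le (by norm_num))
    (h.smooth_form.differentiableAt (by norm_num)), hflat]

theorem CoherentNear.curvForm_eq_zero_of_pullback
    (hF : Module.finrank ℝ (EuclideanSpace ℝ (Fin n)) = Module.finrank ℝ F)
    (h : CoherentNear H θ Φ (f y)) (hf : ContDiffAt ℝ 3 f y)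
    (hbij : Function.Bijective (fderiv ℝ f y))
    (hG : G =ᶠ[𝓝 y] gram (fun z => H (f z)) (pullForm f Φ))
    (hsec : ∀ a b : Fin n → ℝ, LinearIndependent ℝ ![a, b] → sectionalCoord G y a b = 0)
    (u v : EuclideanSpace ℝ (Fin n)) : curvForm θ (f y) u v = 0 := by
  obtain ⟨u, rfl⟩ := hbij.2 u
  obtain ⟨v, rfl⟩ := hbij.2 v
  rw [← curvForm_pullForm (hf.of_le (by norm_num))
    (h.smooth_form.differentiableAt (by norm_num))]
  exact (h.pullback hf hbij.1).curvForm_eq_zero hF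
    (fun a b hab => by rw [← sectionalCoord_congr hG, hsec a b hab]) u v

end LocalDual

/-! ### Bundle data in a chart and a trivialization -/

section LocalRepresentation

variable {n : ℕ} {M : Type*} [TopologicalSpace M] [ChartedSpace (EuclideanSpace ℝ (Fin n)) M]
  [IsManifold (𝓡 n) ∞ M]
  {F : Type*} [NormedAddCommGroup F] [NormedSpace ℝ F]

theorem exists_contMDiff_section_eventuallyEq [T2Space M] {V : M → Type*}
    [TopologicalSpace (TotalSpace F V)] [∀ p, AddCommGroup (V p)] [∀ p, Module ℝ (V p)]
    [∀ p, TopologicalSpace (V p)] [FiberBundle F V] [VectorBundle ℝ F V]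
    {s : ∀ q, V q} {U : Set M} {p : M} (hU : IsOpen U) (hp : p ∈ U)
    (hs : ContMDiffOn (𝓡 n) ((𝓡 n).prod 𝓘(ℝ, F)) ∞ (fun q => TotalSpace.mk' F q (s q)) U) :
    ∃ t : ∀ q, V q, ContMDiff (𝓡 n) ((𝓡 n).prod 𝓘(ℝ, F)) ∞ (fun q => TotalSpace.mk' F q (t q)) ∧
      ∀ᶠ q in 𝓝 p, t q = s q := by
  obtain ⟨f, -, hf⟩ := (SmoothBumpFunction.nhds_basis_tsupport (I := 𝓡 n) p).mem_iff.1
    (hU.mem_nhds hp)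
  refine ⟨fun q => f q • s q, ContMDiffOn.smul_section_of_tsupport f.contMDiff.contMDiffOn hU hf hs,
    ?_⟩
  filter_upwards [f.eventuallyEq_one] with q hq
  rw [hq]
  exact one_smul ℝ _

/-- The derivative of the inverse of the chart at `p`. -/
def coordDeriv (p : M) (x : EuclideanSpace ℝ (Fin n)) :
    EuclideanSpace ℝ (Fin n) →L[ℝ] TangentSpace (𝓡 n) ((extChartAt (𝓡 n) p).symm x) :=
  mfderiv 𝓘(ℝ, EuclideanSpace ℝ (Fin n)) (𝓡 n) (extChartAt (𝓡 n) p).symm x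

theorem contMDiffOn_coordDeriv (p : M) (v : EuclideanSpace ℝ (Fin n)) :
    ContMDiffOn 𝓘(ℝ, EuclideanSpace ℝ (Fin n)) (𝓡 n).tangent ∞
      (fun x => (⟨(extChartAt (𝓡 n) p).symm x,
        coordDeriv p x v⟩ :
          TangentBundle (𝓡 n) M)) (extChartAt (𝓡 n) p).target := by
  have ho := isOpen_extChartAt_target (I := 𝓡 n) p
  have h := (contMDiffOn_extChartAt_symm (I := 𝓡 n) (n := ∞) p).contMDiffOn_tangentMapWithin
    (m := ∞) (by simp) ho.uniqueMDiffOn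
  have hc : ContMDiff 𝓘(ℝ, EuclideanSpace ℝ (Fin n)) 𝓘(ℝ, EuclideanSpace ℝ (Fin n)).tangent ∞
      (fun x => (⟨x, v⟩ : TangentBundle 𝓘(ℝ, EuclideanSpace ℝ (Fin n))
        (EuclideanSpace ℝ (Fin n)))) := by
    exact contMDiff_vectorSpace_iff_contDiff.2 contDiff_const
  refine (h.comp hc.contMDiffOn fun x hx => hx).congr fun x hx => ?_
  simp only [Function.comp_apply, tangentMapWithin]
  rw [mfderivWithin_of_isOpen ho hx]
  rfl

variable {E : M → Type*} [TopologicalSpace (TotalSpace F E)]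
  [∀ p, NormedAddCommGroup (E p)] [∀ p, InnerProductSpace ℝ (E p)]
  [FiberBundle F E] [VectorBundle ℝ F E]

variable (F) (E) in
/-- The set of coordinates at which both the chart and the trivialization at `p` are defined. -/
def localDomain (p : M) : Set (EuclideanSpace ℝ (Fin n)) :=
  (extChartAt (𝓡 n) p).target ∩ (extChartAt (𝓡 n) p).symm ⁻¹' (trivializationAt F E p).baseSet

theorem isOpen_localDomain (p : M) : IsOpen (localDomain (n := n) F E p) :=
  (continuousOn_extChartAt_symm p).isOpen_inter_preimage (isOpen_extChartAt_target p)
    (trivializationAt F E p).open_baseSet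

theorem mem_localDomain (p : M) : extChartAt (𝓡 n) p p ∈ localDomain (n := n) F E p :=
  ⟨mem_extChartAt_target p, by
    simp [FiberBundle.mem_baseSet_trivializationAt' p]⟩

/-- The matrix-valued function representing a bundle homomorphism in the chart and the
trivialization at `p`. -/
def localHom (p : M) (φ : ∀ q : M, TangentSpace (𝓡 n) q →L[ℝ] E q)
    (x : EuclideanSpace ℝ (Fin n)) : EuclideanSpace ℝ (Fin n) →L[ℝ] F :=
  (trivializationAt F E p).continuousLinearMapAt ℝ ((extChartAt (𝓡 n) p).symm x) ∘L
    φ ((extChartAt (𝓡 n) p).symm x) ∘L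
      coordDeriv p x

theorem localHom_apply (p : M) (φ : ∀ q : M, TangentSpace (𝓡 n) q →L[ℝ] E q)
    (x v : EuclideanSpace ℝ (Fin n)) : localHom (F := F) p φ x v
      = (trivializationAt F E p).continuousLinearMapAt ℝ ((extChartAt (𝓡 n) p).symm x)
        (φ ((extChartAt (𝓡 n) p).symm x) (coordDeriv p x v)) := rfl

variable (F) (E) in
/-- The fibre metric in the trivialization at `p`. -/
def localMetric (p : M) (x : EuclideanSpace ℝ (Fin n)) : F →L[ℝ] F →L[ℝ] ℝ :=
  (innerSL ℝ (E := E ((extChartAt (𝓡 n) p).symm x))).bilinearComp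
    ((trivializationAt F E p).symmL ℝ ((extChartAt (𝓡 n) p).symm x))
    ((trivializationAt F E p).symmL ℝ ((extChartAt (𝓡 n) p).symm x))

theorem localMetric_apply (p : M) (x : EuclideanSpace ℝ (Fin n)) (a b : F) :
    localMetric F E p x a b
      = inner ℝ ((trivializationAt F E p).symmL ℝ ((extChartAt (𝓡 n) p).symm x) a)
        ((trivializationAt F E p).symmL ℝ ((extChartAt (𝓡 n) p).symm x) b) := rfl

theorem localMetric_symm (p : M) (x : EuclideanSpace ℝ (Fin n)) (a b : F) :
    localMetric F E p x a b = localMetric F E p x b a :=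
  real_inner_comm _ _

theorem localMetric_pos {p : M} {x : EuclideanSpace ℝ (Fin n)} (hx : x ∈ localDomain F E p) {a : F}
    (ha : a ≠ 0) : 0 < localMetric F E p x a a := by
  rw [localMetric_apply]
  refine real_inner_self_pos.2 fun h => ha ?_
  rw [← (trivializationAt F E p).continuousLinearMapAt_symmL (R := ℝ) hx.2 a, h, map_zero]

theorem localMetric_localHom {p : M} {x : EuclideanSpace ℝ (Fin n)} (hx : x ∈ localDomain F E p)
    (φ ψ : ∀ q : M, TangentSpace (𝓡 n) q →L[ℝ] E q) (u v : EuclideanSpace ℝ (Fin n)) :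
    localMetric F E p x (localHom p φ x u) (localHom p ψ x v)
      = inner ℝ (φ ((extChartAt (𝓡 n) p).symm x)
          (coordDeriv p x u))
        (ψ ((extChartAt (𝓡 n) p).symm x)
          (coordDeriv p x v)) := by
  have h := (trivializationAt F E p).symmL_continuousLinearMapAt (R := ℝ) hx.2
  rw [localMetric_apply]
  simp only [localHom_apply, h]

variable [ContMDiffVectorBundle ∞ F E (𝓡 n)]

theorem contDiffOn_localHom [FiniteDimensional ℝ F] {φ : ∀ q : M, TangentSpace (𝓡 n) q →L[ℝ] E q}
    (hφ : IsSmoothHom F φ) (p : M) :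
    ContDiffOn ℝ ∞ (localHom (F := F) p φ) (localDomain F E p) := by
  refine contDiffOn_clm_apply.2 fun v => ?_
  have hκ : ContMDiffOn 𝓘(ℝ, EuclideanSpace ℝ (Fin n)) (𝓡 n) ∞ (extChartAt (𝓡 n) p).symm
      (localDomain F E p) := (contMDiffOn_extChartAt_symm p).mono Set.inter_subset_left
  have h := (hφ.comp_contMDiffOn hκ).clm_bundle_apply
    ((contMDiffOn_coordDeriv p v).mono
      (Set.inter_subset_left : localDomain F E p ⊆ _))
  have h2 := (((trivializationAt F E p).contMDiffOn_iff (IB := 𝓡 n) (n := ∞)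
    (f := fun x => TotalSpace.mk' F ((extChartAt (𝓡 n) p).symm x) (φ ((extChartAt (𝓡 n) p).symm x)
      (coordDeriv p x v)))
    (fun x (hx : x ∈ localDomain F E p) =>
    (trivializationAt F E p).mem_source.2 hx.2)).1 h).2.contDiffOn
  refine h2.congr fun x hx => ?_
  exact (trivializationAt F E p).continuousLinearMapAt_apply_of_mem ℝ hx.2 _

theorem contMDiffOn_symmL_const (p : M) (a : F) :
    ContMDiffOn (𝓡 n) ((𝓡 n).prod 𝓘(ℝ, F)) ∞
      (fun q => TotalSpace.mk' F q ((trivializationAt F E p).symmL ℝ q a))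
      (trivializationAt F E p).baseSet := by
  rw [Trivialization.contMDiffOn_section_baseSet_iff]
  refine (contMDiffOn_const (c := a)).congr fun q hq => ?_
  rw [Trivialization.symmL_apply _ hq, Trivialization.apply_mk_symm _ hq]

theorem contDiffOn_localMetric [FiniteDimensional ℝ F] [IsContMDiffRiemannianBundle (𝓡 n) ∞ F E]
    (p : M) : ContDiffOn ℝ ∞ (localMetric (n := n) F E p) (localDomain F E p) := by
  refine contDiffOn_clm_apply.2 fun a => contDiffOn_clm_apply.2 fun b => ?_
  have hκ : ContMDiffOn 𝓘(ℝ, EuclideanSpace ℝ (Fin n)) (𝓡 n) ∞ (extChartAt (𝓡 n) p).symm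
      (localDomain F E p) := (contMDiffOn_extChartAt_symm p).mono Set.inter_subset_left
  have hs := contMDiffOn_symmL_const (n := n) (F := F) (E := E) p
  exact (((hs a).inner_bundle (hs b)).comp hκ fun x hx => hx.2).contDiffOn

end LocalRepresentation

/-! ### The connection form of a covariant derivative -/

section ConnectionForm

variable {n : ℕ} {M : Type*} [TopologicalSpace M] [ChartedSpace (EuclideanSpace ℝ (Fin n)) M]
  [IsManifold (𝓡 n) ∞ M]
  {F : Type*} [NormedAddCommGroup F] [NormedSpace ℝ F]
  {E : M → Type*} [TopologicalSpace (TotalSpace F E)]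
  [∀ p, NormedAddCommGroup (E p)] [∀ p, InnerProductSpace ℝ (E p)]
  [FiberBundle F E] [VectorBundle ℝ F E]

theorem mdifferentiableAt_extChartAt_symm {p : M} {x : EuclideanSpace ℝ (Fin n)}
    (hx : x ∈ (extChartAt (𝓡 n) p).target) :
    MDifferentiableAt 𝓘(ℝ, EuclideanSpace ℝ (Fin n)) (𝓡 n) (extChartAt (𝓡 n) p).symm x :=
  (((contMDiffOn_extChartAt_symm (I := 𝓡 n) (n := ∞) p).contMDiffAt
    ((isOpen_extChartAt_target p).mem_nhds hx))).mdifferentiableAt (by simp)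

theorem hasFDerivAt_comp_extChartAt_symm {G : Type*} [NormedAddCommGroup G] [NormedSpace ℝ G]
    {g : M → G} {p : M} {x : EuclideanSpace ℝ (Fin n)} (hx : x ∈ (extChartAt (𝓡 n) p).target)
    (hg : MDifferentiableAt (𝓡 n) 𝓘(ℝ, G) g ((extChartAt (𝓡 n) p).symm x)) :
    HasFDerivAt (fun y => g ((extChartAt (𝓡 n) p).symm y))
      (mvfderiv (𝓡 n) g ((extChartAt (𝓡 n) p).symm x) ∘L
        coordDeriv p x) x :=
  (hg.hasMFDerivAt.comp x (mdifferentiableAt_extChartAt_symm hx).hasMFDerivAt).hasFDerivAt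

variable (F) in
/-- The vector-valued function representing a section in the chart and the trivialization
at `p`. -/
def localSection (p : M) (s : ∀ q : M, E q) (x : EuclideanSpace ℝ (Fin n)) : F :=
  (trivializationAt F E p).continuousLinearMapAt ℝ ((extChartAt (𝓡 n) p).symm x)
    (s ((extChartAt (𝓡 n) p).symm x))

variable [ContMDiffVectorBundle ∞ F E (𝓡 n)]

theorem differentiableAt_localSection {p : M} {x : EuclideanSpace ℝ (Fin n)}
    (hx : x ∈ localDomain F E p) {s : ∀ q : M, E q}
    (hs : MDifferentiableAt (𝓡 n) ((𝓡 n).prod 𝓘(ℝ, F)) (fun q => TotalSpace.mk' F q (s q))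
      ((extChartAt (𝓡 n) p).symm x)) :
    DifferentiableAt ℝ (localSection F p s) x := by
  have : ContMDiffVectorBundle 1 F E (𝓡 n) := ContMDiffVectorBundle.of_le (n := ∞) (by simp)
  rw [Trivialization.mdifferentiableAt_section_iff _ (trivializationAt F E p) s hx.2] at hs
  have h := (hasFDerivAt_comp_extChartAt_symm hx.1 hs).differentiableAt
  refine h.congr_of_eventuallyEq ?_
  filter_upwards [(isOpen_localDomain p).mem_nhds hx] with y hy
  exact (trivializationAt F E p).continuousLinearMapAt_apply_of_mem ℝ hy.2 _

theorem localSection_smul (p : M) (g : M → ℝ) (s : ∀ q : M, E q) (x : EuclideanSpace ℝ (Fin n)) :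
    localSection F p (g • s) x = g ((extChartAt (𝓡 n) p).symm x) • localSection F p s x :=
  map_smul _ _ _

theorem localSection_add (p : M) (s t : ∀ q : M, E q) (x : EuclideanSpace ℝ (Fin n)) :
    localSection F p (s + t) x = localSection F p s x + localSection F p t x :=
  map_add _ _ _

/-- Both terms satisfy the same Leibniz rule, so the derivative terms cancel and the difference
depends only on the value of the section at the point. -/
theorem tensorialAt_sub_fderiv (D : CovariantDerivative (𝓡 n) F E) {p : M}
    {x : EuclideanSpace ℝ (Fin n)} (hx : x ∈ localDomain F E p) (v : EuclideanSpace ℝ (Fin n)) :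
    TensorialAt (𝓡 n) F (fun s : ∀ q : M, E q =>
      localHom p (D s) x v - fderiv ℝ (localSection F p s) x v)
      ((extChartAt (𝓡 n) p).symm x) where
  smul {g s} hg hs := by
    have e : localSection F p (g • s)
        = fun y => g ((extChartAt (𝓡 n) p).symm y) • localSection F p s y :=
      funext (localSection_smul p g s)
    have hg' := hasFDerivAt_comp_extChartAt_symm hx.1 hg
    have h1 : D (g • s) ((extChartAt (𝓡 n) p).symm x) = _ :=
      D.isCovariantDerivativeOnUniv.leibniz hs hg
    have h2 : localHom p (D (g • s)) x v
        = g ((extChartAt (𝓡 n) p).symm x) • localHom p (D s) x v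
          + mvfderiv (𝓡 n) g ((extChartAt (𝓡 n) p).symm x)
            (coordDeriv p x v) •
              localSection F p s x := by
      rw [localHom_apply, h1]
      exact (map_add _ _ _).trans (congrArg₂ (· + ·) (map_smul _ _ _) (map_smul _ _ _))
    rw [e, (hg'.fun_smul (differentiableAt_localSection hx hs).hasFDerivAt).fderiv, h2, smul_sub]
    exact add_sub_add_right_eq_sub _ _ _
  add {s t} hs ht := by
    have e : localSection (n := n) F p (s + t) = fun y => localSection F p s y
      + localSection F p t y :=
      funext (localSection_add p s t)
    have h1 : D (s + t) ((extChartAt (𝓡 n) p).symm x) = _ :=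
      D.isCovariantDerivativeOnUniv.add hs ht
    have h2 : localHom (F := F) p (D (s + t)) x v
        = localHom p (D s) x v + localHom p (D t) x v := by
      rw [localHom_apply, h1]
      exact map_add _ _ _
    rw [e, fderiv_fun_add (differentiableAt_localSection hx hs)
      (differentiableAt_localSection hx ht), h2]
    exact add_sub_add_comm _ _ _ _

/-- `θ` is the connection form of `D` in the chart and the trivialization at `p`, over the open
set `V` of coordinates. -/
structure IsConnectionForm (D : CovariantDerivative (𝓡 n) F E) (p : M)
    (V : Set (EuclideanSpace ℝ (Fin n)))
    (θ : EuclideanSpace ℝ (Fin n) → EuclideanSpace ℝ (Fin n) →L[ℝ] F →L[ℝ] F) : Prop where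
  isOpen : IsOpen V
  mem : extChartAt (𝓡 n) p p ∈ V
  subset : V ⊆ localDomain F E p
  contDiffOn : ContDiffOn ℝ ∞ θ V
  localHom_eq : ∀ x ∈ V, ∀ s : ∀ q : M, E q,
    MDifferentiableAt (𝓡 n) ((𝓡 n).prod 𝓘(ℝ, F)) (fun q => TotalSpace.mk' F q (s q))
      ((extChartAt (𝓡 n) p).symm x) →
    ∀ v, localHom p (D s) x v = covD θ (localSection F p s) v x

theorem exists_isConnectionForm [T2Space M] [FiniteDimensional ℝ F]
    (D : CovariantDerivative (𝓡 n) F E)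
    (hD : CovariantDerivative.ContMDiffCovariantDerivative D ∞) (p : M) :
    ∃ V θ, IsConnectionForm D p V θ := by
  have : ContMDiffVectorBundle 1 F E (𝓡 n) := ContMDiffVectorBundle.of_le (n := ∞) (by simp)
  let b := Module.finBasis ℝ F
  -- The trivializing frame is cut off to global smooth sections, so that each `D (S i)` is a smooth
  -- homomorphism on all of `M`. The domain of the form shrinks to where they still equal the frame.
  choose S hS hSe using fun i => exists_contMDiff_section_eventuallyEq
    (trivializationAt F E p).open_baseSet (FiberBundle.mem_baseSet_trivializationAt' p)
    (contMDiffOn_symmL_const (n := n) p (b i))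
  obtain ⟨W, hW, hWo, hpW⟩ := eventually_nhds_iff.1 (Filter.eventually_all.2 hSe)
  have hDS : ∀ i, IsSmoothHom F (D (S i)) := fun i => by
    have := hD.contMDiff.contMDiff (σ := S i) (by simpa using! (hS i).contMDiffOn)
    simpa [contMDiffOn_univ] using! this
  refine ⟨localDomain F E p ∩ ((extChartAt (𝓡 n) p).target ∩ (extChartAt (𝓡 n) p).symm ⁻¹' W),
    fun x => ∑ i, ContinuousLinearMap.smulRightL ℝ F F (LinearMap.toContinuousLinearMap (b.coord i))
      ∘L localHom p (D (S i)) x, ?_, ?_, ?_, ?_, ?_⟩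
  · exact (isOpen_localDomain p).inter ((continuousOn_extChartAt_symm p).isOpen_inter_preimage
      (isOpen_extChartAt_target p) hWo)
  · exact ⟨mem_localDomain p, mem_extChartAt_target p, by simpa using hpW⟩
  · exact Set.inter_subset_left
  · exact ContDiffOn.sum fun i _ => contDiffOn_const.clm_comp
      ((contDiffOn_localHom (hDS i) p).mono Set.inter_subset_left)
  · rintro x ⟨hx, -, hxW⟩ s hs v
    have hT := tensorialAt_sub_fderiv D hx v
    have hSx : ∀ i, S i ((extChartAt (𝓡 n) p).symm x)
        = (trivializationAt F E p).symmL ℝ ((extChartAt (𝓡 n) p).symm x) (b i) := hW _ hxW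
    have hconst : ∀ i, fderiv ℝ (localSection (n := n) F p (S i)) x = 0 := fun i => by
      have : localSection (n := n) F p (S i) =ᶠ[𝓝 x] fun _ => b i := by
        filter_upwards [(isOpen_localDomain p).mem_nhds hx,
          ((continuousOn_extChartAt_symm p).isOpen_inter_preimage
            (isOpen_extChartAt_target p) hWo).mem_nhds ⟨hx.1, hxW⟩] with y hy hyW
        rw [localSection, hW _ hyW.2 i, Trivialization.continuousLinearMapAt_symmL _ hy.2]
      rw [this.fderiv_eq, fderiv_const_apply]
    -- By tensoriality it suffices to expand the value of `s` in the frame, whose local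
    -- representatives are constant near `x`.
    have key : localHom p (D s) x v - fderiv ℝ (localSection F p s) x v
        = ∑ i, b.coord i (localSection F p s x) • localHom p (D (S i)) x v := by
      have h1 := hT.mkHom_apply hs
      have h2 : s ((extChartAt (𝓡 n) p).symm x)
          = ∑ i, b.coord i (localSection F p s x) • S i ((extChartAt (𝓡 n) p).symm x) := by
        simp only [hSx, ← map_smul, ← map_sum, Module.Basis.coord_apply, b.sum_repr]
        exact (Trivialization.symmL_continuousLinearMapAt _ hx.2 _).symm
      rw [← h1, h2, map_sum]
      refine Finset.sum_congr rfl fun i _ => ?_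
      rw [map_smul, hT.mkHom_apply ((hS i).mdifferentiableAt (by simp)), hconst]
      simp
    rw [covD, ← sub_eq_iff_eq_add', key]
    simp [sum_apply]

end ConnectionForm

/-! ### Coherence and metricity in coordinates -/

section LocalEquations

variable {n : ℕ} {M : Type*} [TopologicalSpace M] [ChartedSpace (EuclideanSpace ℝ (Fin n)) M]
  [IsManifold (𝓡 n) ∞ M]

theorem isInvertible_coordDeriv {p : M} {x : EuclideanSpace ℝ (Fin n)}
    (hx : x ∈ (extChartAt (𝓡 n) p).target) : (coordDeriv p x).IsInvertible := by
  have h := isInvertible_mfderivWithin_extChartAt_symm (I := 𝓡 n) hx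
  rwa [ModelWithCorners.range_eq_univ, mfderivWithin_univ] at h

/-- The coordinate representation of a vector field in the chart at `p`. -/
def localField (p : M) (X : ∀ q : M, TangentSpace (𝓡 n) q) (x : EuclideanSpace ℝ (Fin n)) :
    EuclideanSpace ℝ (Fin n) :=
  (coordDeriv p x).inverse (X ((extChartAt (𝓡 n) p).symm x))

theorem coordDeriv_localField {p : M} {x : EuclideanSpace ℝ (Fin n)}
    (hx : x ∈ (extChartAt (𝓡 n) p).target) (X : ∀ q : M, TangentSpace (𝓡 n) q) :
    coordDeriv p x (localField p X x) = X ((extChartAt (𝓡 n) p).symm x) := by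
  obtain ⟨L, hL⟩ := isInvertible_coordDeriv hx
  rw [localField, ← hL, ContinuousLinearMap.inverse_equiv]
  exact L.apply_symm_apply _

theorem contDiffAt_localField {p : M} {x : EuclideanSpace ℝ (Fin n)}
    (hx : x ∈ (extChartAt (𝓡 n) p).target) {X : ∀ q : M, TangentSpace (𝓡 n) q}
    (hX : IsSmoothVectorField X) : ContDiffAt ℝ 1 (localField p X) x := by
  have hκ : ContMDiffAt 𝓘(ℝ, EuclideanSpace ℝ (Fin n)) (𝓡 n) 2 (extChartAt (𝓡 n) p).symm x :=
    (contMDiffOn_extChartAt_symm p).contMDiffAt ((isOpen_extChartAt_target p).mem_nhds hx)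
  exact contMDiffAt_vectorSpace_iff_contDiffAt.1
    (ContMDiffAt.mpullback_vectorField_preimage (m := 1)
      ((hX ((extChartAt (𝓡 n) p).symm x)).of_le (by simp)) hκ (isInvertible_coordDeriv hx)
      (by norm_num))

theorem coordDeriv_lieBracket {p : M} {x : EuclideanSpace ℝ (Fin n)}
    (hx : x ∈ (extChartAt (𝓡 n) p).target) {X Y : ∀ q : M, TangentSpace (𝓡 n) q}
    (hX : IsSmoothVectorField X) (hY : IsSmoothVectorField Y) :
    coordDeriv p x (fderiv ℝ (localField p Y) x (localField p X x)
        - fderiv ℝ (localField p X) x (localField p Y x))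
      = VectorField.mlieBracket (𝓡 n) X Y ((extChartAt (𝓡 n) p).symm x) := by
  have hκ : ContMDiffAt 𝓘(ℝ, EuclideanSpace ℝ (Fin n)) (𝓡 n) 2 (extChartAt (𝓡 n) p).symm x :=
    (contMDiffOn_extChartAt_symm p).contMDiffAt ((isOpen_extChartAt_target p).mem_nhds hx)
  have : IsManifold (𝓡 n) (minSmoothness ℝ 2) M := by
    rw [minSmoothness_of_isRCLikeNormedField]; infer_instance
  have h := VectorField.mpullback_mlieBracket
    ((hX ((extChartAt (𝓡 n) p).symm x)).mdifferentiableAt (by simp))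
    ((hY ((extChartAt (𝓡 n) p).symm x)).mdifferentiableAt (by simp)) hκ (by simp)
  rw [← VectorField.mlieBracketWithin_univ (I := 𝓡 n) (M := EuclideanSpace ℝ (Fin n)),
    VectorField.mlieBracketWithin_eq_lieBracketWithin] at h
  replace h : localField p (VectorField.mlieBracket (𝓡 n) X Y) x
      = VectorField.lieBracketWithin ℝ (localField p X) (localField p Y) Set.univ x := h
  rw [VectorField.lieBracketWithin_univ] at h
  rw [← coordDeriv_localField hx (VectorField.mlieBracket (𝓡 n) X Y)]
  exact congrArg _ h.symm

theorem exists_isSmoothVectorField [T2Space M] {p : M} (v : TangentSpace (𝓡 n) p) :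
    ∃ X : ∀ q : M, TangentSpace (𝓡 n) q, IsSmoothVectorField X ∧ X p = v := by
  obtain ⟨s, hs, hsm⟩ := FiberBundle.exists_contMDiffOn_extend (k := ∞) (𝓡 n)
    (EuclideanSpace ℝ (Fin n)) v
  obtain ⟨X, hX, hXe⟩ := exists_contMDiff_section_eventuallyEq isOpen_interior
    (mem_interior_iff_mem_nhds.2 hs) (hsm.mono interior_subset)
  exact ⟨X, hX, by rw [hXe.self_of_nhds, FiberBundle.extend_apply_self]⟩

variable {F : Type*} [NormedAddCommGroup F] [NormedSpace ℝ F]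
  {E : M → Type*} [TopologicalSpace (TotalSpace F E)]
  [∀ p, NormedAddCommGroup (E p)] [∀ p, InnerProductSpace ℝ (E p)]
  [FiberBundle F E] [VectorBundle ℝ F E]

theorem localSection_hom {p : M} {x : EuclideanSpace ℝ (Fin n)}
    (hx : x ∈ (extChartAt (𝓡 n) p).target) (φ : ∀ q : M, TangentSpace (𝓡 n) q →L[ℝ] E q)
    (X : ∀ q : M, TangentSpace (𝓡 n) q) :
    localSection F p (fun q => φ q (X q)) x = localHom p φ x (localField p X x) := by
  rw [localHom_apply, coordDeriv_localField hx, localSection]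

theorem continuousLinearMapAt_injective {p q : M} (hq : q ∈ (trivializationAt F E p).baseSet) :
    Function.Injective ((trivializationAt F E p).continuousLinearMapAt ℝ q) :=
  Function.LeftInverse.injective (g := (trivializationAt F E p).symmL ℝ q)
    (Trivialization.symmL_continuousLinearMapAt _ hq)

variable [ContMDiffVectorBundle ∞ F E (𝓡 n)] {D : CovariantDerivative (𝓡 n) F E} {p : M}
  {V : Set (EuclideanSpace ℝ (Fin n))}
  {θ : EuclideanSpace ℝ (Fin n) → EuclideanSpace ℝ (Fin n) →L[ℝ] F →L[ℝ] F}
  {φ ψ : ∀ q : M, TangentSpace (𝓡 n) q →L[ℝ] E q} {x : EuclideanSpace ℝ (Fin n)}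

theorem IsSmoothHom.contMDiff_apply (hφ : IsSmoothHom F φ) {X : ∀ q : M, TangentSpace (𝓡 n) q}
    (hX : IsSmoothVectorField X) :
    ContMDiff (𝓡 n) ((𝓡 n).prod 𝓘(ℝ, F)) ∞ (fun q => TotalSpace.mk' F q (φ q (X q))) :=
  ContMDiff.clm_bundle_apply hφ hX

theorem IsSmoothHom.contDiffAt_localHom [FiniteDimensional ℝ F] (hφ : IsSmoothHom F φ)
    (hx : x ∈ localDomain F E p) : ContDiffAt ℝ ∞ (localHom (F := F) p φ) x :=
  (contDiffOn_localHom hφ p).contDiffAt ((isOpen_localDomain p).mem_nhds hx)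

theorem IsConnectionForm.covD_localSection_hom [FiniteDimensional ℝ F] (hφ : IsSmoothHom F φ)
    (hx : x ∈ localDomain F E p) {X : ∀ q : M, TangentSpace (𝓡 n) q}
    (hX : IsSmoothVectorField X) (v : EuclideanSpace ℝ (Fin n)) :
    covD θ (localSection F p (fun q => φ q (X q))) v x
      = fderiv ℝ (localHom (F := F) p φ) x v (localField p X x)
        + localHom p φ x (fderiv ℝ (localField p X) x v)
        + θ x v (localHom p φ x (localField p X x)) := by
  have e : localSection F p (fun q => φ q (X q))
      =ᶠ[𝓝 x] fun y => localHom p φ y (localField p X y) := by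
    filter_upwards [(isOpen_extChartAt_target p).mem_nhds hx.1] with y hy
    exact localSection_hom hy φ X
  have h1 := (hφ.contDiffAt_localHom hx).differentiableAt (by simp)
  have h2 := (contDiffAt_localField hx.1 hX).differentiableAt (by simp)
  rw [covD, e.fderiv_eq, e.eq_of_nhds, (h1.hasFDerivAt.clm_apply h2.hasFDerivAt).fderiv]
  simp [add_comm]

/-- The expression vanishing on a coherent tangent bundle, in coordinates. -/
theorem IsConnectionForm.coherence_eq [FiniteDimensional ℝ F] (hθ : IsConnectionForm D p V θ)
    (hφ : IsSmoothHom F φ) (hx : x ∈ V) {X Y : ∀ q : M, TangentSpace (𝓡 n) q}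
    (hX : IsSmoothVectorField X) (hY : IsSmoothVectorField Y) :
    (trivializationAt F E p).continuousLinearMapAt ℝ ((extChartAt (𝓡 n) p).symm x)
        (D (fun q => φ q (Y q)) ((extChartAt (𝓡 n) p).symm x) (X ((extChartAt (𝓡 n) p).symm x))
        - D (fun q => φ q (X q)) ((extChartAt (𝓡 n) p).symm x) (Y ((extChartAt (𝓡 n) p).symm x))
        - φ ((extChartAt (𝓡 n) p).symm x)
          (VectorField.mlieBracket (𝓡 n) X Y ((extChartAt (𝓡 n) p).symm x)))
      = fderiv ℝ (localHom (F := F) p φ) x (localField p X x) (localField p Y x)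
          + θ x (localField p X x) (localHom p φ x (localField p Y x))
        - (fderiv ℝ (localHom (F := F) p φ) x (localField p Y x) (localField p X x)
          + θ x (localField p Y x) (localHom p φ x (localField p X x))) := by
  have hxd := hθ.subset hx
  have h1 := hθ.localHom_eq x hx _
    ((hφ.contMDiff_apply hY _).mdifferentiableAt (by simp)) (localField p X x)
  have h2 := hθ.localHom_eq x hx _
    ((hφ.contMDiff_apply hX _).mdifferentiableAt (by simp)) (localField p Y x)
  rw [IsConnectionForm.covD_localSection_hom hφ hxd hY, localHom_apply,
    coordDeriv_localField hxd.1] at h1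
  rw [IsConnectionForm.covD_localSection_hom hφ hxd hX, localHom_apply,
    coordDeriv_localField hxd.1] at h2
  rw [map_sub, map_sub, h1, h2, ← coordDeriv_lieBracket hxd.1 hX hY, ← localHom_apply, map_sub]
  abel

/-- Coherence is assumed for global fields only; cut-off extensions realize any two tangent vectors,
and the coordinate expression depends only on their values at the point. -/
theorem IsConnectionForm.coherentAt [T2Space M] [FiniteDimensional ℝ F]
    [IsContMDiffRiemannianBundle (𝓡 n) ∞ F E]
    (hθ : IsConnectionForm D p V θ) (h : IsCoherentTangentBundle D φ) (hx : x ∈ V) :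
    CoherentAt θ (localHom p φ) x := fun u v => by
  obtain ⟨X, hX, hXu⟩ := exists_isSmoothVectorField (coordDeriv p x u)
  obtain ⟨Y, hY, hYv⟩ := exists_isSmoothVectorField (coordDeriv p x v)
  obtain ⟨L, hL⟩ := isInvertible_coordDeriv (hθ.subset hx).1
  have e := hθ.coherence_eq h.smooth_hom hx hX hY
  have hu : localField p X x = u := by
    rw [localField, hXu, ← hL, ContinuousLinearMap.inverse_equiv]
    exact L.symm_apply_apply _
  have hv : localField p Y x = v := by
    rw [localField, hYv, ← hL, ContinuousLinearMap.inverse_equiv]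
    exact L.symm_apply_apply _
  rw [h.coherent X Y hX hY, map_zero, hu, hv] at e
  exact sub_eq_zero.1 e.symm

theorem IsConnectionForm.coherent_apply [FiniteDimensional ℝ F] (hθ : IsConnectionForm D p V θ)
    (hφ : IsSmoothHom F φ) (hc : CoherentAt θ (localHom p φ) (extChartAt (𝓡 n) p p))
    {X Y : ∀ q : M, TangentSpace (𝓡 n) q} (hX : IsSmoothVectorField X)
    (hY : IsSmoothVectorField Y) :
    D (fun q => φ q (Y q)) p (X p) - D (fun q => φ q (X q)) p (Y p)
      - φ p (VectorField.mlieBracket (𝓡 n) X Y p) = 0 := by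
  have e := hθ.coherence_eq hφ hθ.mem hX hY
  rw [sub_eq_zero.2 (hc _ _)] at e
  have := continuousLinearMapAt_injective (hθ.subset hθ.mem).2 (e.trans (map_zero _).symm)
  rwa [extChartAt_to_inv] at this

theorem IsConnectionForm.metricAt [FiniteDimensional ℝ F]
    [IsContMDiffRiemannianBundle (𝓡 n) ∞ F E] (hθ : IsConnectionForm D p V θ)
    (hm : D.IsMetricCompatible) (hx : x ∈ V) : MetricAt (localMetric F E p) θ x := fun v a b => by
  have hxd := hθ.subset hx
  have hs : ∀ a : F, MDifferentiableAt (𝓡 n) ((𝓡 n).prod 𝓘(ℝ, F))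
      (fun q => TotalSpace.mk' F q ((trivializationAt F E p).symmL ℝ q a))
      ((extChartAt (𝓡 n) p).symm x) := fun a =>
    (((contMDiffOn_symmL_const p a).contMDiffAt
      ((trivializationAt F E p).open_baseSet.mem_nhds hxd.2))).mdifferentiableAt (by simp)
  have hD : ∀ a : F, localHom p (D fun q => (trivializationAt F E p).symmL ℝ q a) x v
      = θ x v a := fun a => by
    have e : localSection F p (fun q => (trivializationAt F E p).symmL ℝ q a)
        =ᶠ[𝓝 x] fun _ => a := by
      filter_upwards [(isOpen_localDomain p).mem_nhds hxd] with y hy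
      exact Trivialization.continuousLinearMapAt_symmL _ hy.2 _
    rw [hθ.localHom_eq x hx _ (hs a), covD, e.fderiv_eq, e.eq_of_nhds]
    simp
  have hH := ((contDiffOn_localMetric (n := n) (F := F) (E := E) p).contDiffAt
    ((isOpen_localDomain p).mem_nhds hxd)).differentiableAt (by simp)
  -- Metric compatibility is phrased with a vector field, hence the extension of the tangent vector.
  have h := hm.mvfderiv_inner_eq
    (FiberBundle.extend (EuclideanSpace ℝ (Fin n)) (coordDeriv p x v)) (hs a) (hs b)
  have hi := (hasFDerivAt_comp_extChartAt_symm hxd.1 ((hs a).inner_bundle (hs b))).fderiv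
  rw [FiberBundle.extend_apply_self] at h
  rw [← fderiv_apply_const hH, ← fderiv_apply_const (hH.clm_apply (differentiableAt_const a))]
  have e : (fun y => localMetric F E p y a b) = fun y =>
      inner ℝ ((trivializationAt F E p).symmL ℝ ((extChartAt (𝓡 n) p).symm y) a)
        ((trivializationAt F E p).symmL ℝ ((extChartAt (𝓡 n) p).symm y) b) := rfl
  rw [e, hi]
  refine h.trans ?_
  have hL : ∀ a : F, D (fun q => (trivializationAt F E p).symmL ℝ q a)
      ((extChartAt (𝓡 n) p).symm x) (coordDeriv p x v)
      = (trivializationAt F E p).symmL ℝ ((extChartAt (𝓡 n) p).symm x) (θ x v a) := fun a => by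
    rw [← hD a, localHom_apply, Trivialization.symmL_continuousLinearMapAt _ hxd.2]
  simp only [FiberBundle.extend_apply_self, hL, localMetric_apply]

end LocalEquations

/-! ### Changing from a point's own chart to a fixed chart -/

section ChartTransition

variable {n : ℕ} {M : Type*} [TopologicalSpace M] [ChartedSpace (EuclideanSpace ℝ (Fin n)) M]

/-- The transition map from the coordinates of the chart at `q` to those of the chart at `p`. -/
def chartTransition (p q : M) (y : EuclideanSpace ℝ (Fin n)) : EuclideanSpace ℝ (Fin n) :=
  extChartAt (𝓡 n) p ((extChartAt (𝓡 n) q).symm y)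

variable [IsManifold (𝓡 n) ∞ M] {p q : M} {x y : EuclideanSpace ℝ (Fin n)}

theorem contDiffAt_chartTransition (hy : y ∈ (extChartAt (𝓡 n) q).target)
    (hp : (extChartAt (𝓡 n) q).symm y ∈ (extChartAt (𝓡 n) p).source) :
    ContDiffAt ℝ ∞ (chartTransition p q) y := by
  rw [extChartAt_source] at hp
  exact (ContMDiffAt.comp y (contMDiffAt_extChartAt' hp)
    ((contMDiffOn_extChartAt_symm q).contMDiffAt
      ((isOpen_extChartAt_target q).mem_nhds hy))).contDiffAt

theorem chartTransition_self (hx : x ∈ (extChartAt (𝓡 n) p).target) :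
    chartTransition p ((extChartAt (𝓡 n) p).symm x)
      (extChartAt (𝓡 n) ((extChartAt (𝓡 n) p).symm x) ((extChartAt (𝓡 n) p).symm x)) = x := by
  rw [chartTransition, extChartAt_to_inv, (extChartAt (𝓡 n) p).right_inv hx]

theorem contDiffAt_chartTransition_self (hx : x ∈ (extChartAt (𝓡 n) p).target) :
    ContDiffAt ℝ ∞ (chartTransition p ((extChartAt (𝓡 n) p).symm x))
      (extChartAt (𝓡 n) ((extChartAt (𝓡 n) p).symm x) ((extChartAt (𝓡 n) p).symm x)) :=
  contDiffAt_chartTransition (mem_extChartAt_target _) (by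
    rw [extChartAt_to_inv]
    exact (extChartAt (𝓡 n) p).map_target hx)

/-- Chain rule for a composite that is locally the identity. It identifies `coordDeriv p x` after
the transition derivative with the inverse differential of the chart at the point itself, which is
`ofComponents`. -/
theorem mfderiv_extChartAt_comp_coordDeriv (hx : x ∈ (extChartAt (𝓡 n) p).target) :
    mfderiv (𝓡 n) 𝓘(ℝ, EuclideanSpace ℝ (Fin n)) (extChartAt (𝓡 n) ((extChartAt (𝓡 n) p).symm x))
        ((extChartAt (𝓡 n) p).symm x) ∘L
      (coordDeriv p x ∘L fderiv ℝ (chartTransition p ((extChartAt (𝓡 n) p).symm x))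
        (extChartAt (𝓡 n) ((extChartAt (𝓡 n) p).symm x) ((extChartAt (𝓡 n) p).symm x)))
      = ContinuousLinearMap.id ℝ (EuclideanSpace ℝ (Fin n)) := by
  set q := (extChartAt (𝓡 n) p).symm x with hq
  have hf := (contDiffAt_chartTransition_self hx).differentiableAt (by simp)
  have he : MDifferentiableAt (𝓡 n) 𝓘(ℝ, EuclideanSpace ℝ (Fin n)) (extChartAt (𝓡 n) q) q :=
    mdifferentiableAt_extChartAt (mem_chart_source _ q)
  have h1 := hasFDerivAt_comp_extChartAt_symm hx he
  have h2 : HasFDerivAt (fun y => extChartAt (𝓡 n) q ((extChartAt (𝓡 n) p).symm y))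
    (mvfderiv (𝓡 n) (extChartAt (𝓡 n) q) q ∘L coordDeriv p x)
    (chartTransition p q (extChartAt (𝓡 n) q q)) := by rw [chartTransition_self hx]; exact h1
  have h3 := h2.comp (extChartAt (𝓡 n) q q) hf.hasFDerivAt
  have h4 : HasFDerivAt (fun y => y) (ContinuousLinearMap.id ℝ (EuclideanSpace ℝ (Fin n)))
    (extChartAt (𝓡 n) q q) := hasFDerivAt_id _
  refine (h3.unique (h4.congr_of_eventuallyEq ?_) :)
  have hs : (extChartAt (𝓡 n) p).source ∈ 𝓝 ((extChartAt (𝓡 n) q).symm (extChartAt (𝓡 n) q q)) := by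
    rw [extChartAt_to_inv]
    exact (isOpen_extChartAt_source p).mem_nhds ((extChartAt (𝓡 n) p).map_target hx)
  filter_upwards [(isOpen_extChartAt_target q).mem_nhds (mem_extChartAt_target q),
    (continuousAt_extChartAt_symm q).preimage_mem_nhds hs] with y hy hyp
  simp only [Function.comp_apply, chartTransition]
  rw [(extChartAt (𝓡 n) p).left_inv hyp, (extChartAt (𝓡 n) q).right_inv hy]

theorem coordDeriv_fderiv_chartTransition (hx : x ∈ (extChartAt (𝓡 n) p).target)
    (c : Fin n → ℝ) :
    coordDeriv p x (fderiv ℝ (chartTransition p ((extChartAt (𝓡 n) p).symm x))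
        (extChartAt (𝓡 n) ((extChartAt (𝓡 n) p).symm x) ((extChartAt (𝓡 n) p).symm x))
        (WithLp.toLp 2 c))
      = ofComponents ((extChartAt (𝓡 n) p).symm x) c := by
  obtain ⟨L, hL⟩ := isInvertible_mfderiv_extChartAt (I := 𝓡 n)
    (mem_extChartAt_source (I := 𝓡 n) ((extChartAt (𝓡 n) p).symm x))
  have h := mfderiv_extChartAt_comp_coordDeriv hx
  rw [← hL] at h
  have h2 := congrArg (fun T => T (WithLp.toLp 2 c)) h
  rw [ofComponents, ← hL, ContinuousLinearMap.inverse_equiv]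
  exact L.injective (h2.trans (L.apply_symm_apply _).symm)

theorem components_ofComponents (p : M) (c : Fin n → ℝ) : components p (ofComponents p c) = c := by
  obtain ⟨L, hL⟩ := isInvertible_mfderiv_extChartAt (I := 𝓡 n)
    (mem_extChartAt_source (I := 𝓡 n) p)
  rw [ofComponents, components, ← hL, ContinuousLinearMap.inverse_equiv]
  have := L.apply_symm_apply ((EuclideanSpace.equiv (Fin n) ℝ).symm c)
  exact (congrArg (EuclideanSpace.equiv (Fin n) ℝ) this).trans
    ((EuclideanSpace.equiv (Fin n) ℝ).apply_symm_apply c)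

theorem ofComponents_components (p : M) (v : TangentSpace (𝓡 n) p) :
    ofComponents p (components p v) = v := by
  obtain ⟨L, hL⟩ := isInvertible_mfderiv_extChartAt (I := 𝓡 n)
    (mem_extChartAt_source (I := 𝓡 n) p)
  rw [ofComponents, components, ← hL, ContinuousLinearMap.inverse_equiv]
  exact L.symm_apply_apply v

theorem bijective_fderiv_chartTransition (hx : x ∈ (extChartAt (𝓡 n) p).target) :
    Function.Bijective (fderiv ℝ (chartTransition p ((extChartAt (𝓡 n) p).symm x))
      (extChartAt (𝓡 n) ((extChartAt (𝓡 n) p).symm x) ((extChartAt (𝓡 n) p).symm x))) := by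
  have hinj : Function.Injective
      (fderiv ℝ (chartTransition p ((extChartAt (𝓡 n) p).symm x))
      (extChartAt (𝓡 n) ((extChartAt (𝓡 n) p).symm x) ((extChartAt (𝓡 n) p).symm x))) := by
    intro u v huv
    have h := fun u => congrArg (fun T => T u) (mfderiv_extChartAt_comp_coordDeriv hx)
    refine (h u).symm.trans (Eq.trans ?_ (h v))
    simp only [ContinuousLinearMap.comp_apply, huv]
  exact ⟨hinj, LinearMap.injective_iff_surjective.1 hinj⟩

/-- The two derivatives land in tangent spaces at base points that are only provably equal. Packing
base point and map into a sigma type lets `coeffs_eq` transport any dependent tensor field by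
congruence. -/
theorem sigma_coordDeriv_eq (hy : y ∈ (extChartAt (𝓡 n) q).target)
    (hp : (extChartAt (𝓡 n) q).symm y ∈ (extChartAt (𝓡 n) p).source) :
    (⟨(extChartAt (𝓡 n) q).symm y, coordDeriv q y⟩ :
        Σ m : M, EuclideanSpace ℝ (Fin n) →L[ℝ] TangentSpace (𝓡 n) m)
      = ⟨(extChartAt (𝓡 n) p).symm (chartTransition p q y),
        coordDeriv p (chartTransition p q y) ∘L fderiv ℝ (chartTransition p q) y⟩ := by
  have hf := (contDiffAt_chartTransition hy hp).differentiableAt (by simp)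
  have ht : chartTransition p q y ∈ (extChartAt (𝓡 n) p).target :=
    (extChartAt (𝓡 n) p).map_source hp
  have h1 : HasMFDerivAt 𝓘(ℝ, EuclideanSpace ℝ (Fin n)) (𝓡 n)
      (fun z => (extChartAt (𝓡 n) p).symm (chartTransition p q z)) y
      (coordDeriv p (chartTransition p q y) ∘L fderiv ℝ (chartTransition p q) y) :=
    (mdifferentiableAt_extChartAt_symm ht).hasMFDerivAt.comp y hf.hasFDerivAt.hasMFDerivAt
  have h2 : (extChartAt (𝓡 n) q).symm
      =ᶠ[𝓝 y] fun z => (extChartAt (𝓡 n) p).symm (chartTransition p q z) := by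
    filter_upwards [(continuousAt_extChartAt_symm'' hy).preimage_mem_nhds
      ((isOpen_extChartAt_source p).mem_nhds hp)] with z hz
    exact ((extChartAt (𝓡 n) p).left_inv hz).symm
  exact Sigma.ext h2.eq_of_nhds (heq_of_eq (h1.congr_of_eventuallyEq h2).mfderiv)

end ChartTransition

/-! ### The pull-back metric and its Schouten tensor in a fixed chart -/

section PullbackMetric

variable {n : ℕ} {M : Type*} [TopologicalSpace M] [ChartedSpace (EuclideanSpace ℝ (Fin n)) M]
  [IsManifold (𝓡 n) ∞ M] {p : M} {x : EuclideanSpace ℝ (Fin n)}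

theorem toBilin'_of_apply_single
    (b : EuclideanSpace ℝ (Fin n) →L[ℝ] EuclideanSpace ℝ (Fin n) →L[ℝ] ℝ) (c d : Fin n → ℝ) :
    (Matrix.of fun i j => b (EuclideanSpace.single i 1) (EuclideanSpace.single j 1)).toBilin' c d
      = b (WithLp.toLp 2 c) (WithLp.toLp 2 d) := by
  rw [clm_eq_sum b (WithLp.toLp 2 c), sum_apply, Matrix.toBilin'_apply]
  refine Finset.sum_congr rfl fun i _ => ?_
  rw [smul_apply, clm_eq_sum (b (EuclideanSpace.single i 1)) (WithLp.toLp 2 d), Finset.smul_sum]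
  refine Finset.sum_congr rfl fun j _ => ?_
  simp only [Matrix.of_apply, smul_eq_mul]
  ring

/-- The point with coordinates `x` in the chart at `p`, and its coordinates in its own chart. -/
def selfCoord (p : M) (x : EuclideanSpace ℝ (Fin n)) : EuclideanSpace ℝ (Fin n) :=
  extChartAt (𝓡 n) ((extChartAt (𝓡 n) p).symm x) ((extChartAt (𝓡 n) p).symm x)

theorem coeffs_eq {q : M} {y : EuclideanSpace ℝ (Fin n)}
    (g : ∀ q : M, LinearMap.BilinForm ℝ (TangentSpace (𝓡 n) q))
    (hy : y ∈ (extChartAt (𝓡 n) q).target)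
    (hp : (extChartAt (𝓡 n) q).symm y ∈ (extChartAt (𝓡 n) p).source) (i j : Fin n) :
    coeffs g q y i j = g ((extChartAt (𝓡 n) p).symm (chartTransition p q y))
      (coordDeriv p (chartTransition p q y)
        (fderiv ℝ (chartTransition p q) y (EuclideanSpace.single i 1)))
      (coordDeriv p (chartTransition p q y)
        (fderiv ℝ (chartTransition p q) y (EuclideanSpace.single j 1))) :=
  congrArg (fun s : Σ m : M, EuclideanSpace ℝ (Fin n) →L[ℝ] TangentSpace (𝓡 n) m =>
    g s.1 (s.2 (EuclideanSpace.single i 1)) (s.2 (EuclideanSpace.single j 1)))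
    (sigma_coordDeriv_eq hy hp)

variable {F : Type*} [NormedAddCommGroup F] [NormedSpace ℝ F]
  {E : M → Type*} [TopologicalSpace (TotalSpace F E)]
  [∀ p, NormedAddCommGroup (E p)] [∀ p, InnerProductSpace ℝ (E p)]
  [FiberBundle F E] [VectorBundle ℝ F E]
  {φ ψ : ∀ q : M, TangentSpace (𝓡 n) q →L[ℝ] E q}

theorem eventually_chartTransition_mem (hx : x ∈ localDomain F E p) :
    ∀ᶠ y in 𝓝 (selfCoord p x), y ∈ (extChartAt (𝓡 n) ((extChartAt (𝓡 n) p).symm x)).target ∧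
      (extChartAt (𝓡 n) ((extChartAt (𝓡 n) p).symm x)).symm y ∈ (extChartAt (𝓡 n) p).source ∧
      chartTransition p ((extChartAt (𝓡 n) p).symm x) y ∈ localDomain F E p := by
  set q := (extChartAt (𝓡 n) p).symm x
  have hs : (extChartAt (𝓡 n) p).source ∈ 𝓝 ((extChartAt (𝓡 n) q).symm (extChartAt (𝓡 n) q q)) := by
    rw [extChartAt_to_inv]
    exact (isOpen_extChartAt_source p).mem_nhds ((extChartAt (𝓡 n) p).map_target hx.1)
  have hd : localDomain F E p ∈ 𝓝 (chartTransition p q (selfCoord p x)) := by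
    rw [selfCoord, chartTransition_self hx.1]
    exact (isOpen_localDomain p).mem_nhds hx
  exact ((isOpen_extChartAt_target q).eventually_mem (mem_extChartAt_target q)).and
    (((continuousAt_extChartAt_symm q).eventually hs).and
      ((contDiffAt_chartTransition_self hx.1).continuousAt.eventually hd))

theorem coeffs_pullbackMetric_eventuallyEq (hx : x ∈ localDomain F E p)
    (φ : ∀ q : M, TangentSpace (𝓡 n) q →L[ℝ] E q) :
    coeffs (pullbackMetric φ) ((extChartAt (𝓡 n) p).symm x) =ᶠ[𝓝 (selfCoord p x)]
      gram (fun y => localMetric F E p (chartTransition p ((extChartAt (𝓡 n) p).symm x) y))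
        (pullForm (chartTransition p ((extChartAt (𝓡 n) p).symm x)) (localHom p φ)) := by
  filter_upwards [eventually_chartTransition_mem hx] with y hy
  ext i j
  rw [coeffs_eq _ hy.1 hy.2.1]
  exact (localMetric_localHom hy.2.2 φ φ _ _).symm

theorem coeffs_conformal_eventuallyEq (hx : x ∈ localDomain F E p)
    (φ : ∀ q : M, TangentSpace (𝓡 n) q →L[ℝ] E q) {σ : M → ℝ} {τ : EuclideanSpace ℝ (Fin n) → ℝ}
    (hτ : ∀ z ∈ localDomain F E p, σ ((extChartAt (𝓡 n) p).symm z) = τ z) :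
    coeffs (fun m => Real.exp (2 * σ m) • pullbackMetric φ m) ((extChartAt (𝓡 n) p).symm x)
      =ᶠ[𝓝 (selfCoord p x)]
      gram (fun y => localMetric F E p (chartTransition p ((extChartAt (𝓡 n) p).symm x) y))
        (pullForm (chartTransition p ((extChartAt (𝓡 n) p).symm x))
          fun z => Real.exp (τ z) • localHom p φ z) := by
  filter_upwards [eventually_chartTransition_mem hx] with y hy
  ext i j
  rw [coeffs_eq _ hy.1 hy.2.1]
  refine (congrArg (Real.exp (2 * σ _) * ·) (localMetric_localHom hy.2.2 φ φ _ _).symm).trans ?_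
  simp only [hτ _ hy.2.2, gram, Matrix.of_apply, pullForm, ContinuousLinearMap.comp_apply,
    smul_apply, map_smul, smul_eq_mul, two_mul, Real.exp_add]
  ring

theorem injective_localHom_iff (hx : x ∈ localDomain F E p) :
    Function.Injective (localHom (F := F) p φ x)
      ↔ (extChartAt (𝓡 n) p).symm x ∈ regularSet φ := by
  obtain ⟨L, hL⟩ := isInvertible_coordDeriv hx.1
  have e : (localHom (F := F) p φ x : EuclideanSpace ℝ (Fin n) → F)
      = (trivializationAt F E p).continuousLinearMapAt ℝ ((extChartAt (𝓡 n) p).symm x) ∘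
        φ ((extChartAt (𝓡 n) p).symm x) ∘ L := by
    rw [← ContinuousLinearEquiv.coe_coe, hL]; rfl
  rw [e, (continuousLinearMapAt_injective hx.2).of_comp_iff, regularSet, Set.mem_ofPred_eq]
  exact Function.Injective.of_comp_iff' _ L.bijective

variable [ContMDiffVectorBundle ∞ F E (𝓡 n)] [FiniteDimensional ℝ F]
  [IsContMDiffRiemannianBundle (𝓡 n) ∞ F E] {D : CovariantDerivative (𝓡 n) F E}
  {V : Set (EuclideanSpace ℝ (Fin n))}
  {θ : EuclideanSpace ℝ (Fin n) → EuclideanSpace ℝ (Fin n) →L[ℝ] F →L[ℝ] F}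

theorem IsConnectionForm.coherentNear [T2Space M] (hθ : IsConnectionForm D p V θ)
    (h : IsCoherentTangentBundle D φ) (hx : x ∈ V)
    (hreg : (extChartAt (𝓡 n) p).symm x ∈ regularSet φ) :
    CoherentNear (localMetric F E p) θ (localHom p φ) x := by
  have hxd := hθ.subset hx
  have hV := hθ.isOpen.mem_nhds hx
  refine ⟨?_, ?_, ?_, ?_, ?_, Eventually.of_forall fun y => localMetric_symm p y, ?_,
    (injective_localHom_iff hxd).2 hreg⟩
  · exact contDiffAt_infty.1 ((contDiffOn_localMetric p).contDiffAt
      ((isOpen_localDomain p).mem_nhds hxd)) 2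
  · exact contDiffAt_infty.1 (hθ.contDiffOn.contDiffAt hV) 2
  · exact contDiffAt_infty.1 (h.smooth_hom.contDiffAt_localHom hxd) 2
  · filter_upwards [hV] with y hy using hθ.metricAt h.metric_connection hy
  · filter_upwards [hV] with y hy using hθ.coherentAt h hy
  · filter_upwards [hV] with y hy a ha using localMetric_pos (hθ.subset hy) ha

variable {B : EuclideanSpace ℝ (Fin n) →L[ℝ] F}

/-- Any `B` that is symmetric against `φ` and produces the curvature must be the local form of `φ ∘
Â`. This serves both to recognize `ψ` as the conformal Schouten form and to read off the dual from
`DualAt`. -/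
theorem localHom_schoutenHat (hn : 3 ≤ n)
    (hF : Module.finrank ℝ (EuclideanSpace ℝ (Fin n)) = Module.finrank ℝ F)
    (hx : x ∈ localDomain F E p) (h : CoherentNear (localMetric F E p) θ (localHom p φ) x)
    (hB : ∀ u v, localMetric F E p x (localHom p φ x u) (B v)
      = localMetric F E p x (localHom p φ x v) (B u))
    (hR : ∀ u v a, curvForm θ x u v a
      = -kulkarni (localMetric F E p x) (localHom p φ x) B u v a)
    (c : Fin n → ℝ) :
    (trivializationAt F E p).continuousLinearMapAt ℝ ((extChartAt (𝓡 n) p).symm x)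
      (φ _ (schoutenHat (pullbackMetric φ) ((extChartAt (𝓡 n) p).symm x) (ofComponents _ c)))
      = B (fderiv ℝ (chartTransition p ((extChartAt (𝓡 n) p).symm x)) (selfCoord p x)
          (WithLp.toLp 2 c)) := by
  have hfx : chartTransition p ((extChartAt (𝓡 n) p).symm x) (selfCoord p x) = x :=
    chartTransition_self hx.1
  have hf := contDiffAt_infty.1 (contDiffAt_chartTransition_self hx.1) 3
  have hbij := bijective_fderiv_chartTransition hx.1
  have key := CoherentNear.schoutenHat_pullback (y := selfCoord p x)
    (f := chartTransition p ((extChartAt (𝓡 n) p).symm x)) (B := B) hn hF (by rwa [hfx]) hf hbij.1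
    (coeffs_pullbackMetric_eventuallyEq hx φ) (by rwa [hfx]) (by rwa [hfx]) c
  rw [hfx] at key
  rw [← key, schoutenHat, LinearMap.comp_apply, LinearMap.comp_apply, components_ofComponents,
    Matrix.toLin'_apply, ← coordDeriv_fderiv_chartTransition hx.1]
  rfl

theorem schouten_apply_eq_inner (hn : 3 ≤ n)
    (hF : Module.finrank ℝ (EuclideanSpace ℝ (Fin n)) = Module.finrank ℝ F)
    (hx : x ∈ localDomain F E p) (h : CoherentNear (localMetric F E p) θ (localHom p φ) x)
    (hB : ∀ u v, localMetric F E p x (localHom p φ x u) (localHom p ψ x v)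
      = localMetric F E p x (localHom p φ x v) (localHom p ψ x u))
    (hR : ∀ u v a, curvForm θ x u v a
      = -kulkarni (localMetric F E p x) (localHom p φ x) (localHom p ψ x) u v a)
    (v w : TangentSpace (𝓡 n) ((extChartAt (𝓡 n) p).symm x)) :
    schouten (pullbackMetric φ) ((extChartAt (𝓡 n) p).symm x) v w = inner ℝ (φ _ v) (ψ _ w) := by
  have hfx : chartTransition p ((extChartAt (𝓡 n) p).symm x) (selfCoord p x) = x :=
    chartTransition_self hx.1
  have hf := contDiffAt_infty.1 (contDiffAt_chartTransition_self hx.1) 3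
  have hbij := bijective_fderiv_chartTransition hx.1
  have key := CoherentNear.schoutenMatrix_pullback (y := selfCoord p x)
    (f := chartTransition p ((extChartAt (𝓡 n) p).symm x)) (B := localHom p ψ x) hn hF
    (by rwa [hfx]) hf hbij.1
    (coeffs_pullbackMetric_eventuallyEq hx φ) (by rwa [hfx]) (by rwa [hfx])
  rw [hfx] at key
  set df := fderiv ℝ (chartTransition p ((extChartAt (𝓡 n) p).symm x)) (selfCoord p x) with hdf
  have e : ∀ c d : Fin n → ℝ, (schoutenMatrix (coeffs (pullbackMetric φ)
      ((extChartAt (𝓡 n) p).symm x)) (selfCoord p x)).toBilin' c d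
      = localMetric F E p x (localHom p φ x (df (WithLp.toLp 2 c)))
        (localHom p ψ x (df (WithLp.toLp 2 d))) := fun c d => by
    rw [key]
    exact toBilin'_of_apply_single
      ((localMetric F E p x).bilinearComp (localHom p φ x ∘L df) (localHom p ψ x ∘L df)) c d
  rw [← ofComponents_components _ v, ← ofComponents_components _ w,
    ← coordDeriv_fderiv_chartTransition hx.1, ← coordDeriv_fderiv_chartTransition hx.1,
    ← localMetric_localHom hx]
  refine Eq.trans ?_ (e _ _)
  rw [coordDeriv_fderiv_chartTransition hx.1, coordDeriv_fderiv_chartTransition hx.1,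
    ofComponents_components, ofComponents_components]
  rfl

end PullbackMetric

/-! ### The structure equations for a homomorphism and its dual -/

section Duality

variable {n : ℕ}

/-- The equations satisfied by a bundle homomorphism and its dual: `Ψ` is coherent, the Schouten
tensor `⟨Φ, Ψ⟩` is symmetric, and it determines the curvature. -/
structure DualAt {F : Type*} [NormedAddCommGroup F] [NormedSpace ℝ F]
    (H : EuclideanSpace ℝ (Fin n) → F →L[ℝ] F →L[ℝ] ℝ)
    (θ : EuclideanSpace ℝ (Fin n) → EuclideanSpace ℝ (Fin n) →L[ℝ] F →L[ℝ] F)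
    (Φ Ψ : EuclideanSpace ℝ (Fin n) → EuclideanSpace ℝ (Fin n) →L[ℝ] F)
    (x : EuclideanSpace ℝ (Fin n)) : Prop where
  coherent : CoherentAt θ Ψ x
  symm : ∀ u v, H x (Φ x u) (Ψ x v) = H x (Φ x v) (Ψ x u)
  curv : ∀ u v a, curvForm θ x u v a = -kulkarni (H x) (Φ x) (Ψ x) u v a

theorem DualAt.congr {F : Type*} [NormedAddCommGroup F] [NormedSpace ℝ F]
    {H : EuclideanSpace ℝ (Fin n) → F →L[ℝ] F →L[ℝ] ℝ}
    {θ : EuclideanSpace ℝ (Fin n) → EuclideanSpace ℝ (Fin n) →L[ℝ] F →L[ℝ] F}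
    {Φ Ψ Ψ' : EuclideanSpace ℝ (Fin n) → EuclideanSpace ℝ (Fin n) →L[ℝ] F}
    {x : EuclideanSpace ℝ (Fin n)} (h : DualAt H θ Φ Ψ x) (he : Ψ' =ᶠ[𝓝 x] Ψ) :
    DualAt H θ Φ Ψ' x := by
  refine ⟨fun u v => ?_, ?_, ?_⟩
  · rw [he.fderiv_eq, he.eq_of_nhds]
    exact h.coherent u v
  · rw [he.eq_of_nhds]
    exact h.symm
  · rw [he.eq_of_nhds]
    exact h.curv

theorem DualAt.swap {F : Type*} [NormedAddCommGroup F] [NormedSpace ℝ F]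
    {H : EuclideanSpace ℝ (Fin n) → F →L[ℝ] F →L[ℝ] ℝ}
    {θ : EuclideanSpace ℝ (Fin n) → EuclideanSpace ℝ (Fin n) →L[ℝ] F →L[ℝ] F}
    {Φ Ψ : EuclideanSpace ℝ (Fin n) → EuclideanSpace ℝ (Fin n) →L[ℝ] F}
    {x : EuclideanSpace ℝ (Fin n)} (h : DualAt H θ Φ Ψ x) (hs : ∀ a b, H x a b = H x b a)
    (hc : CoherentAt θ Φ x) : DualAt H θ Ψ Φ x :=
  ⟨hc, fun u v => by rw [hs, h.symm, hs], fun u v a => by rw [h.curv, kulkarni_comm]⟩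

variable {M : Type*} [TopologicalSpace M] [ChartedSpace (EuclideanSpace ℝ (Fin n)) M]

theorem frequently_extChartAt_symm_mem {R : Set M} (hR : Dense R) {p : M}
    {x : EuclideanSpace ℝ (Fin n)} (hx : x ∈ (extChartAt (𝓡 n) p).target) :
    ∃ᶠ y in 𝓝 x, (extChartAt (𝓡 n) p).symm y ∈ R := by
  intro h
  have hs := (extChartAt (𝓡 n) p).map_target hx
  refine mem_closure_iff_frequently.1 (hR ((extChartAt (𝓡 n) p).symm x)) ?_
  have hc := continuousAt_extChartAt' (I := 𝓡 n) hs
  rw [← (extChartAt (𝓡 n) p).right_inv hx] at h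
  filter_upwards [hc.eventually h, (isOpen_extChartAt_source p).mem_nhds hs] with q hq hqs
  rwa [(extChartAt (𝓡 n) p).left_inv hqs] at hq

variable [IsManifold (𝓡 n) ∞ M] {p : M} {x : EuclideanSpace ℝ (Fin n)}
  {F : Type*} [NormedAddCommGroup F] [NormedSpace ℝ F]
  {E : M → Type*} [TopologicalSpace (TotalSpace F E)]
  [∀ p, NormedAddCommGroup (E p)] [∀ p, InnerProductSpace ℝ (E p)]
  [FiberBundle F E] [VectorBundle ℝ F E]
  {φ ψ : ∀ q : M, TangentSpace (𝓡 n) q →L[ℝ] E q}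
  [ContMDiffVectorBundle ∞ F E (𝓡 n)] [FiniteDimensional ℝ F]
  [IsContMDiffRiemannianBundle (𝓡 n) ∞ F E] {D : CovariantDerivative (𝓡 n) F E}
  {V : Set (EuclideanSpace ℝ (Fin n))}
  {θ : EuclideanSpace ℝ (Fin n) → EuclideanSpace ℝ (Fin n) →L[ℝ] F →L[ℝ] F}

theorem localHom_eq_iff (hx : x ∈ localDomain F E p) :
    localHom (F := F) p φ x = localHom p ψ x
      ↔ φ ((extChartAt (𝓡 n) p).symm x) = ψ ((extChartAt (𝓡 n) p).symm x) := by
  refine ⟨fun h => ContinuousLinearMap.ext fun v => ?_, fun h => by rw [localHom, h, localHom]⟩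
  obtain ⟨L, hL⟩ := isInvertible_coordDeriv hx.1
  have hv : coordDeriv p x (L.symm v) = v := by rw [← hL]; exact L.apply_symm_apply v
  have h2 := congrArg (fun T => T (L.symm v)) h
  simp only [localHom_apply, hv] at h2
  exact continuousLinearMapAt_injective hx.2 h2

theorem IsSmoothHom.eq_of_dense (hφ : IsSmoothHom F φ) (hψ : IsSmoothHom F ψ) {R : Set M}
    (hR : Dense R) (h : ∀ q ∈ R, φ q = ψ q) : φ = ψ := by
  funext p
  have hx := mem_localDomain (F := F) (E := E) (n := n) p
  have key : localHom (F := F) p φ (extChartAt (𝓡 n) p p)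
      = localHom p ψ (extChartAt (𝓡 n) p p) := by
    refine tendsto_nhds_unique_of_frequently_eq (hφ.contDiffAt_localHom hx).continuousAt
      (hψ.contDiffAt_localHom hx).continuousAt ?_
    refine ((frequently_extChartAt_symm_mem hR hx.1).and_eventually
      ((isOpen_localDomain p).mem_nhds hx)).mono fun y hy => ?_
    exact (localHom_eq_iff hy.2).2 (h _ hy.1)
  rw [localHom_eq_iff hx, extChartAt_to_inv] at key
  exact key

theorem IsDual.unique {χ : ∀ q : M, TangentSpace (𝓡 n) q →L[ℝ] E q} (hR : Dense (regularSet φ))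
    (hψ : IsDual F φ ψ) (hχ : IsDual F φ χ) : ψ = χ :=
  hψ.1.eq_of_dense hχ.1 hR fun q hq => ContinuousLinearMap.ext fun v => by
    rw [hψ.2 q hq, hχ.2 q hq]

variable [T2Space M]

/-- The conformal factor exists only near a regular point. There its gradient defines
`confSchouten`, which equals the local form of `ψ` on a neighbourhood; equality of germs is needed
because closedness involves a derivative. -/
theorem IsGCF.dualAt_of_mem_regularSet (hn : 3 ≤ n)
    (hF : Module.finrank ℝ (EuclideanSpace ℝ (Fin n)) = Module.finrank ℝ F) (h : IsGCF D φ)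
    (hψ : IsDual F φ ψ) (hθ : IsConnectionForm D p V θ) (hx : x ∈ V)
    (hreg : (extChartAt (𝓡 n) p).symm x ∈ regularSet φ) :
    DualAt (localMetric F E p) θ (localHom p φ) (localHom p ψ) x := by
  have hxd := hθ.subset hx
  obtain ⟨U, hU, hxU, hUR, σ, hσ, hsec⟩ := h.conformallyFlat _ hreg
  have hN := hθ.coherentNear h.isCoherentTangentBundle hx hreg
  have hUx : ∀ᶠ y in 𝓝 x, (extChartAt (𝓡 n) p).symm y ∈ U :=
    (continuousAt_extChartAt_symm'' hxd.1).eventually (hU.mem_nhds hxU)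
  set τ : EuclideanSpace ℝ (Fin n) → ℝ := fun y => σ ((extChartAt (𝓡 n) p).symm y) with hτ
  have hτx : ContDiffAt ℝ ∞ τ x :=
    (ContMDiffAt.comp x (hσ.contMDiffAt (hU.mem_nhds hxU))
      ((contMDiffOn_extChartAt_symm p).contMDiffAt
        ((isOpen_extChartAt_target p).mem_nhds hxd.1))).contDiffAt
  obtain ⟨ξ, hξ, hgrad⟩ := hN.exists_gradient hF (contDiffAt_infty.1 hτx 3)
  have hflat : ∀ᶠ y in 𝓝 x, ∀ u v,
      curvForm (confForm (localMetric F E p) θ (localHom p φ) ξ) y u v = 0 := by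
    filter_upwards [((hN.conformal (contDiffAt_infty.1 hτx 2) hξ hgrad).eventually hF), hUx,
      hθ.isOpen.mem_nhds hx] with y hy hyU hyV
    have hyd := hθ.subset hyV
    have hfy : chartTransition p ((extChartAt (𝓡 n) p).symm y) (selfCoord p y) = y :=
      chartTransition_self hyd.1
    have key := CoherentNear.curvForm_eq_zero_of_pullback (y := selfCoord p y) hF
      (by rwa [hfy]) (contDiffAt_infty.1 (contDiffAt_chartTransition_self hyd.1) 3)
      (bijective_fderiv_chartTransition hyd.1)
      (coeffs_conformal_eventuallyEq hyd φ (σ := σ) (τ := τ) fun z _ => rfl)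
      fun a b hab => ?_
    · rwa [hfy] at key
    · have := hsec _ hyU (ofComponents _ a) (ofComponents _ b) ?_
      · rwa [sectionalCurvature, components_ofComponents, components_ofComponents] at this
      · rw [LinearIndependent.pair_iff] at hab ⊢
        intro s t hst
        refine hab s t (Function.LeftInverse.injective (components_ofComponents (n := n)
          ((extChartAt (𝓡 n) p).symm y)) ?_)
        rw [map_add, map_smul, map_smul, map_zero]
        exact hst
  have hB : ∀ᶠ y in 𝓝 x,
      localHom p ψ y = confSchouten (localMetric F E p) θ (localHom p φ) ξ y := by
    filter_upwards [hN.eventually hF, hflat, eventually_eventually_nhds.2 hgrad, hUx,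
      hθ.isOpen.mem_nhds hx, hξ.eventually (by simp),
      (contDiffAt_infty.1 hτx 2).eventually (by simp)] with y hy hyf hyg hyU hyV hyξ hyτ
    have hyd := hθ.subset hyV
    refine ContinuousLinearMap.ext fun u => ?_
    -- Every coordinate vector comes from components in the point's own chart, where the Schouten
    -- endomorphism is defined.
    obtain ⟨c, rfl⟩ := (bijective_fderiv_chartTransition hyd.1).2 u
    have e := localHom_schoutenHat hn hF hyd hy
      (hy.confSchouten_symm hyτ (hyξ.differentiableAt (by norm_num)) hyg)
      (hy.curvForm_eq_neg_kulkarni (hyξ.differentiableAt (by norm_num)) hyf) (WithLp.ofLp c)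
    rw [← hψ.2 _ (hUR hyU), ← coordDeriv_fderiv_chartTransition hyd.1] at e
    exact e
  have hξ1 := hξ.differentiableAt (by norm_num)
  exact DualAt.congr ⟨hN.coherentAt_confSchouten (contDiffAt_infty.1 hτx 2) hξ hgrad
    hflat.self_of_nhds, hN.confSchouten_symm (contDiffAt_infty.1 hτx 2) hξ1 hgrad,
    hN.curvForm_eq_neg_kulkarni hξ1 hflat.self_of_nhds⟩ hB

/-- Each equation equates two continuous functions of the point, since `ψ` is smooth across singular
points; they agree on the dense regular set, hence on all of `V`. -/
theorem IsGCF.dualAt (hn : 3 ≤ n)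
    (hF : Module.finrank ℝ (EuclideanSpace ℝ (Fin n)) = Module.finrank ℝ F) (h : IsGCF D φ)
    (hψ : IsDual F φ ψ) (hθ : IsConnectionForm D p V θ) (hx : x ∈ V) :
    DualAt (localMetric F E p) θ (localHom p φ) (localHom p ψ) x := by
  have hxd := hθ.subset hx
  have hfreq : ∃ᶠ y in 𝓝 x,
      DualAt (localMetric F E p) θ (localHom p φ) (localHom p ψ) y := by
    refine ((frequently_extChartAt_symm_mem h.dense_regularSet hxd.1).and_eventually
      (hθ.isOpen.mem_nhds hx)).mono fun y hy => ?_
    exact h.dualAt_of_mem_regularSet hn hF hψ hθ hy.2 hy.1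
  have hΦ := h.isCoherentTangentBundle.smooth_hom.contDiffAt_localHom hxd
  have hΨ := hψ.1.contDiffAt_localHom hxd
  have hH := (contDiffOn_localMetric (n := n) (F := F) (E := E) p).contDiffAt
    ((isOpen_localDomain p).mem_nhds hxd)
  have hθx := hθ.contDiffOn.contDiffAt (hθ.isOpen.mem_nhds hx)
  have cH := hH.continuousAt
  have cΦ := hΦ.continuousAt
  have cΨ := hΨ.continuousAt
  have cθ := hθx.continuousAt
  have cdΨ := (hΨ.fderiv_right (m := 0) (by simp)).continuousAt
  have cdθ := (hθx.fderiv_right (m := 0) (by simp)).continuousAt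
  refine ⟨fun u v => ?_, fun u v => ?_, fun u v a => ?_⟩
  · refine tendsto_nhds_unique_of_frequently_eq
      (f := fun y => fderiv ℝ (localHom p ψ) y u v + θ y u (localHom p ψ y v))
      (g := fun y => fderiv ℝ (localHom p ψ) y v u + θ y v (localHom p ψ y u)) ?_ ?_
      (hfreq.mono fun y hy => hy.coherent u v) <;>
    exact ContinuousAt.tendsto (by fun_prop)
  · refine tendsto_nhds_unique_of_frequently_eq
      (f := fun y => localMetric F E p y (localHom p φ y u) (localHom p ψ y v))
      (g := fun y => localMetric F E p y (localHom p φ y v) (localHom p ψ y u)) ?_ ?_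
      (hfreq.mono fun y hy => hy.symm u v) <;>
    exact ContinuousAt.tendsto (by fun_prop)
  · refine tendsto_nhds_unique_of_frequently_eq (f := fun y => curvForm θ y u v a)
      (g := fun y => -kulkarni (localMetric F E p y) (localHom p φ y) (localHom p ψ y) u v a) ?_ ?_
      (hfreq.mono fun y hy => hy.curv u v a) <;>
    refine ContinuousAt.tendsto ?_
    · simp only [curvForm, add_apply, sub_apply, ContinuousLinearMap.comp_apply]
      fun_prop
    · simp only [kulkarni]
      fun_prop

theorem IsGCF.isCoherentTangentBundle_dual (hn : 3 ≤ n)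
    (hF : Module.finrank ℝ (EuclideanSpace ℝ (Fin n)) = Module.finrank ℝ F) (h : IsGCF D φ)
    (hψ : IsDual F φ ψ) : IsCoherentTangentBundle D ψ := by
  have hc := h.isCoherentTangentBundle
  refine ⟨hc.smooth_connection, hc.metric_connection, hψ.1, fun X Y hX hY p => ?_⟩
  obtain ⟨V, θ, hθ⟩ := exists_isConnectionForm D hc.smooth_connection p
  exact hθ.coherent_apply hψ.1 (h.dualAt hn hF hψ hθ hθ.mem).coherent hX hY

/-- The Schouten tensor of `φ` is `⟨φ, ψ⟩`, so a vector killed by `ψ` lies in its right radical and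
`ψ` is injective. The Schouten tensor of `ψ` is then the transpose, equally non-degenerate. -/
theorem IsConnectionForm.mem_nonparabolicSet (hn : 3 ≤ n)
    (hF : Module.finrank ℝ (EuclideanSpace ℝ (Fin n)) = Module.finrank ℝ F)
    (hθ : IsConnectionForm D p V θ) (hx : x ∈ V) (hφ : IsCoherentTangentBundle D φ)
    (hψ : IsCoherentTangentBundle D ψ)
    (hd : DualAt (localMetric F E p) θ (localHom p φ) (localHom p ψ) x)
    (h : (extChartAt (𝓡 n) p).symm x ∈ nonparabolicSet φ) :
    (extChartAt (𝓡 n) p).symm x ∈ nonparabolicSet ψ := by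
  have hxd := hθ.subset hx
  have e1 := schouten_apply_eq_inner hn hF hxd (hθ.coherentNear hφ hx h.1) hd.symm hd.curv
  have hreg : (extChartAt (𝓡 n) p).symm x ∈ regularSet ψ := by
    refine (injective_iff_map_eq_zero _).2 fun w hw => h.2.2 w fun v => ?_
    rw [e1, hw, inner_zero_right]
  have hs := hd.swap (localMetric_symm p x) (hθ.coherentAt hφ hx)
  have e2 := schouten_apply_eq_inner hn hF hxd (hθ.coherentNear hψ hx hreg) hs.symm hs.curv
  have e : ∀ v w, schouten (pullbackMetric ψ) ((extChartAt (𝓡 n) p).symm x) v w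
      = schouten (pullbackMetric φ) ((extChartAt (𝓡 n) p).symm x) w v := fun v w => by
    rw [e1, e2, real_inner_comm]
  exact ⟨hreg, fun v hv => h.2.2 v fun w => by rw [← e, hv],
    fun v hv => h.2.1 v fun w => by rw [← e, hv]⟩

theorem IsConnectionForm.apply_eq_schoutenHat (hn : 3 ≤ n)
    (hF : Module.finrank ℝ (EuclideanSpace ℝ (Fin n)) = Module.finrank ℝ F)
    (hθ : IsConnectionForm D p V θ) (hx : x ∈ V) (hφ : IsCoherentTangentBundle D φ)
    (hd : DualAt (localMetric F E p) θ (localHom p φ) (localHom p ψ) x)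
    (hreg : (extChartAt (𝓡 n) p).symm x ∈ regularSet φ)
    (v : TangentSpace (𝓡 n) ((extChartAt (𝓡 n) p).symm x)) :
    ψ _ v = φ _ (schoutenHat (pullbackMetric φ) _ v) := by
  have hxd := hθ.subset hx
  have e := localHom_schoutenHat hn hF hxd (hθ.coherentNear hφ hx hreg) hd.symm hd.curv
    (components _ v)
  refine continuousLinearMapAt_injective hxd.2 ?_
  rw [localHom_apply, selfCoord, coordDeriv_fderiv_chartTransition hxd.1,
    ofComponents_components] at e
  exact e.symm

end Duality

/-! ### Conformal flatness and admissibility of the dual -/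

section Biduality

variable {n : ℕ} {M : Type*} [TopologicalSpace M] [T2Space M]
  [ChartedSpace (EuclideanSpace ℝ (Fin n)) M] [IsManifold (𝓡 n) ∞ M]
  {F : Type*} [NormedAddCommGroup F] [NormedSpace ℝ F] [FiniteDimensional ℝ F]
  {E : M → Type*} [TopologicalSpace (TotalSpace F E)]
  [∀ p, NormedAddCommGroup (E p)] [∀ p, InnerProductSpace ℝ (E p)]
  [FiberBundle F E] [VectorBundle ℝ F E] [ContMDiffVectorBundle ∞ F E (𝓡 n)]
  [IsContMDiffRiemannianBundle (𝓡 n) ∞ F E] {D : CovariantDerivative (𝓡 n) F E}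
  {φ ψ : ∀ q : M, TangentSpace (𝓡 n) q →L[ℝ] E q} {p : M} {x : EuclideanSpace ℝ (Fin n)}
  {V : Set (EuclideanSpace ℝ (Fin n))}
  {θ : EuclideanSpace ℝ (Fin n) → EuclideanSpace ℝ (Fin n) →L[ℝ] F →L[ℝ] F}

theorem IsConnectionForm.exists_flat
    (hF : Module.finrank ℝ (EuclideanSpace ℝ (Fin n)) = Module.finrank ℝ F)
    (hθ : IsConnectionForm D p V θ) (hx : x ∈ V) (hφ : IsCoherentTangentBundle D φ)
    (hψ : IsCoherentTangentBundle D ψ)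
    (hd : ∀ y ∈ V, DualAt (localMetric F E p) θ (localHom p φ) (localHom p ψ) y)
    (hreg : (extChartAt (𝓡 n) p).symm x ∈ regularSet φ) :
    ∃ (N : Set (EuclideanSpace ℝ (Fin n))) (τ : EuclideanSpace ℝ (Fin n) → ℝ)
      (η : EuclideanSpace ℝ (Fin n) → EuclideanSpace ℝ (Fin n) →L[ℝ] F →L[ℝ] F),
      IsOpen N ∧ x ∈ N ∧ N ⊆ V ∧ (∀ y ∈ N, (extChartAt (𝓡 n) p).symm y ∈ regularSet φ) ∧
      ContDiffOn ℝ ∞ τ N ∧ ∀ y ∈ N,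
        CoherentNear (localMetric F E p) η (fun z => Real.exp (τ z) • localHom p φ z) y ∧
        ∀ u v, curvForm η y u v = 0 := by
  have hN := hθ.coherentNear hφ hx hreg
  have hV : ∀ᶠ y in 𝓝 x, y ∈ V := hθ.isOpen.mem_nhds hx
  obtain ⟨τ, ξ, hτ, hξ, hgrad, hflat⟩ := hN.exists_flat (Ψ := localHom p ψ)
    (hV.mono fun y hy => (contDiffOn_localMetric p).contDiffAt
      ((isOpen_localDomain p).mem_nhds (hθ.subset hy)))
    (hV.mono fun y hy => hθ.contDiffOn.contDiffAt (hθ.isOpen.mem_nhds hy))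
    (hV.mono fun y hy => hφ.smooth_hom.contDiffAt_localHom (hθ.subset hy))
    (hV.mono fun y hy => hψ.smooth_hom.contDiffAt_localHom (hθ.subset hy))
    (hV.mono fun y hy => (hd y hy).coherent) (hV.mono fun y hy => (hd y hy).symm)
    (hV.mono fun y hy => (hd y hy).curv)
  have hC := hN.conformal (contDiffAt_infty.1 hτ.self_of_nhds 2) hξ.self_of_nhds hgrad
  obtain ⟨N, hN1, hN2, hN3⟩ := mem_nhds_iff.1
    (hV.and (hτ.and ((hN.eventually hF).and ((hC.eventually hF).and hflat))))
  refine ⟨N, τ, _, hN2, hN3, fun y hy => (hN1 hy).1, fun y hy => ?_,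
    fun y hy => (hN1 hy).2.1.contDiffWithinAt, fun y hy => (hN1 hy).2.2.2⟩
  exact (injective_localHom_iff (hθ.subset (hN1 hy).1)).1 (hN1 hy).2.2.1.injective

/-- Used below with the roles of the two homomorphisms exchanged: the equations around a regular
point yield a flat conformal change in coordinates, whose exponent is transported to `M` by the
chart. -/
theorem isConformallyFlatOn_of_dualAt
    (hF : Module.finrank ℝ (EuclideanSpace ℝ (Fin n)) = Module.finrank ℝ F)
    (hφ : IsCoherentTangentBundle D φ) (hψ : IsCoherentTangentBundle D ψ)
    (hd : ∀ p V θ, IsConnectionForm D p V θ → ∀ y ∈ V,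
      DualAt (localMetric F E p) θ (localHom p φ) (localHom p ψ) y) :
    IsConformallyFlatOn (pullbackMetric φ) (regularSet φ) := by
  intro p hp
  obtain ⟨V, θ, hθ⟩ := exists_isConnectionForm D hφ.smooth_connection p
  obtain ⟨N, τ, η, hNo, hpN, hNV, hNR, hτ, hη⟩ := hθ.exists_flat hF hθ.mem hφ hψ
    (hd p V θ hθ) (by rwa [extChartAt_to_inv])
  refine ⟨(extChartAt (𝓡 n) p).source ∩ extChartAt (𝓡 n) p ⁻¹' N,
    (continuousOn_extChartAt p).isOpen_inter_preimage (isOpen_extChartAt_source p) hNo,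
    ⟨mem_extChartAt_source p, hpN⟩, fun q hq => ?_, fun q => τ (extChartAt (𝓡 n) p q), ?_,
    fun q hq v w _ => ?_⟩
  · have := hNR _ hq.2
    rwa [(extChartAt (𝓡 n) p).left_inv hq.1] at this
  · refine ContMDiffOn.comp (t := N) hτ.contMDiffOn ?_ fun q hq => hq.2
    exact (contMDiffOn_extChartAt (I := 𝓡 n)).mono fun q hq => by
      rw [← extChartAt_source (𝓡 n)]; exact hq.1
  · obtain ⟨y, hy, rfl⟩ : ∃ y ∈ N ∩ (extChartAt (𝓡 n) p).target,
        (extChartAt (𝓡 n) p).symm y = q :=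
      ⟨_, ⟨hq.2, (extChartAt (𝓡 n) p).map_source hq.1⟩, (extChartAt (𝓡 n) p).left_inv hq.1⟩
    have hyd := hθ.subset (hNV hy.1)
    have hfy : chartTransition p ((extChartAt (𝓡 n) p).symm y) (selfCoord p y) = y :=
      chartTransition_self hyd.1
    exact CoherentNear.sectionalCoord_pullback_eq_zero (y := selfCoord p y) hF
      (by rw [hfy]; exact (hη y hy.1).1)
      (contDiffAt_infty.1 (contDiffAt_chartTransition_self hyd.1) 3)
      (bijective_fderiv_chartTransition hyd.1).1
      (coeffs_conformal_eventuallyEq hyd φ (τ := τ) fun z hz => by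
        rw [(extChartAt (𝓡 n) p).right_inv hz.1])
      (by rw [hfy]; exact (hη y hy.1).2) _ _

theorem IsGCF.nonparabolicSet_subset (hn : 3 ≤ n)
    (hF : Module.finrank ℝ (EuclideanSpace ℝ (Fin n)) = Module.finrank ℝ F)
    (h : IsGCF D φ) (hψ : IsDual F φ ψ) : nonparabolicSet φ ⊆ nonparabolicSet ψ := by
  intro p hp
  have hc := h.isCoherentTangentBundle
  obtain ⟨V, θ, hθ⟩ := exists_isConnectionForm D hc.smooth_connection p
  have := hθ.mem_nonparabolicSet hn hF hθ.mem hc (h.isCoherentTangentBundle_dual hn hF hψ)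
    (h.dualAt hn hF hψ hθ hθ.mem) (by rwa [extChartAt_to_inv])
  rwa [extChartAt_to_inv] at this

/-- The swapped equations hold at all points of `M`, so the dual is identified at every regular
point of `ψ`, including those where `φ` is singular. -/
theorem IsGCF.isDual_swap (hn : 3 ≤ n)
    (hF : Module.finrank ℝ (EuclideanSpace ℝ (Fin n)) = Module.finrank ℝ F)
    (h : IsGCF D φ) (hψ : IsDual F φ ψ) : IsDual F ψ φ := by
  have hc := h.isCoherentTangentBundle
  refine ⟨hc.smooth_hom, fun p hp => ?_⟩
  obtain ⟨V, θ, hθ⟩ := exists_isConnectionForm D hc.smooth_connection p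
  have := hθ.apply_eq_schoutenHat hn hF hθ.mem (h.isCoherentTangentBundle_dual hn hF hψ)
    ((h.dualAt hn hF hψ hθ hθ.mem).swap (localMetric_symm p _) (hθ.coherentAt hc hθ.mem))
    (by rwa [extChartAt_to_inv])
  rwa [extChartAt_to_inv] at this

theorem IsAdmissibleGCF.dual (hn : 3 ≤ n)
    (hF : Module.finrank ℝ (EuclideanSpace ℝ (Fin n)) = Module.finrank ℝ F)
    (h : IsAdmissibleGCF D φ) (hψ : IsDual F φ ψ) : IsAdmissibleGCF D ψ := by
  have hc := h.isCoherentTangentBundle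
  have hcψ := h.toIsGCF.isCoherentTangentBundle_dual hn hF hψ
  have hd : Dense (nonparabolicSet ψ) :=
    h.dense_nonparabolicSet.mono (IsGCF.nonparabolicSet_subset hn hF h.toIsGCF hψ)
  exact
    { isCoherentTangentBundle := hcψ
      dense_regularSet := hd.mono fun _ hq => hq.1
      conformallyFlat := isConformallyFlatOn_of_dualAt hF hcψ hc fun p V θ hθ y hy =>
        (h.toIsGCF.dualAt hn hF hψ hθ hy).swap (localMetric_symm p _) (hθ.coherentAt hc hy)
      dense_nonparabolicSet := hd
      exists_dual := ⟨φ, h.toIsGCF.isDual_swap hn hF hψ⟩ }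

end Biduality

end GCF

end

/-! ### Existence, uniqueness and involutivity of the dual -/

theorem theorem2 {n : ℕ} (hn : 3 ≤ n)
    {M : Type*} [TopologicalSpace M] [T2Space M] [SecondCountableTopology M]
    [ChartedSpace (EuclideanSpace ℝ (Fin n)) M] [IsManifold (𝓡 n) ∞ M]
    {F : Type*} [NormedAddCommGroup F] [NormedSpace ℝ F] [FiniteDimensional ℝ F]
    (hF : Module.finrank ℝ F = n)
    {E : M → Type*} [TopologicalSpace (TotalSpace F E)]
    [∀ p, NormedAddCommGroup (E p)] [∀ p, InnerProductSpace ℝ (E p)]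
    [FiberBundle F E] [VectorBundle ℝ F E] [ContMDiffVectorBundle ∞ F E (𝓡 n)]
    [IsContMDiffRiemannianBundle (𝓡 n) ∞ F E]
    (D : CovariantDerivative (𝓡 n) F E)
    (φ : ∀ p : M, TangentSpace (𝓡 n) p →L[ℝ] E p)
    (h : GCF.IsAdmissibleGCF D φ) :
    (∃! ψ : ∀ p : M, TangentSpace (𝓡 n) p →L[ℝ] E p, GCF.IsDual F φ ψ) ∧
    ∀ ψ : ∀ p : M, TangentSpace (𝓡 n) p →L[ℝ] E p, GCF.IsDual F φ ψ →
      GCF.IsAdmissibleGCF D ψ ∧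
      ∀ χ : ∀ p : M, TangentSpace (𝓡 n) p →L[ℝ] E p, GCF.IsDual F ψ χ ↔ χ = φ := by
  have hF' : Module.finrank ℝ (EuclideanSpace ℝ (Fin n)) = Module.finrank ℝ F := by simp [hF]
  obtain ⟨ψ₀, hψ₀⟩ := h.exists_dual
  refine ⟨⟨ψ₀, hψ₀, fun χ hχ => GCF.IsDual.unique h.dense_regularSet hχ hψ₀⟩, fun ψ hψ => ?_⟩
  have hA := h.dual hn hF' hψ
  have hφ := h.toIsGCF.isDual_swap hn hF' hψ
  refine ⟨hA, fun χ => ⟨fun hχ => GCF.IsDual.unique hA.dense_regularSet hχ hφ, ?_⟩⟩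
  rintro rfl
  exact hφ
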